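/- Let $N$ (agents, nonempty) and $M$ (divisible items) be finite sets. Agent $i$ owns $W_{ij}\ge 0$ units of item $j$, with $\sum_{i} W_{ij}=1$ for every $j$. Agent $i$ has the separable piecewise linear concave (SPLC) utility $u_i(y)=\sum_j u_{ij}(y_j)$ on $\mathbb{R}^M_{\ge 0}$, where $u_{ij}(0)=0$ and $u_{ij}$ has finitely many linear segments with strictly decreasing slopes $U_{ij1}>U_{ij2}>\cdots$, which are either all $\ge 0$ or all $\le 0$; the $k$-th segment has length $L_{ijk}\in(0,\infty)$, except that the last one has infinite length. Item $j$ is a good if $U_{ij1}>0$ for some $i$, and a bad otherwise. Assume that $\sum_{i}\sum_{k:\,U_{ijk}>0}L_{ijk}>1$ for every good $j$, and that $\sum_{i:\,U_{ij1}=0}L_{ij1}<1$ for every bad $j$. A competitive equilibrium consists of prices $p\in\mathbb{R}^M$ and an allocation $x\in\mathbb{R}_{\ge0}^{N\times M}$ such that for every $i$ the bundle $x_i$ maximizes $u_i(y)$ subject to $y\ge 0$ and $\sum_j y_jp_j\le\sum_j W_{ij}p_j$, and $\sum_i x_{ij}=\sum_i W_{ij}$ for every $j$. Equilibria $(p,x)$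 and $(\alpha p,x)$ with $\alpha>0$ are the same up to scaling. Suppose that the instance is strongly connected: every agent owns a positive amount of some good and a positive amount of some bad, and the directed graph on $N$ with an edge from $i$ to $i'$ whenever there is a good $l$ such that the last segment of $u_{il}$ has positive slope and $W_{i'l}>0$ is strongly connected. Suppose also that the parameters (all $W_{ij}$, the nonzero $U_{ijk}$, and the finite $L_{ijk}$) have no polynomial relation, that is, every polynomial with rational coefficients that vanishes at them vanishes at all real values of these parameters that satisfy the normalization $\sum_i W_{ij}=1$ for all $j$. Then the number of competitive equilibria up to scaling is finite and odd. -/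

import Mathlib

/-- A mixed-manna exchange instance with separable piecewise linear concave (SPLC) utilities.
`N` is the set of agents and `M` the set of divisible items. Agent `i` owns `W i j` units of
item `j`; one unit of every item is available in total. The function `u i j` has `K i j + 1`
linear segments, numbered from `0`; `U i j k` is the slope of the `k`-th segment, `L i j k` is
the length of the `k`-th segment when it is not the last one, and the last segment has infinite
length. -/
structure MannaInstance (N M : Type*) [Fintype N] [Fintype M] where
  W : N → M → ℝ
  K : N → M → ℕ
  U : (i : N) → (j : M) → Fin (K i j + 1) → ℝ
  L : (i : N) → (j : M) → Fin (K i j) → ℝ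
  W_nonneg : ∀ i j, 0 ≤ W i j
  supply : ∀ j, ∑ i, W i j = 1
  L_pos : ∀ i j k, 0 < L i j k
  /-- Concavity: slopes strictly decrease from one segment to the next. -/
  U_strictAnti : ∀ i j, StrictAnti (U i j)
  /-- Each `u i j` is either nonnegative and increasing or nonpositive and decreasing. -/
  U_sign : ∀ i j, (∀ k, 0 ≤ U i j k) ∨ (∀ k, U i j k ≤ 0)

namespace MannaInstance

variable {N M : Type*} [Fintype N] [Fintype M]

/-- The left end point of segment `k` of `u i j`. -/
noncomputable def segStart (I : MannaInstance N M) (i : N) (j : M) (k : Fin (I.K i j + 1)) : ℝ :=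
  ∑ l : Fin (I.K i j) with l.val < k.val, I.L i j l

/-- The piecewise linear function `u i j`: slope times the part of `[0, t]` that lies in the
segment, summed over all segments. -/
noncomputable def itemUtility (I : MannaInstance N M) (i : N) (j : M) (t : ℝ) : ℝ :=
  (∑ k : Fin (I.K i j),
      I.U i j k.castSucc * min (I.L i j k) (max 0 (t - I.segStart i j k.castSucc)))
    + I.U i j (Fin.last _) * max 0 (t - I.segStart i j (Fin.last _))

/-- Utility of agent `i` for the bundle `y`. -/
noncomputable def utility (I : MannaInstance N M) (i : N) (y : M → ℝ) : ℝ :=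
  ∑ j, I.itemUtility i j (y j)

/-- The length of segment `k` of `u i j`, infinite for the last segment. -/
noncomputable def segLength (I : MannaInstance N M) (i : N) (j : M) (k : Fin (I.K i j + 1)) :
    ENNReal :=
  if h : k.val < I.K i j then ENNReal.ofReal (I.L i j ⟨k.val, h⟩) else ⊤

/-- An item is a good if some agent gets positive utility from it. -/
def IsGood (I : MannaInstance N M) (j : M) : Prop := ∃ i, 0 < I.U i j 0

/-- An item is a bad if no agent gets positive utility from it. -/
def IsBad (I : MannaInstance N M) (j : M) : Prop := ∀ i, I.U i j 0 ≤ 0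

open Classical in
/-- The maximum possible demand for the good `j` at a positive price. -/
noncomputable def desire (I : MannaInstance N M) (j : M) : ENNReal :=
  ∑ i, ∑ k with 0 < I.U i j k, I.segLength i j k

open Classical in
/-- The maximum amount of the bad `j` that can be assigned at no loss of utility. -/
noncomputable def indifference (I : MannaInstance N M) (j : M) : ENNReal :=
  ∑ i with I.U i j 0 = 0, I.segLength i j 0

/-- Agent `i` is non-satiated for `j` if the last segment of `u i j` has positive slope. -/
def NonSatiated (I : MannaInstance N M) (i : N) (j : M) : Prop := 0 < I.U i j (Fin.last _)

/-- Edge `i → i'` of the economy graph: `i` is non-satiated for some good that `i'` brings. -/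
def EconomyEdge (I : MannaInstance N M) (i i' : N) : Prop :=
  ∃ l, I.IsGood l ∧ I.NonSatiated i l ∧ 0 < I.W i' l

/-- Strong connectivity of an instance: every agent brings a positive amount of some good and of
some bad, and the economy graph is strongly connected. -/
structure StronglyConnected (I : MannaInstance N M) : Prop where
  brings_good : ∀ i, ∃ j, I.IsGood j ∧ 0 < I.W i j
  brings_bad : ∀ i, ∃ j, I.IsBad j ∧ 0 < I.W i j
  connected : ∀ i i', Relation.ReflTransGen I.EconomyEdge i i'

/-- The parameters of an instance: all endowments, all nonzero slopes, and the lengths of all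
segments of finite length. -/
inductive Param (I : MannaInstance N M)
  | endowment (i : N) (j : M) : Param I
  | slope (i : N) (j : M) (k : Fin (I.K i j + 1)) (h : I.U i j k ≠ 0) : Param I
  | length (i : N) (j : M) (k : Fin (I.K i j)) : Param I

/-- The values that the parameters have in the instance. -/
def paramValue (I : MannaInstance N M) : I.Param → ℝ
  | .endowment i j => I.W i j
  | .slope i j k _ => I.U i j k
  | .length i j k => I.L i j k

/-- The parameters satisfy no polynomial relation with rational coefficients, apart from the
consequences of the normalization `∑ i, W i j = 1`: a polynomial that vanishes at the parameters
of the instance vanishes at all real values `θ` of the parameters that are so normalized. -/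
def NoPolynomialRelation (I : MannaInstance N M) : Prop :=
  ∀ Q : MvPolynomial I.Param ℚ, MvPolynomial.aeval I.paramValue Q = 0 →
    ∀ θ : I.Param → ℝ, (∀ j, ∑ i, θ (.endowment i j) = 1) → MvPolynomial.aeval θ Q = 0

/-- The bundle `y` is nonnegative and agent `i` can afford it at prices `p`. -/
def Affordable (I : MannaInstance N M) (p : M → ℝ) (i : N) (y : M → ℝ) : Prop :=
  (∀ j, 0 ≤ y j) ∧ ∑ j, y j * p j ≤ ∑ j, I.W i j * p j

/-- Prices `p` and the allocation `x` form a competitive equilibrium. -/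
structure IsEquilibrium (I : MannaInstance N M) (p : M → ℝ) (x : N → M → ℝ) : Prop where
  affordable : ∀ i, I.Affordable p i (x i)
  optimal : ∀ i y, I.Affordable p i y → I.utility i y ≤ I.utility i (x i)
  clearing : ∀ j, ∑ i, x i j = ∑ i, I.W i j

/-- The competitive equilibria of an instance. -/
structure Equilibrium (I : MannaInstance N M) where
  price : M → ℝ
  alloc : N → M → ℝ
  isEquilibrium : I.IsEquilibrium price alloc

/-- Two equilibria are the same up to scaling if their allocations agree and their prices differ
by a positive factor. -/
def scaling (I : MannaInstance N M) : Setoid I.Equilibrium where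
  r e e' := (∃ α : ℝ, 0 < α ∧ e'.price = α • e.price) ∧ e'.alloc = e.alloc
  iseqv :=
    { refl := fun _ => ⟨⟨1, one_pos, (one_smul ℝ _).symm⟩, rfl⟩
      symm := by
        rintro e e' ⟨⟨α, hα, h⟩, hx⟩
        exact ⟨⟨α⁻¹, inv_pos.mpr hα, by rw [h, inv_smul_smul₀ hα.ne']⟩, hx.symm⟩
      trans := by
        rintro e e' e'' ⟨⟨α, hα, h⟩, hx⟩ ⟨⟨β, hβ, h'⟩, hx'⟩
        exact ⟨⟨β * α, mul_pos hβ hα, by rw [h', h, mul_smul]⟩, hx'.trans hx⟩ }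

end MannaInstance

/-! Let `r i` be the reciprocal of the marginal utility of money of agent `i`, and let `f t` be the
signed money spent on a piece `t`, that is, a utility segment whose slope has the sign of its item.
Goods have positive prices and bads negative ones. In the unknowns `(r, p, f)` the first order
conditions become linear with complementarity: a piece is empty, or full, or satisfies `p = r *
slope`. The zero-slope segment of a bad is always taken in full and enters as a constant `base`.
Fixing the scale by `r o = 1` for one agent `o`, equilibria up to scaling are the solutions at which
every agent has `excess` zero.

Now deform. With a parameter `μ` in `[0, m]`, require of each agent `i ≠ o` that `r i ≥ ε` and
`excess i ≤ μ`, one of the two with equality. For each choice of the alternatives (a `State`) the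
solutions form a polyhedron with one more unknown than equations.

These polyhedra are bounded by strong connectivity (`exists_gap_const`, `exists_bounds`): if the
values of `r` had a large gap, someone above the gap would always want more of a good owned by
someone below it; that good would be so expensive that the low group would have positive total
excess.

They are nondegenerate by genericity (`card_le_of_determined`, `Generic.tight_unique`): every
equation and every tight inequality can be solved for a parameter or unknown of its own, so two
tight inequalities at one point would contradict the transcendence degree of the parameters.

Hence each polyhedron is empty or a segment (`polyFlags_ncard`). Segments are glued in pairs where
an alternative switches, and the number of unglued ends is even (`even_boundary_flags`). Unglued
ends have `μ = m` or `μ = 0`. At `μ = m` all `r i` with `i ≠ o` equal `ε`, and exactly one such end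
exists. At `μ = 0` the bounds give `r i > ε`, so the ends are exactly the equilibria, and their
number is odd (`Generic.odd_eqSet`). -/

/-! ### Parity of the ends of glued segments -/

section SegmentCells

variable {V : Type*} [NormedAddCommGroup V] [NormedSpace ℝ V] {Q ι : Type*} [Finite ι]
  {E : Q → V →ₗ[ℝ] ℝ} {b : Q → ℝ} {g : ι → V →ₗ[ℝ] ℝ} {c : ι → ℝ}

/-- The polyhedron cut out by the equations `E q v = b q` and the inequalities `c a ≤ g a v`. -/
def polyCell (E : Q → V →ₗ[ℝ] ℝ) (b : Q → ℝ) (g : ι → V →ₗ[ℝ] ℝ) (c : ι → ℝ) : Set V :=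
  {v | (∀ q, E q v = b q) ∧ ∀ a, c a ≤ g a v}

/-- The pairs of a point of the polyhedron and an inequality that is tight there. -/
def polyFlags (E : Q → V →ₗ[ℝ] ℝ) (b : Q → ℝ) (g : ι → V →ₗ[ℝ] ℝ) (c : ι → ℝ) : Set (V × ι) :=
  {x | x.1 ∈ polyCell E b g c ∧ g x.2 x.1 = c x.2}

/-- A bounded polyhedron is left in every direction through a tight inequality. -/
theorem exists_exit (hb : Bornology.IsBounded (polyCell E b g c)) {v u : V}
    (hv : v ∈ polyCell E b g c) (hu : u ≠ 0) (hE : ∀ q, E q u = 0) :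
    ∃ t : ℝ, 0 ≤ t ∧ v + t • u ∈ polyCell E b g c ∧ ∃ a, g a (v + t • u) = c a ∧ g a u < 0 := by
  classical
  have := Fintype.ofFinite ι
  have hEt : ∀ t : ℝ, ∀ q, E q (v + t • u) = b q := fun t q => by
    simp [hE q, hv.1 q]
  -- Otherwise the whole ray from `v` in direction `u` would stay in the bounded polyhedron.
  have hne : (Finset.univ.filter fun a => g a u < 0).Nonempty := by
    by_contra h
    rw [Finset.not_nonempty_iff_eq_empty, Finset.filter_eq_empty_iff] at h
    obtain ⟨R, hR⟩ := hb.exists_norm_le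
    have hray : ∀ t : ℝ, 0 ≤ t → ‖v + t • u‖ ≤ R := fun t ht => by
      refine hR _ ⟨hEt t, fun a => ?_⟩
      have h1 : 0 ≤ g a u := not_lt.1 (h (Finset.mem_univ a))
      have h2 := hv.2 a
      have h3 := mul_nonneg ht h1
      simp only [map_add, map_smul, smul_eq_mul]
      linarith
    have hupos : 0 < ‖u‖ := norm_pos_iff.2 hu
    have h0 : 0 ≤ R := (norm_nonneg _).trans (hray 0 le_rfl)
    have h1 : 0 ≤ (R + ‖v‖ + 1) / ‖u‖ := by positivity
    have h2 := hray _ h1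
    have h3 : ‖((R + ‖v‖ + 1) / ‖u‖) • u‖ = R + ‖v‖ + 1 := by
      rw [norm_smul, Real.norm_of_nonneg h1, div_mul_cancel₀ _ hupos.ne']
    have h4 := norm_sub_le (v + ((R + ‖v‖ + 1) / ‖u‖) • u) v
    rw [add_sub_cancel_left, h3] at h4
    linarith
  -- Ratio test: the inequality that the ray reaches first.
  obtain ⟨a, ha, hmin⟩ := Finset.exists_min_image _ (fun a => (g a v - c a) / (-g a u)) hne
  have hau : g a u < 0 := (Finset.mem_filter.1 ha).2
  have ht0 : 0 ≤ (g a v - c a) / (-g a u) :=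
    div_nonneg (sub_nonneg.2 (hv.2 a)) (by linarith)
  refine ⟨_, ht0, ⟨hEt _, fun d => ?_⟩, a, ?_, hau⟩
  · simp only [map_add, map_smul, smul_eq_mul]
    by_cases hd : g d u < 0
    · have h := hmin d (Finset.mem_filter.2 ⟨Finset.mem_univ d, hd⟩)
      rw [le_div_iff₀ (by linarith : 0 < -g d u)] at h
      linarith
    · have h1 := mul_nonneg ht0 (not_lt.1 hd)
      have h2 := hv.2 d
      linarith
  · simp only [map_add, map_smul, smul_eq_mul]
    have hne := hau.ne
    field_simp
    ring

/-- If at most one inequality is tight at each point, an inequality is tight at one point only. -/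
theorem eq_of_tight (hb : Bornology.IsBounded (polyCell E b g c))
    (hnd : ∀ v ∈ polyCell E b g c, ∀ a a', g a v = c a → g a' v = c a' → a = a')
    {v w : V} {a : ι} (hv : v ∈ polyCell E b g c) (hw : w ∈ polyCell E b g c)
    (hva : g a v = c a) (hwa : g a w = c a) : v = w := by
  by_contra hvw
  -- Inequality `a` stays tight along the line through `v` and `w`, so the exit would have to happen
  -- through `a` itself, on which the direction is constant.
  obtain ⟨t, -, hmem, d, hd, hdu⟩ := exists_exit (u := w - v) hb hv
    (sub_ne_zero.2 (Ne.symm hvw)) (fun q => by simp [hv.1 q, hw.1 q])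
  have ha : g a (w - v) = 0 := by simp [hva, hwa]
  have := hnd _ hmem a d (by simp only [map_add, map_smul, ha, hva]; simp) hd
  subst this
  exact hdu.ne ha

/-- A bounded nonempty polyhedron given by fewer equations than the dimension, with at most one
tight inequality at each point, is a segment: it has exactly two flags. -/
theorem polyFlags_ncard [FiniteDimensional ℝ V] [Fintype Q]
    (hQ : Fintype.card Q < Module.finrank ℝ V)
    (hb : Bornology.IsBounded (polyCell E b g c))
    (hnd : ∀ v ∈ polyCell E b g c, ∀ a a', g a v = c a → g a' v = c a' → a = a')
    (hne : (polyCell E b g c).Nonempty) : (polyFlags E b g c).ncard = 2 := by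
  obtain ⟨v, hv⟩ := hne
  obtain ⟨u, hu, hu0⟩ : ∃ u ∈ LinearMap.ker (LinearMap.pi E), u ≠ 0 :=
    Submodule.exists_mem_ne_zero_of_ne_bot
      (LinearMap.ker_ne_bot_of_finrank_lt (by simpa using hQ))
  have hE : ∀ q, E q u = 0 := fun q => congrFun (LinearMap.mem_ker.1 hu) q
  obtain ⟨s, hs, hvs, a, ha, hau⟩ := exists_exit hb hv hu0 hE
  obtain ⟨t, ht, hvt, d, hd, hdu⟩ := exists_exit hb hv (neg_ne_zero.2 hu0)
    (fun q => by simp [hE q])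
  rw [map_neg, neg_lt_zero] at hdu
  set x := v + s • u with hx
  set y := v + t • -u with hy
  have had : a ≠ d := by rintro rfl; linarith
  -- The part of `w - x` outside the line, corrected to keep `a` tight, would lead to a point with a
  -- second tight inequality.
  have hline : ∀ w ∈ polyCell E b g c, ∃ k : ℝ, w = x + k • u := by
    intro w hw
    refine ⟨g a (w - x) / g a u, ?_⟩
    by_contra hne
    set u' := (w - x) - (g a (w - x) / g a u) • u with hu'
    have h0 : u' ≠ 0 := by
      intro h
      apply hne
      rw [hu', sub_eq_zero] at h
      rw [← h]; abel
    have hau' : g a u' = 0 := by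
      simp only [hu', map_sub, map_smul, smul_eq_mul]
      have := hau.ne
      field_simp
      ring
    obtain ⟨k, -, hmem, e, he, heu⟩ := exists_exit hb hvs h0
      (fun q => by simp only [hu', map_sub, map_smul, hE q, hw.1 q, hvs.1 q]; simp)
    have := hnd _ hmem a e (by simp only [map_add, map_smul, hau', ha]; simp) he
    subst this
    exact heu.ne hau'
  have hset : polyFlags E b g c = {(x, a), (y, d)} := by
    ext ⟨w, e⟩
    simp only [Set.mem_insert_iff, Set.mem_singleton_iff, Prod.mk.injEq]
    constructor
    · rintro ⟨hw, he⟩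
      obtain ⟨k, hk⟩ := hline w hw
      simp only at he
      have hya : y = x + (-(s + t)) • u := by rw [hx, hy]; module
      have hwx : g e w = g e x + k * g e u := by rw [hk]; simp
      have hwa : g a w = g a x + k * g a u := by rw [hk]; simp
      have hwd : g d w = g d x + k * g d u := by rw [hk]; simp
      have hyd : g d y = g d x + (-(s + t)) * g d u := by rw [hya]; simp
      have hye : g e y = g e x + (-(s + t)) * g e u := by rw [hya]; simp
      have hk0 : k ≤ 0 := by
        by_contra! h
        have := hw.2 a
        nlinarith
      have hk1 : -(s + t) ≤ k := by
        by_contra! h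
        have := hw.2 d
        nlinarith
      have h1 := hvs.2 e
      have h2 := hvt.2 e
      -- All points lie between `x` and `y`, so an inequality tight at `w` is already tight at the
      -- end towards which it decreases.
      rcases lt_trichotomy (g e u) 0 with h | h | h
      · left
        have : e = a := hnd _ hvs e a (le_antisymm (by nlinarith) h1) ha
        subst this
        exact ⟨eq_of_tight hb hnd hw hvs he ha, rfl⟩
      · left
        have : e = a := hnd _ hvs e a (by rw [h] at hwx; linarith) ha
        subst this
        exact absurd h hau.ne
      · right
        have : e = d := hnd _ hvt e d (le_antisymm (by nlinarith) h2) hd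
        subst this
        exact ⟨eq_of_tight hb hnd hw hvt he hd, rfl⟩
    · rintro (⟨rfl, rfl⟩ | ⟨rfl, rfl⟩)
      · exact ⟨hvs, ha⟩
      · exact ⟨hvt, hd⟩
  rw [hset, Set.ncard_pair]
  simp [had]

/-- Parity of boundary flags in a finite family of segments that are glued along the flags whose
inequality lies in `J`. -/
theorem even_boundary_flags [FiniteDimensional ℝ V] [Fintype Q] {S : Type*} [Finite S]
    (hQ : Fintype.card Q < Module.finrank ℝ V)
    (E : S → Q → V →ₗ[ℝ] ℝ) (b : S → Q → ℝ) (g : S → ι → V →ₗ[ℝ] ℝ) (c : S → ι → ℝ)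
    (hb : ∀ σ, Bornology.IsBounded (polyCell (E σ) (b σ) (g σ) (c σ)))
    (hnd : ∀ σ, ∀ v ∈ polyCell (E σ) (b σ) (g σ) (c σ),
      ∀ a a', g σ a v = c σ a → g σ a' v = c σ a' → a = a')
    (J : Set ι) (flip : S → ι → S)
    (hflip : ∀ σ v, ∀ a ∈ J, (v, a) ∈ polyFlags (E σ) (b σ) (g σ) (c σ) →
      (v, a) ∈ polyFlags (E (flip σ a)) (b (flip σ a)) (g (flip σ a)) (c (flip σ a)) ∧
        flip (flip σ a) a = σ ∧ flip σ a ≠ σ) :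
    {x : S × V × ι | x.2 ∈ polyFlags (E x.1) (b x.1) (g x.1) (c x.1)}.Finite ∧
    Even {x : S × V × ι | x.2 ∈ polyFlags (E x.1) (b x.1) (g x.1) (c x.1) ∧ x.2.2 ∉ J}.ncard := by
  classical
  have := Fintype.ofFinite S
  have hcell : ∀ σ, (polyFlags (E σ) (b σ) (g σ) (c σ)).Finite ∧
      Even (polyFlags (E σ) (b σ) (g σ) (c σ)).ncard := by
    intro σ
    rcases (polyCell (E σ) (b σ) (g σ) (c σ)).eq_empty_or_nonempty with h | h
    · have : polyFlags (E σ) (b σ) (g σ) (c σ) = ∅ := by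
        ext x
        simp [polyFlags, h]
      simp [this]
    · have h2 := polyFlags_ncard hQ (hb σ) (hnd σ) h
      exact ⟨Set.finite_of_ncard_ne_zero (by simp [h2]), by simp [h2]⟩
  set A := {x : S × V × ι | x.2 ∈ polyFlags (E x.1) (b x.1) (g x.1) (c x.1)} with hA
  have hAU : A = ⋃ σ, Prod.mk σ '' polyFlags (E σ) (b σ) (g σ) (c σ) := by
    ext ⟨σ, x⟩
    simp [hA]
  have hfin : A.Finite := by
    rw [hAU]
    exact Set.finite_iUnion fun σ => (hcell σ).1.image _
  refine ⟨hfin, ?_⟩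
  have hcard : Even hfin.toFinset.card := by
    rw [Finset.card_eq_sum_card_fiberwise (f := Prod.fst) (t := Finset.univ) (by simp)]
    refine Finset.even_sum _ fun σ _ => ?_
    have h2 := (hcell σ).2
    rw [Set.ncard_eq_toFinset_card _ (hcell σ).1] at h2
    refine (congrArg Even ?_).mpr h2
    refine Finset.card_bij' (fun x _ => x.2) (fun x _ => (σ, x)) ?_ ?_ ?_ ?_
    · rintro ⟨τ, x⟩ h
      simp only [Finset.mem_filter, Set.Finite.mem_toFinset] at h ⊢
      obtain ⟨h1, rfl⟩ := h
      exact h1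
    · intro x h
      simpa [hA] using h
    · rintro ⟨τ, x⟩ h
      simp only [Finset.mem_filter] at h
      rw [← h.2]
    · intro x h
      rfl
  have hsplit := Finset.card_filter_add_card_filter_not (s := hfin.toFinset) (fun x => x.2.2 ∈ J)
  -- Flags with inequality in `J` are paired by `flip`, a fixed-point-free involution.
  have hin : Even (hfin.toFinset.filter fun x => x.2.2 ∈ J).card := by
    rw [← ZMod.natCast_eq_zero_iff_even, Finset.card_eq_sum_ones, Nat.cast_sum]
    refine Finset.sum_involution (fun x _ => (flip x.1 x.2.2, x.2)) ?_ ?_ ?_ ?_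
    · intros; decide
    · intro x hx _ h
      simp only [Finset.mem_filter, Set.Finite.mem_toFinset] at hx
      exact (hflip x.1 x.2.1 x.2.2 hx.2 hx.1).2.2 (congrArg Prod.fst h)
    · intro x hx
      simp only [Finset.mem_filter, Set.Finite.mem_toFinset] at hx ⊢
      exact ⟨(hflip x.1 x.2.1 x.2.2 hx.2 hx.1).1, hx.2⟩
    · intro x hx
      simp only [Finset.mem_filter, Set.Finite.mem_toFinset] at hx
      simp only [(hflip x.1 x.2.1 x.2.2 hx.2 hx.1).2.1]
  have hout : Even (hfin.toFinset.filter fun x => ¬ x.2.2 ∈ J).card := by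
    rw [← hsplit] at hcard
    exact (Nat.even_add.1 hcard).1 hin
  rw [← Set.ncard_coe_finset] at hout
  convert hout using 1
  congr 1
  ext x
  simp [hA]

end SegmentCells

/-! ### Transcendence degree and the number of relations -/

/-- The elements of a field extension that are algebraic over the algebra generated by a set. -/
def algebraicOver (s : Set ℝ) : Subfield ℝ where
  carrier := {a | IsAlgebraic (Algebra.adjoin ℚ s) a}
  mul_mem' := fun ha hb => ha.mul hb
  one_mem' := isAlgebraic_one
  add_mem' := fun ha hb => ha.add hb
  zero_mem' := isAlgebraic_zero
  neg_mem' := fun ha => ha.neg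
  inv_mem' := fun _ ha => ha.inv

/-- If algebraically independent numbers `θ` and further numbers `y` satisfy relations that
determine the entries named by an injective family `e` from the other entries, then there are at
most as many relations as entries of `y`. -/
theorem card_le_of_determined {ι κ Q : Type*} [Fintype ι] [Fintype κ] [Fintype Q]
    {θ : ι → ℝ} (hθ : AlgebraicIndependent ℚ θ) (y : κ → ℝ) (e : Q → ι ⊕ κ)
    (he : Function.Injective e)
    (h : ∀ K : Subfield ℝ, (∀ z ∉ Set.range e, Sum.elim θ y z ∈ K) → ∀ i, θ i ∈ K) :
    Fintype.card Q ≤ Fintype.card κ := by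
  classical
  set s : Set ℝ := Sum.elim θ y '' (Set.range e)ᶜ with hs
  have hK := h (algebraicOver s) (fun z hz =>
    isAlgebraic_algebraMap (⟨_, Algebra.subset_adjoin ⟨z, hz, rfl⟩⟩ : Algebra.adjoin ℚ s))
  -- All `θ i` are algebraic over the entries that are not determined. By rank in the algebraic
  -- matroid there are at least as many of these as indices `i`, which bounds the number of
  -- determined ones by `card κ`.
  have hsub : Set.range θ ⊆ (AlgebraicIndependent.matroid ℚ ℝ).closure s := by
    rintro _ ⟨i, rfl⟩
    rw [AlgebraicIndependent.matroid_closure_eq]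
    exact hK i
  have hind : (AlgebraicIndependent.matroid ℚ ℝ).Indep (Set.range θ) := by
    rw [AlgebraicIndependent.matroid_indep_iff]
    exact hθ.coe_range
  have h1 := (AlgebraicIndependent.matroid ℚ ℝ).eRk_mono hsub
  rw [Matroid.eRk_closure_eq, hind.eRk_eq_encard] at h1
  have h2 := h1.trans ((AlgebraicIndependent.matroid ℚ ℝ).eRk_le_encard s)
  have h3 := h2.trans (Set.encard_image_le _ _)
  have h4 : (Set.range θ).encard = Fintype.card ι := by
    rw [← Set.image_univ, hθ.injective.encard_image, Set.encard_univ, ENat.card_eq_coe_fintype_card]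
  have h5 : (Set.range e).encard = Fintype.card Q := by
    rw [← Set.image_univ, he.encard_image, Set.encard_univ, ENat.card_eq_coe_fintype_card]
  have h6 := Set.encard_add_encard_compl (Set.range e)
  rw [h5, Set.encard_univ, ENat.card_eq_coe_fintype_card, Fintype.card_sum] at h6
  rw [h4] at h3
  obtain ⟨k, hk⟩ := ENat.ne_top_iff_exists.1
    (Set.encard_ne_top_iff.2 (Set.toFinite (Set.range e)ᶜ))
  rw [← hk] at h3 h6
  norm_cast at h3 h6
  omega

theorem exists_pos_le {ι : Type*} [Finite ι] (q : ι → ℝ) :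
    ∃ w : ℝ, 0 < w ∧ ∀ i, 0 < q i → w ≤ q i := by
  obtain ⟨K, hK⟩ := (Set.finite_range fun i => (q i)⁻¹).bddAbove
  refine ⟨(max K 1)⁻¹, by positivity, fun i hi => ?_⟩
  rw [inv_le_comm₀ (by positivity) hi]
  exact (hK ⟨i, rfl⟩).trans (le_max_left _ _)

/-! ### Markets of pieces and estimates for clearing prices -/

/-- A market of pieces: every piece is a segment of the utility of one agent for one item, with
slope of the sign of the item. Unbounded pieces are given the length `2`, which exceeds the supply.
Agent `i` receives the amount `base i j` of item `j` in any case. -/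
structure PieceMarket (N M T : Type*) [Fintype N] [Fintype M] [Fintype T] where
  agent : T → N
  item : T → M
  slope : T → ℝ
  len : T → ℝ
  bdd : T → Prop
  sgn : M → ℝ
  base : N → M → ℝ
  W : N → M → ℝ
  sgn_eq : ∀ j, sgn j = 1 ∨ sgn j = -1
  slope_pos : ∀ t, 0 < sgn (item t) * slope t
  len_pos : ∀ t, 0 < len t
  len_eq : ∀ t, ¬ bdd t → len t = 2
  base_nonneg : ∀ i j, 0 ≤ base i j
  base_good : ∀ i j, sgn j = 1 → base i j = 0
  base_lt : ∀ j, ∑ i, base i j < 1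
  W_nonneg : ∀ i j, 0 ≤ W i j
  supply : ∀ j, ∑ i, W i j = 1
  enough : ∀ j, ∃ s : Finset T, (∀ t ∈ s, item t = j) ∧ 1 < ∑ t ∈ s, len t
  disposal : ∀ i j, sgn j = -1 → ∃ t, agent t = i ∧ item t = j ∧ ¬ bdd t
  connected : ∀ i i', Relation.ReflTransGen
    (fun i i' => ∃ t, agent t = i ∧ ¬ bdd t ∧ sgn (item t) = 1 ∧ 0 < W i' (item t)) i i'

namespace PieceMarket

variable {N M T : Type*} [Fintype N] [Fintype M] [Fintype T] (P : PieceMarket N M T)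

/-- The pieces of an item. -/
noncomputable def pieces (j : M) : Finset T := by
  classical exact Finset.univ.filter fun t => P.item t = j

/-- The pieces of an agent. -/
noncomputable def agentPieces (i : N) : Finset T := by
  classical exact Finset.univ.filter fun t => P.agent t = i

@[simp] theorem mem_pieces {j : M} {t : T} : t ∈ P.pieces j ↔ P.item t = j := by
  simp [pieces]

@[simp] theorem mem_agentPieces {i : N} {t : T} : t ∈ P.agentPieces i ↔ P.agent t = i := by
  simp [agentPieces]

/-- Income minus spending of an agent. -/
noncomputable def excess (p : M → ℝ) (f : T → ℝ) (i : N) : ℝ :=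
  ∑ j, (P.W i j - P.base i j) * p j - ∑ t ∈ P.agentPieces i, f t

/-- Spending `f t = x t * p (item t)` is optimal when the marginal utility of money of agent `i`
is `1 / r i`, and the items are sold out. -/
structure IsClearing (r : N → ℝ) (p : M → ℝ) (f : T → ℝ) : Prop where
  pos : ∀ i, 0 < r i
  sgn_pos : ∀ j, 0 < P.sgn j * p j
  nonneg : ∀ t, 0 ≤ P.sgn (P.item t) * f t
  le : ∀ t, P.sgn (P.item t) * f t ≤ P.sgn (P.item t) * (P.len t * p (P.item t))
  of_not_full : ∀ t, f t ≠ P.len t * p (P.item t) → r (P.agent t) * P.slope t ≤ p (P.item t)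
  of_not_empty : ∀ t, f t ≠ 0 → p (P.item t) ≤ r (P.agent t) * P.slope t
  clear : ∀ j, ∑ t ∈ P.pieces j, f t = (1 - ∑ i, P.base i j) * p j

theorem sum_fiber_pieces (f : T → ℝ) : ∑ j, ∑ t ∈ P.pieces j, f t = ∑ t, f t := by
  classical
  rw [← Finset.sum_fiberwise Finset.univ P.item f]
  refine Finset.sum_congr rfl fun j _ => Finset.sum_congr ?_ fun _ _ => rfl
  ext t; simp

theorem sum_fiber_agentPieces (f : T → ℝ) : ∑ i, ∑ t ∈ P.agentPieces i, f t = ∑ t, f t := by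
  classical
  rw [← Finset.sum_fiberwise Finset.univ P.agent f]
  refine Finset.sum_congr rfl fun j _ => Finset.sum_congr ?_ fun _ _ => rfl
  ext t; simp

variable {P} {r : N → ℝ} {p : M → ℝ} {f : T → ℝ}

namespace IsClearing

variable (h : P.IsClearing r p f)
include h

/-- Walras' law: the items are sold out and one unit of each is owned in total, so income and
spending cancel. -/
theorem sum_excess : ∑ i, P.excess p f i = 0 := by
  simp only [excess, Finset.sum_sub_distrib]
  rw [P.sum_fiber_agentPieces, ← P.sum_fiber_pieces, Finset.sum_comm, ← Finset.sum_sub_distrib]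
  refine Finset.sum_eq_zero fun j _ => ?_
  rw [h.clear j, ← Finset.sum_mul, Finset.sum_sub_distrib, P.supply j, sub_self]

theorem sgn_mul_le (t : T) : P.sgn (P.item t) * f t ≤ P.sgn (P.item t) * p (P.item t) := by
  have h1 : P.sgn (P.item t) * f t ≤ ∑ t' ∈ P.pieces (P.item t), P.sgn (P.item t) * f t' :=
    Finset.single_le_sum (f := fun t' => P.sgn (P.item t) * f t')
      (fun t' ht' => by rw [← (P.mem_pieces.1 ht')]; exact h.nonneg t') (P.mem_pieces.2 rfl)
  rw [← Finset.mul_sum, h.clear] at h1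
  have h2 := h.sgn_pos (P.item t)
  have h3 : 0 ≤ ∑ i, P.base i (P.item t) := Finset.sum_nonneg fun i _ => P.base_nonneg i _
  nlinarith

/-- The stand-in length `2` exceeds the unit supply, so it never acts as a constraint. -/
theorem not_full_of_unbounded {t : T} (ht : ¬ P.bdd t) : f t ≠ P.len t * p (P.item t) := by
  intro hf
  have h1 := h.sgn_mul_le t
  rw [hf, P.len_eq t ht] at h1
  have h2 := h.sgn_pos (P.item t)
  linarith

theorem exists_not_empty (j : M) : ∃ t, P.item t = j ∧ f t ≠ 0 := by
  by_contra! hc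
  have h1 := h.clear j
  rw [Finset.sum_eq_zero fun t ht => hc t (P.mem_pieces.1 ht)] at h1
  have h2 := h.sgn_pos j
  have h3 := P.base_lt j
  rcases mul_eq_zero.1 h1.symm with h4 | h4
  · linarith
  · simp [h4] at h2

theorem exists_not_full (j : M) : ∃ t, P.item t = j ∧ f t ≠ P.len t * p (P.item t) := by
  by_contra! hc
  obtain ⟨s, hs, hs1⟩ := P.enough j
  have h1 := h.clear j
  have h2 := h.sgn_pos j
  have h3 : 0 ≤ ∑ i, P.base i j := Finset.sum_nonneg fun i _ => P.base_nonneg i _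
  have h4 : ∑ t ∈ s, P.sgn j * f t ≤ ∑ t ∈ P.pieces j, P.sgn j * f t :=
    Finset.sum_le_sum_of_subset_of_nonneg (fun t ht => P.mem_pieces.2 (hs t ht))
      (fun t ht _ => by rw [← P.mem_pieces.1 ht]; exact h.nonneg t)
  rw [← Finset.mul_sum (P.pieces j), h1] at h4
  have h5 : ∑ t ∈ s, P.sgn j * f t = (∑ t ∈ s, P.len t) * (P.sgn j * p j) := by
    rw [Finset.sum_mul]
    refine Finset.sum_congr rfl fun t ht => ?_
    rw [hc t (hs t ht), hs t ht]; ring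
  rw [h5] at h4
  nlinarith

/-- A good has a piece that is bought, and a bad has a piece that is not full; the optimality
condition of that piece bounds the size of the price. For the lower bound `abs_ge` the two kinds of
pieces trade places. -/
theorem abs_le {j : M} {c K : ℝ} (hK : ∀ t, |P.slope t| ≤ K)
    (hc : ∀ i, r i ≤ c) : |p j| ≤ c * K := by
  have hj := h.sgn_pos j
  rcases P.sgn_eq j with hs | hs
  · obtain ⟨t, rfl, ht⟩ := h.exists_not_empty j
    rw [hs, one_mul] at hj
    rw [abs_of_pos hj]
    refine (h.of_not_empty t ht).trans ?_
    have h1 := (le_abs_self _).trans (hK t)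
    have h2 := (abs_nonneg _).trans (hK t)
    exact mul_le_mul_of_nonneg (hc _) h1 (h.pos _).le h2
  · obtain ⟨t, rfl, ht⟩ := h.exists_not_full j
    rw [hs] at hj
    rw [abs_of_neg (by linarith)]
    have h0 := h.of_not_full t ht
    have h1 := (neg_le_abs _).trans (hK t)
    have h2 := (abs_nonneg _).trans (hK t)
    have := mul_le_mul_of_nonneg (hc (P.agent t)) h1 (h.pos _).le h2
    linarith

theorem abs_ge {j : M} {c K : ℝ} (hK0 : 0 ≤ K) (hK : ∀ t, K ≤ |P.slope t|)
    (hc : ∀ i, c ≤ r i) : c * K ≤ P.sgn j * p j := by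
  have hj := h.sgn_pos j
  rcases P.sgn_eq j with hs | hs
  · obtain ⟨t, rfl, ht⟩ := h.exists_not_full j
    have h1 := P.slope_pos t
    have h0 := h.of_not_full t ht
    have h2 := hK t
    rw [hs, one_mul] at h1 hj ⊢
    rw [abs_of_pos h1] at h2
    exact (mul_le_mul (hc _) h2 hK0 (h.pos _).le).trans h0
  · obtain ⟨t, rfl, ht⟩ := h.exists_not_empty j
    have h1 := P.slope_pos t
    have h0 := h.of_not_empty t ht
    have h2 := hK t
    rw [hs] at h1 hj ⊢
    rw [abs_of_neg (by linarith)] at h2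
    have := mul_le_mul (hc (P.agent t)) h2 hK0 (h.pos _).le
    linarith

theorem abs_spending_le (t : T) : |f t| ≤ |p (P.item t)| := by
  have h1 := h.sgn_mul_le t
  have h2 := h.nonneg t
  rcases P.sgn_eq (P.item t) with hs | hs
  · rw [hs] at h1 h2
    rw [abs_of_nonneg (by linarith), abs_of_nonneg (by linarith)]; linarith
  · rw [hs] at h1 h2
    rw [abs_of_nonpos (by linarith), abs_of_nonpos (by linarith)]; linarith

/-- An agent with small `r` buys only goods that are cheap, and its unbounded piece of each bad
(`disposal`) keeps the prices of bads close to zero. So every term of the excess is at least `-a *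
K`, and the endowment of `g` comes on top. -/
theorem excess_ge {i : N} {a K : ℝ} (hK0 : 0 ≤ K) (hK : ∀ t, |P.slope t| ≤ K) (hi : r i ≤ a)
    {g : M} (hg : P.sgn g = 1) :
    P.W i g * p g - a * (K * (Fintype.card M + Fintype.card T)) ≤ P.excess p f i := by
  classical
  have hri := h.pos i
  have ha : 0 ≤ a * K := mul_nonneg (hri.le.trans hi) hK0
  have h1 : ∀ j, (if j = g then P.W i g * p g else 0) - a * K ≤ (P.W i j - P.base i j) * p j := by
    intro j
    have hj := h.sgn_pos j
    have hW := P.W_nonneg i j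
    rcases P.sgn_eq j with hs | hs
    · rw [hs, one_mul] at hj
      rw [P.base_good i j hs, sub_zero]
      have := mul_nonneg hW hj.le
      split_ifs with hjg
      · subst hjg; linarith
      · linarith
    · rw [hs] at hj
      have hjg : j ≠ g := by rintro rfl; linarith
      rw [if_neg hjg]
      obtain ⟨t, rfl, rfl, ht⟩ := P.disposal i j hs
      have h2 := h.of_not_full t (h.not_full_of_unbounded ht)
      have h3 := (neg_le_abs _).trans (hK t)
      have h4 := mul_le_mul_of_nonneg hi h3 hri.le hK0
      have hW1 : P.W (P.agent t) (P.item t) ≤ 1 := by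
        rw [← P.supply (P.item t)]
        exact Finset.single_le_sum (f := fun i => P.W i (P.item t))
          (fun i _ => P.W_nonneg i _) (Finset.mem_univ _)
      have hb := P.base_nonneg (P.agent t) (P.item t)
      nlinarith
  have h2 : ∀ t ∈ P.agentPieces i, f t ≤ a * K := by
    intro t ht
    rw [mem_agentPieces] at ht
    subst ht
    have hs1 := h.nonneg t
    have hs2 := h.sgn_mul_le t
    by_cases h0 : f t ≤ 0
    · linarith
    · have h3 := h.of_not_empty t (by linarith)
      have h4 := mul_le_mul_of_nonneg hi ((le_abs_self _).trans (hK t)) hri.le hK0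
      rcases P.sgn_eq (P.item t) with hs | hs
      · rw [hs] at hs2; linarith
      · rw [hs] at hs1; linarith
  have h3 := Finset.sum_le_sum fun j (_ : j ∈ Finset.univ) => h1 j
  have h4 := Finset.sum_le_card_nsmul _ _ _ h2
  have h5 : ((P.agentPieces i).card : ℝ) ≤ Fintype.card T := by
    exact_mod_cast Finset.card_le_univ _
  rw [Finset.sum_sub_distrib, Finset.sum_ite_eq' Finset.univ g] at h3
  simp only [Finset.mem_univ, if_true, Finset.sum_const, Finset.card_univ, nsmul_eq_mul] at h3 h4
  have h6 := mul_le_mul_of_nonneg_right h5 ha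
  simp only [excess]
  linarith

/-- Provides the value `m` of the deformation parameter that no excess can reach. -/
theorem excess_le (i : N) {B : ℝ} (hB : ∀ j, |p j| ≤ B) :
    P.excess p f i ≤ B * (2 * Fintype.card M + Fintype.card T) := by
  have h1 : ∀ j ∈ Finset.univ, (P.W i j - P.base i j) * p j ≤ 2 * B := by
    intro j _
    have hW1 : P.W i j ≤ 1 := by
      rw [← P.supply j]
      exact Finset.single_le_sum (f := fun i => P.W i j)
        (fun i _ => P.W_nonneg i _) (Finset.mem_univ _)
    have hb1 : P.base i j ≤ 1 :=
      (Finset.single_le_sum (f := fun i => P.base i j)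
        (fun i _ => P.base_nonneg i _) (Finset.mem_univ _)).trans (P.base_lt j).le
    have hW := P.W_nonneg i j
    have hb := P.base_nonneg i j
    refine (le_abs_self _).trans ?_
    rw [abs_mul]
    exact mul_le_mul (_root_.abs_le.2 ⟨by linarith, by linarith⟩) (hB j) (abs_nonneg _) (by norm_num)
  have h2 : ∀ t ∈ P.agentPieces i, -f t ≤ B := fun t _ =>
    (neg_le_abs _).trans ((h.abs_spending_le t).trans (hB _))
  have h3 := Finset.sum_le_card_nsmul _ _ _ h1
  have h4 := Finset.sum_le_card_nsmul _ _ _ h2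
  have h5 : ((P.agentPieces i).card : ℝ) ≤ Fintype.card T := by
    exact_mod_cast Finset.card_le_univ _
  simp only [Finset.card_univ, nsmul_eq_mul, Finset.sum_neg_distrib] at h3 h4
  simp only [excess]
  rcases isEmpty_or_nonempty T with hT | ⟨⟨t⟩⟩
  · simp only [Fintype.card_eq_zero] at *
    simp only [Finset.eq_empty_of_isEmpty, Finset.sum_empty, Finset.card_empty] at *
    push_cast at *
    linarith
  · have hB0 := (abs_nonneg _).trans (hB (P.item t))
    have h6 := mul_le_mul_of_nonneg_right h5 hB0
    linarith

end IsClearing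

/-! ### A priori bounds for `r` -/

variable (P)

/-- If the agents split into a group with small `r` and a group with much larger `r`, then the
first group has positive total excess. -/
theorem exists_gap_const : ∃ C : ℝ, 1 < C ∧ ∀ r p f, P.IsClearing r p f → ∀ (A : Set N) (a : ℝ),
    A.Nonempty → Aᶜ.Nonempty → (∀ l ∈ A, r l ≤ a) → (∀ i ∉ A, C * a ≤ r i) →
    (∃ l ∈ A, 0 < P.excess p f l) ∧ 0 < ∑ᶠ l ∈ A, P.excess p f l := by
  classical
  obtain ⟨K, hK0, hK⟩ : ∃ K : ℝ, 0 ≤ K ∧ ∀ t, |P.slope t| ≤ K := by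
    obtain ⟨K, hK⟩ := (Set.finite_range fun t => |P.slope t|).bddAbove
    exact ⟨max K 0, le_max_right _ _, fun t => (hK ⟨t, rfl⟩).trans (le_max_left _ _)⟩
  obtain ⟨w, hw0, hw⟩ : ∃ w : ℝ, 0 < w ∧ ∀ i t, 0 < P.W i (P.item t) → 0 < P.slope t →
      w ≤ P.W i (P.item t) * P.slope t := by
    obtain ⟨w, hw, h⟩ := exists_pos_le fun x : N × T => P.W x.1 (P.item x.2) * P.slope x.2
    exact ⟨w, hw, fun i t h1 h2 => h (i, t) (mul_pos h1 h2)⟩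
  set C0 := K * (Fintype.card M + Fintype.card T) with hC0
  have hC00 : 0 ≤ C0 := by positivity
  -- Each member of `A` can have excess as low as `-a * C0`. The constant makes one endowment in `A`
  -- worth more than `card N + 1` such deficits.
  refine ⟨((Fintype.card N + 1) * C0 + 1) / w + 1, ?_, ?_⟩
  · have : 0 < ((Fintype.card N + 1) * C0 + 1) / w := by positivity
    linarith
  intro r p f h A a hA hAc hlow hhigh
  obtain ⟨l₀, hl₀⟩ := hA
  have ha : 0 < a := (h.pos l₀).trans_le (hlow l₀ hl₀)
  -- A path of the economy graph from the complement of `A` into `A` has an edge that crosses over.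
  obtain ⟨i, l, hi, hl, t, hti, htb, hts, htW⟩ : ∃ i l, i ∉ A ∧ l ∈ A ∧ ∃ t, P.agent t = i ∧
      ¬ P.bdd t ∧ P.sgn (P.item t) = 1 ∧ 0 < P.W l (P.item t) := by
    obtain ⟨i₀, hi₀⟩ := hAc
    by_contra! hc
    have : ∀ k, Relation.ReflTransGen (fun i i' => ∃ t, P.agent t = i ∧ ¬ P.bdd t ∧
        P.sgn (P.item t) = 1 ∧ 0 < P.W i' (P.item t)) i₀ k → k ∉ A := by
      intro k hk
      induction hk with
      | refl => exact hi₀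
      | tail _ hbc ih =>
        obtain ⟨t, h1, h2, h3, h4⟩ := hbc
        intro hk
        exact absurd h4 (not_lt.2 (hc _ _ ih hk t h1 h2 h3))
    exact this l₀ (P.connected _ _) hl₀
  have hslope : 0 < P.slope t := by
    have := P.slope_pos t
    rwa [hts, one_mul] at this
  have hp : (((Fintype.card N + 1) * C0 + 1) / w + 1) * a * P.slope t ≤ p (P.item t) := by
    refine le_trans ?_ (h.of_not_full t (h.not_full_of_unbounded htb))
    rw [hti]
    exact mul_le_mul_of_nonneg_right (hhigh i hi) hslope.le
  have hWp : (Fintype.card N + 1) * (a * C0) + a ≤ P.W l (P.item t) * p (P.item t) := by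
    have h1 := mul_le_mul_of_nonneg_left hp htW.le
    have h2 := hw l t htW hslope
    have h3 : 0 ≤ (((Fintype.card N + 1) * C0 + 1) / w + 1) * a := by positivity
    have h4 := mul_le_mul_of_nonneg_left h2 h3
    have h5 : (((Fintype.card N + 1) * C0 + 1) / w + 1) * a * w =
      (Fintype.card N + 1) * (a * C0) + a + a * w := by
      field_simp
    have h6 := mul_pos ha hw0
    rw [h5] at h4
    nlinarith
  have hexl := h.excess_ge hK0 hK (hlow l hl) hts
  rw [← hC0] at hexl
  have haC : 0 ≤ a * C0 := by positivity
  have hex : ∀ k ∈ A, -(a * C0) ≤ P.excess p f k := fun k hk => by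
    have h1 := h.excess_ge hK0 hK (hlow k hk) hts
    have h2 := h.sgn_pos (P.item t)
    rw [hts, one_mul] at h2
    have h3 := mul_nonneg (P.W_nonneg k (P.item t)) h2.le
    rw [← hC0] at h1
    linarith
  have hl1 : Fintype.card N * (a * C0) + a ≤ P.excess p f l := by linarith
  refine ⟨⟨l, hl, ?_⟩, ?_⟩
  · have : 0 ≤ Fintype.card N * (a * C0) := by positivity
    linarith
  · rw [finsum_mem_eq_toFinset_sum, ← Finset.add_sum_erase _ _ (Set.mem_toFinset.2 hl)]
    have h1 := Finset.card_nsmul_le_sum (A.toFinset.erase l) (P.excess p f) (-(a * C0))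
      (fun k hk => hex k (Set.mem_toFinset.1 (Finset.mem_of_mem_erase hk)))
    have h2 : ((A.toFinset.erase l).card : ℝ) ≤ Fintype.card N := by
      exact_mod_cast Finset.card_le_univ _
    rw [nsmul_eq_mul] at h1
    have h3 := mul_le_mul_of_nonneg_right h2 haC
    linarith

end PieceMarket

/-- Pigeonhole: every step short of the whole set adds an element. Applied to the agents with `r`
within a factor `C ^ k` of `r o`, it shows that a gap of factor `C` must occur unless all agents are
reached after `card N` steps. -/
theorem forall_of_card_growth {N : Type*} [Fintype N] (S : ℕ → Set N) (h0 : (S 0).Nonempty)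
    (hmono : Monotone S) (hgrow : ∀ k, S k ≠ Set.univ → S (k + 1) ≠ S k) :
    S (Fintype.card N) = Set.univ := by
  classical
  have key : ∀ k, S k = Set.univ ∨ k + 1 ≤ (S k).ncard := by
    intro k
    induction k with
    | zero => exact Or.inr ((Set.ncard_pos (Set.toFinite _)).2 h0)
    | succ k ih =>
      by_cases hk : S k = Set.univ
      · exact Or.inl (Set.eq_univ_of_univ_subset (hk ▸ hmono (Nat.le_add_right k 1)))
      · have h1 := Set.ncard_lt_ncard (LE.le.ssubset_of_ne (hmono (Nat.le_add_right k 1))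
          (hgrow k hk).symm) (Set.toFinite _)
        have h2 := ih.resolve_left hk
        exact Or.inr (by omega)
  refine (key _).resolve_right fun h => ?_
  have := Set.ncard_le_card (S (Fintype.card N))
  rw [Nat.card_eq_fintype_card] at this
  omega

namespace PieceMarket

variable {N M T : Type*} [Fintype N] [Fintype M] [Fintype T] (P : PieceMarket N M T)

/-- A priori bounds for `r` relative to a fixed agent. -/
theorem exists_bounds (o : N) : ∃ G : ℝ, 1 < G ∧ ∀ r p f, P.IsClearing r p f → r o = 1 →
    ((∀ i, 1 < r i → 0 ≤ P.excess p f i) → ∀ i, r i ≤ G) ∧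
    ((∀ i, i ≠ o → P.excess p f i ≤ 0) → ∀ i, G⁻¹ ≤ r i) := by
  classical
  obtain ⟨C, hC, hgap⟩ := P.exists_gap_const
  have hn : Fintype.card N ≠ 0 := (Fintype.card_pos_iff.2 ⟨o⟩).ne'
  refine ⟨C ^ Fintype.card N, one_lt_pow₀ hC hn, fun r p f h ho => ⟨fun hex => ?_, fun hex => ?_⟩⟩
  · suffices H : {i | r i ≤ C ^ Fintype.card N} = Set.univ by
      intro i
      exact (Set.ext_iff.1 H i).2 trivial
    refine forall_of_card_growth (fun k => {i | r i ≤ C ^ k}) ⟨o, by simp [ho]⟩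
      (fun k l hkl i hi => hi.trans (pow_le_pow_right₀ hC.le hkl)) fun k hk hk1 => ?_
    -- If the set stalls, there is a gap above `C ^ k`. The low group then has positive total excess
    -- while the others, having `r > 1`, have nonnegative excess, against Walras' law.
    have h1 := hgap r p f h {i | r i ≤ C ^ k} (C ^ k)
      ⟨o, by simpa [ho] using one_le_pow₀ hC.le⟩ (Set.nonempty_compl.2 hk) (fun l hl => hl)
      (fun i hi => by
        rw [← hk1] at hi
        simp only [Set.mem_ofPred_eq, not_le] at hi
        rw [mul_comm, ← pow_succ]
        exact hi.le)
    have h2 := h.sum_excess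
    rw [← finsum_eq_sum_of_fintype, ← finsum_mem_univ,
      ← Set.union_compl_self {i | r i ≤ C ^ k},
      finsum_mem_union disjoint_compl_right (Set.toFinite _) (Set.toFinite _)] at h2
    have h3 : 0 ≤ ∑ᶠ l ∈ {i | r i ≤ C ^ k}ᶜ, P.excess p f l := by
      rw [finsum_mem_eq_toFinset_sum]
      exact Finset.sum_nonneg fun i hi => hex i
        ((one_le_pow₀ hC.le).trans_lt (not_le.1 (Set.mem_toFinset.1 hi)))
    linarith [h1.2]
  · suffices H : {i | (C ^ Fintype.card N)⁻¹ ≤ r i} = Set.univ by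
      intro i
      exact (Set.ext_iff.1 H i).2 trivial
    have hpos : ∀ k : ℕ, 0 < C ^ k := fun k => by positivity
    refine forall_of_card_growth (fun k => {i | (C ^ k)⁻¹ ≤ r i}) ⟨o, by simp [ho]⟩
      (fun k l hkl i hi => le_trans (inv_anti₀ (hpos k) (pow_le_pow_right₀ hC.le hkl)) hi)
      fun k hk hk1 => ?_
    -- Here the low group does not contain `o`, so none of its members may have positive excess.
    have h1 := hgap r p f h {i | (C ^ k)⁻¹ ≤ r i}ᶜ (C ^ (k + 1))⁻¹
      (Set.nonempty_compl.2 hk) ⟨o, by simpa [ho] using inv_le_one_of_one_le₀ (one_le_pow₀ hC.le)⟩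
      (fun l hl => by
        rw [← hk1] at hl
        simp only [Set.mem_compl_iff, Set.mem_ofPred_eq, not_le] at hl
        exact hl.le)
      (fun i hi => by
        simp only [Set.mem_compl_iff, not_not, Set.mem_ofPred_eq] at hi
        refine le_trans (le_of_eq ?_) hi
        rw [pow_succ]
        field_simp)
    obtain ⟨l, hl, hl0⟩ := h1.1
    refine absurd (hex l ?_) (not_le.2 hl0)
    rintro rfl
    apply hl
    simpa [ho] using inv_le_one_of_one_le₀ (one_le_pow₀ hC.le)

/-! ### Pricing and distributing the items for given `r` -/

theorem exists_share {ι : Type*} (A B : Finset ι) (w : ι → ℝ) (hw : ∀ i, 0 < w i) (hAB : Disjoint A B)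
    {m : ℝ} (hA : ∑ i ∈ A, w i ≤ m) (hm : m ≤ ∑ i ∈ A, w i + ∑ i ∈ B, w i) :
    ∃ x : ι → ℝ, (∀ i ∈ A, x i = w i) ∧ (∀ i ∈ B, 0 ≤ x i ∧ x i ≤ w i) ∧
      (∀ i, i ∉ A → i ∉ B → x i = 0) ∧ ∑ i ∈ A, x i + ∑ i ∈ B, x i = m := by
  classical
  rcases B.eq_empty_or_nonempty with rfl | hB
  · refine ⟨fun i => if i ∈ A then w i else 0, by simp +contextual, by simp, by simp +contextual, ?_⟩
    simp only [Finset.sum_empty, add_zero] at hm ⊢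
    rw [Finset.sum_congr rfl fun i hi => if_pos hi]
    linarith
  · have hBpos : 0 < ∑ i ∈ B, w i := Finset.sum_pos (fun i _ => hw i) hB
    set q := (m - ∑ i ∈ A, w i) / ∑ i ∈ B, w i with hq
    have hq0 : 0 ≤ q := div_nonneg (by linarith) hBpos.le
    have hq1 : q ≤ 1 := by rw [hq, div_le_one hBpos]; linarith
    refine ⟨fun i => if i ∈ A then w i else if i ∈ B then q * w i else 0, by simp +contextual,
      fun i hi => ?_, by simp +contextual, ?_⟩
    · have : i ∉ A := fun h => Finset.disjoint_left.1 hAB h hi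
      simp only [this, hi, if_true, if_false]
      have := hw i
      constructor
      · positivity
      · nlinarith
    · rw [Finset.sum_congr rfl fun i hi => if_pos hi, Finset.sum_congr rfl fun i hi =>
        (if_neg (Finset.disjoint_right.1 hAB hi)).trans (if_pos hi), ← Finset.mul_sum, hq]
      field_simp
      ring

/-- A level of a real function on a weighted finite set at which the total weight passes `m`. -/
theorem exists_level {ι : Type*} (S : Finset ι) (w c : ι → ℝ) (hw : ∀ i, 0 < w i) {m : ℝ}
    (hm0 : 0 < m) (hm : m ≤ ∑ i ∈ S, w i) :
    ∃ i₀ ∈ S, ∃ x : ι → ℝ, (∀ i ∈ S, 0 ≤ x i ∧ x i ≤ w i) ∧ ∑ i ∈ S, x i = m ∧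
      (∀ i ∈ S, x i ≠ w i → c i₀ ≤ c i) ∧ ∀ i ∈ S, x i ≠ 0 → c i ≤ c i₀ := by
  classical
  have hS : S.Nonempty := by
    rw [Finset.nonempty_iff_ne_empty]
    rintro rfl
    simp at hm
    linarith
  obtain ⟨i₁, hi₁, hmax⟩ := Finset.exists_max_image S c hS
  have hF : (S.filter fun i => m ≤ ∑ k ∈ S with c k ≤ c i, w k).Nonempty := by
    refine ⟨i₁, Finset.mem_filter.2 ⟨hi₁, ?_⟩⟩
    rwa [Finset.filter_true_of_mem hmax]
  obtain ⟨i₀, hi₀, hmin⟩ := Finset.exists_min_image _ c hF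
  rw [Finset.mem_filter] at hi₀
  -- Otherwise the largest value of `c` below `c i₀` would already be a level with enough weight,
  -- against the minimality of `i₀`.
  have hA : ∑ k ∈ S with c k < c i₀, w k ≤ m := by
    by_contra! hc
    have hne : (S.filter fun k => c k < c i₀).Nonempty := by
      rw [Finset.nonempty_iff_ne_empty]
      intro h
      rw [h] at hc
      simp at hc
      linarith
    obtain ⟨i₂, hi₂, hmax₂⟩ := Finset.exists_max_image _ c hne
    have h2 := (Finset.mem_filter.1 hi₂)
    have h3 : (S.filter fun k => c k < c i₀) = S.filter fun k => c k ≤ c i₂ := by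
      ext k
      simp only [Finset.mem_filter, and_congr_right_iff]
      exact fun hk => ⟨fun h => hmax₂ k (Finset.mem_filter.2 ⟨hk, h⟩), fun h => h.trans_lt h2.2⟩
    rw [h3] at hc
    exact absurd (hmin i₂ (Finset.mem_filter.2 ⟨h2.1, hc.le⟩)) (not_le.2 h2.2)
  have hdisj : Disjoint (S.filter fun k => c k < c i₀) (S.filter fun k => c k = c i₀) :=
    Finset.disjoint_left.2 fun k h1 h2 => by
      simp only [Finset.mem_filter] at h1 h2
      exact h1.2.ne h2.2
  have hunion : (S.filter fun k => c k < c i₀) ∪ (S.filter fun k => c k = c i₀) =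
      S.filter fun k => c k ≤ c i₀ := by
    ext k
    simp only [Finset.mem_union, Finset.mem_filter, le_iff_lt_or_eq]
    tauto
  obtain ⟨x, hx1, hx2, hx3, hx4⟩ := exists_share _ _ w hw hdisj hA
    (by rw [← Finset.sum_union hdisj, hunion]; exact hi₀.2)
  refine ⟨i₀, hi₀.1, x, fun i hi => ?_, ?_, fun i hi h => ?_, fun i hi h => ?_⟩
  · rcases lt_trichotomy (c i) (c i₀) with h | h | h
    · rw [hx1 i (Finset.mem_filter.2 ⟨hi, h⟩)]
      exact ⟨(hw i).le, le_rfl⟩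
    · exact hx2 i (Finset.mem_filter.2 ⟨hi, h⟩)
    · rw [hx3 i (by simp [h.le]) (by simp [h.ne'])]
      exact ⟨le_rfl, (hw i).le⟩
  · rw [← Finset.sum_union hdisj, hunion] at hx4
    rw [← hx4]
    refine (Finset.sum_subset (Finset.filter_subset _ _) fun k hk h => hx3 k ?_ ?_).symm
    · intro h'; exact h (Finset.mem_filter.2 ⟨hk, (Finset.mem_filter.1 h').2.le⟩)
    · intro h'; exact h (Finset.mem_filter.2 ⟨hk, (Finset.mem_filter.1 h').2.le⟩)
  · by_contra! hc
    exact h (hx1 i (Finset.mem_filter.2 ⟨hi, hc⟩))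
  · by_contra! hc
    exact h (hx3 i (by simp [hc.le]) (by simp [hc.ne']))

/-- For given `r`, the items can be priced and distributed. -/
theorem exists_isClearing (r : N → ℝ) (hr : ∀ i, 0 < r i) : ∃ p f, P.IsClearing r p f := by
  classical
  have key : ∀ j, ∃ q : ℝ, 0 < P.sgn j * q ∧ ∃ x : T → ℝ, ∑ t ∈ P.pieces j, x t = 1 - ∑ i, P.base i j ∧
      ∀ t ∈ P.pieces j, (0 ≤ x t ∧ x t ≤ P.len t) ∧
        (x t ≠ P.len t → r (P.agent t) * P.slope t ≤ q) ∧
        (x t ≠ 0 → q ≤ r (P.agent t) * P.slope t) := by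
    intro j
    have h0 : 0 ≤ ∑ i, P.base i j := Finset.sum_nonneg fun i _ => P.base_nonneg i _
    obtain ⟨s, hs, hs1⟩ := P.enough j
    have hlen : ∑ t ∈ s, P.len t ≤ ∑ t ∈ P.pieces j, P.len t :=
      Finset.sum_le_sum_of_subset_of_nonneg (fun t ht => P.mem_pieces.2 (hs t ht))
        fun t _ _ => (P.len_pos t).le
    -- The supply left over by `base` goes to the pieces in decreasing order of `r * slope`, for
    -- goods and bads alike; the value at which it runs out is the price.
    obtain ⟨t₀, ht₀, x, hx1, hx2, hx3, hx4⟩ := exists_level (P.pieces j) P.len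
      (fun t => -(r (P.agent t) * P.slope t)) P.len_pos
      (sub_pos.2 (P.base_lt j)) (by linarith)
    refine ⟨r (P.agent t₀) * P.slope t₀, ?_, x, hx2, fun t ht => ⟨hx1 t ht,
      fun h => by have := hx3 t ht h; linarith, fun h => by have := hx4 t ht h; linarith⟩⟩
    have h1 := P.slope_pos t₀
    rw [P.mem_pieces.1 ht₀] at h1
    have := mul_pos (hr (P.agent t₀)) h1
    linarith
  choose p hp x hxs hx using key
  refine ⟨p, fun t => x (P.item t) t * p (P.item t), hr, hp, fun t => ?_, fun t => ?_, fun t h => ?_,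
    fun t h => ?_, fun j => ?_⟩
  · have h1 := (hx (P.item t) t (P.mem_pieces.2 rfl)).1.1
    have h2 := hp (P.item t)
    nlinarith
  · have h1 := (hx (P.item t) t (P.mem_pieces.2 rfl)).1.2
    have h2 := hp (P.item t)
    nlinarith
  · exact (hx (P.item t) t (P.mem_pieces.2 rfl)).2.1 fun h' => h (by rw [h'])
  · exact (hx (P.item t) t (P.mem_pieces.2 rfl)).2.2 fun h' => h (by rw [h', zero_mul])
  · rw [← hxs, Finset.sum_mul]
    refine Finset.sum_congr rfl fun t ht => ?_
    rw [P.mem_pieces.1 ht]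

end PieceMarket

/-! ### The deformed system as a family of polyhedra -/

namespace PieceMarket

variable {N M T : Type*}

/-- Indices of the unknowns: `r`, prices, spending, and the deformation parameter. -/
abbrev Var (N M T : Type*) := N ⊕ M ⊕ T ⊕ Unit

/-- A piece is partial (`none`), empty (`some false`) or full (`some true`); an agent other than `o`
is low (`false`) or high (`true`). -/
abbrev State (T : Type*) {N : Type*} (o : N) := (T → Option Bool) × ({i // i ≠ o} → Bool)

/-- Indices of the equations of a state. -/
abbrev Eqn (M T : Type*) {N : Type*} (o : N) := T ⊕ M ⊕ {i // i ≠ o} ⊕ Unit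

/-- Indices of the inequalities of a state. -/
abbrev Ineq (M T : Type*) {N : Type*} (o : N) := (T × Bool) ⊕ {i // i ≠ o} ⊕ Bool ⊕ M

/-- Coordinates. -/
def vr (v : Var N M T → ℝ) (i : N) : ℝ := v (.inl i)
def vp (v : Var N M T → ℝ) (j : M) : ℝ := v (.inr (.inl j))
def vf (v : Var N M T → ℝ) (t : T) : ℝ := v (.inr (.inr (.inl t)))
def vm (v : Var N M T → ℝ) : ℝ := v (.inr (.inr (.inr ())))

def cr (i : N) : (Var N M T → ℝ) →ₗ[ℝ] ℝ := LinearMap.proj (.inl i)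
def cp (j : M) : (Var N M T → ℝ) →ₗ[ℝ] ℝ := LinearMap.proj (.inr (.inl j))
def cf (t : T) : (Var N M T → ℝ) →ₗ[ℝ] ℝ := LinearMap.proj (.inr (.inr (.inl t)))
def cm : (Var N M T → ℝ) →ₗ[ℝ] ℝ := LinearMap.proj (.inr (.inr (.inr ())))

@[simp] theorem cr_apply (v : Var N M T → ℝ) (i : N) : cr i v = vr v i := rfl
@[simp] theorem cp_apply (v : Var N M T → ℝ) (j : M) : cp j v = vp v j := rfl
@[simp] theorem cf_apply (v : Var N M T → ℝ) (t : T) : cf t v = vf v t := rfl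
@[simp] theorem cm_apply (v : Var N M T → ℝ) : cm v = vm v := rfl

variable [Fintype N] [Fintype M] [Fintype T] (P : PieceMarket N M T) (o : N) (ε m δ : ℝ)

/-- Spending on a piece that is empty (`false`) or full (`true`). -/
def cap (t : T) (β : Bool) (q : ℝ) : ℝ := if β then P.len t * q else 0

/-- The sign of a side of a piece. -/
def eta (β : Bool) : ℝ := if β then -1 else 1

theorem eta_ne_zero (β : Bool) : eta β ≠ 0 := by cases β <;> simp [eta]

/-- Linearity in `r` and `p` is the reason for using the reciprocal of the marginal utility of money
as an unknown; spending instead of amounts does the same for the capacities and the excess. -/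
def tieForm (t : T) : (Var N M T → ℝ) →ₗ[ℝ] ℝ := cp (P.item t) - P.slope t • cr (P.agent t)

def gapForm (t : T) (β : Bool) : (Var N M T → ℝ) →ₗ[ℝ] ℝ :=
  cf t - P.cap t β 1 • cp (P.item t)

noncomputable def clearForm (j : M) : (Var N M T → ℝ) →ₗ[ℝ] ℝ :=
  ∑ t ∈ P.pieces j, cf t - (1 - ∑ i, P.base i j) • cp j

noncomputable def excessForm (i : N) : (Var N M T → ℝ) →ₗ[ℝ] ℝ :=
  ∑ j, (P.W i j - P.base i j) • cp j - ∑ t ∈ P.agentPieces i, cf t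

@[simp] theorem tieForm_apply (v : Var N M T → ℝ) (t : T) :
    P.tieForm t v = vp v (P.item t) - vr v (P.agent t) * P.slope t := by
  simp [tieForm, mul_comm]

@[simp] theorem gapForm_apply (v : Var N M T → ℝ) (t : T) (β : Bool) :
    P.gapForm t β v = vf v t - P.cap t β (vp v (P.item t)) := by
  cases β <;> simp [gapForm, cap]

@[simp] theorem clearForm_apply (v : Var N M T → ℝ) (j : M) :
    P.clearForm j v = ∑ t ∈ P.pieces j, vf v t - (1 - ∑ i, P.base i j) * vp v j := by
  simp [clearForm]

@[simp] theorem excessForm_apply (v : Var N M T → ℝ) (i : N) :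
    P.excessForm i v = P.excess (vp v) (vf v) i := by
  simp [excessForm, excess]

/-- The equations of a state. -/
noncomputable def eqnForm (σ : State T o) : Eqn M T o → (Var N M T → ℝ) →ₗ[ℝ] ℝ
  | .inl t => (σ.1 t).elim (P.tieForm t) (P.gapForm t)
  | .inr (.inl j) => P.clearForm j
  | .inr (.inr (.inl i)) => if σ.2 i then P.excessForm i - cm else cr i
  | .inr (.inr (.inr _)) => cr o

/-- The right hand sides of the equations. -/
def eqnVal (σ : State T o) : Eqn M T o → ℝ
  | .inl _ => 0
  | .inr (.inl _) => 0
  | .inr (.inr (.inl i)) => if σ.2 i then 0 else ε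
  | .inr (.inr (.inr _)) => 1

/-- The inequalities of a state. -/
noncomputable def ineqForm (σ : State T o) : Ineq M T o → (Var N M T → ℝ) →ₗ[ℝ] ℝ
  | .inl (t, β) => (σ.1 t).elim ((P.sgn (P.item t) * eta β) • P.gapForm t β)
      fun β' => if β = β' then eta β • P.tieForm t else 0
  | .inr (.inl i) => if σ.2 i then cr i else cm - P.excessForm i
  | .inr (.inr (.inl β)) => eta β • cm
  | .inr (.inr (.inr j)) => P.sgn j • cp j

/-- The right hand sides of the inequalities. -/
def ineqVal (σ : State T o) : Ineq M T o → ℝ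
  -- An empty or full piece has only one genuine inequality; the index of the other side carries `-1
  -- ≤ 0`, which always holds and is never tight.
  | .inl (t, β) => (σ.1 t).elim 0 fun β' => if β = β' then 0 else -1
  | .inr (.inl i) => if σ.2 i then ε else 0
  | .inr (.inr (.inl β)) => if β then -m else 0
  -- A closed substitute for strict positivity of the signed price; for the `δ` chosen later it is
  -- never tight at a solution.
  | .inr (.inr (.inr _)) => δ

/-- The solutions in a given state. -/
def cell (σ : State T o) : Set (Var N M T → ℝ) :=
  polyCell (P.eqnForm o σ) (eqnVal o ε σ) (P.ineqForm o σ) (ineqVal o ε m δ σ)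

/-- The solutions in a given state, each with a tight inequality. -/
def flags (σ : State T o) : Set ((Var N M T → ℝ) × Ineq M T o) :=
  polyFlags (P.eqnForm o σ) (eqnVal o ε σ) (P.ineqForm o σ) (ineqVal o ε m δ σ)

/-- A piece conforms to its state. -/
def PieceOK (v : Var N M T → ℝ) (t : T) : Option Bool → Prop
  | none => vp v (P.item t) = vr v (P.agent t) * P.slope t ∧
      ∀ β, 0 ≤ P.sgn (P.item t) * eta β * (vf v t - P.cap t β (vp v (P.item t)))
  | some β => vf v t = P.cap t β (vp v (P.item t)) ∧
      0 ≤ eta β * (vp v (P.item t) - vr v (P.agent t) * P.slope t)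

/-- An agent conforms to its state. -/
def AgentOK (v : Var N M T → ℝ) (i : N) : Bool → Prop
  | true => P.excess (vp v) (vf v) i = vm v ∧ ε ≤ vr v i
  | false => vr v i = ε ∧ P.excess (vp v) (vf v) i ≤ vm v

/-- A side of a piece is tight. -/
def PieceTight (v : Var N M T → ℝ) (t : T) (β : Bool) : Option Bool → Prop
  | none => vf v t = P.cap t β (vp v (P.item t))
  | some β' => β = β' ∧ vp v (P.item t) = vr v (P.agent t) * P.slope t

/-- The inequality of an agent is tight. -/
def AgentTight (v : Var N M T → ℝ) (i : N) : Bool → Prop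
  | true => vr v i = ε
  | false => P.excess (vp v) (vf v) i = vm v

variable {P o ε m δ} {v : Var N M T → ℝ} {σ : State T o}

theorem mem_cell : v ∈ P.cell o ε m δ σ ↔ (∀ t, P.PieceOK v t (σ.1 t)) ∧
    (∀ j, ∑ t ∈ P.pieces j, vf v t = (1 - ∑ i, P.base i j) * vp v j) ∧
    (∀ i : {i // i ≠ o}, P.AgentOK ε v i (σ.2 i)) ∧ vr v o = 1 ∧ 0 ≤ vm v ∧ vm v ≤ m ∧
    ∀ j, δ ≤ P.sgn j * vp v j := by
  simp only [cell, polyCell, Set.mem_ofPred_eq, Sum.forall, eqnForm, eqnVal, ineqForm, ineqVal,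
    clearForm_apply, sub_eq_zero, Prod.forall, Bool.forall_bool, eta, forall_const]
  have hp : ∀ t, P.PieceOK v t (σ.1 t) ↔ ((σ.1 t).elim (P.tieForm t) (P.gapForm t)) v = 0 ∧
      ∀ β, ((σ.1 t).elim 0 fun β' => if β = β' then 0 else -1) ≤
        ((σ.1 t).elim ((P.sgn (P.item t) * eta β) • P.gapForm t β)
          fun β' => if β = β' then eta β • P.tieForm t else 0) v := by
    intro t
    rcases σ.1 t with _ | β'
    · simp [PieceOK, sub_eq_zero]
    · cases β' <;> simp [PieceOK, sub_eq_zero]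
  have ha : ∀ i : {i // i ≠ o}, P.AgentOK ε v i (σ.2 i) ↔
      (if σ.2 i then P.excessForm i - cm else cr i.1) v = (if σ.2 i then 0 else ε) ∧
      (if σ.2 i then ε else 0) ≤ (if σ.2 i then cr i.1 else cm - P.excessForm i) v := by
    intro i
    rcases σ.2 i <;> simp [AgentOK, sub_eq_zero]
  simp only [hp, ha, forall_and, Bool.forall_bool, eta]
  simp
  tauto

theorem tight_piece {t : T} {β : Bool} (hv : v ∈ P.cell o ε m δ σ) :
    (v, .inl (t, β)) ∈ P.flags o ε m δ σ ↔ P.PieceTight v t β (σ.1 t) := by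
  have h1 : P.sgn (P.item t) ≠ 0 := by rcases P.sgn_eq (P.item t) with h | h <;> simp [h]
  have h2 := eta_ne_zero β
  have h3 : (v, .inl (t, β)) ∈ P.flags o ε m δ σ ↔
    P.ineqForm o σ (.inl (t, β)) v = ineqVal (M := M) o ε m δ σ (.inl (t, β)) := and_iff_right hv
  rw [h3]
  simp only [ineqForm, ineqVal]
  rcases σ.1 t with _ | β'
  · simp [PieceTight, sub_eq_zero, h1, h2]
  · by_cases hb : β = β' <;> simp [PieceTight, hb, sub_eq_zero, eta_ne_zero]

theorem tight_agent {i : {i // i ≠ o}} (hv : v ∈ P.cell o ε m δ σ) :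
    (v, .inr (.inl i)) ∈ P.flags o ε m δ σ ↔ P.AgentTight ε v i (σ.2 i) := by
  have h3 : (v, .inr (.inl i)) ∈ P.flags o ε m δ σ ↔
    P.ineqForm o σ (.inr (.inl i)) v = ineqVal (M := M) o ε m δ σ (.inr (.inl i)) :=
      and_iff_right hv
  rw [h3]
  simp only [ineqForm, ineqVal]
  rcases σ.2 i
  · simp only [AgentTight, Bool.false_eq_true, if_false, LinearMap.sub_apply, cm_apply,
      excessForm_apply, sub_eq_zero]
    exact eq_comm
  · simp [AgentTight]

theorem tight_param {β : Bool} (hv : v ∈ P.cell o ε m δ σ) :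
    (v, .inr (.inr (.inl β))) ∈ P.flags o ε m δ σ ↔ vm v = if β then m else 0 := by
  have h3 : (v, .inr (.inr (.inl β))) ∈ P.flags o ε m δ σ ↔
    P.ineqForm o σ (.inr (.inr (.inl β))) v = ineqVal (M := M) o ε m δ σ (.inr (.inr (.inl β))) :=
      and_iff_right hv
  rw [h3]
  simp only [ineqForm, ineqVal]
  cases β <;> simp [eta]

theorem tight_price {j : M} (hv : v ∈ P.cell o ε m δ σ) :
    (v, .inr (.inr (.inr j))) ∈ P.flags o ε m δ σ ↔ P.sgn j * vp v j = δ := by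
  have h3 : (v, .inr (.inr (.inr j))) ∈ P.flags o ε m δ σ ↔
    P.ineqForm o σ (.inr (.inr (.inr j))) v = ineqVal (M := M) o ε m δ σ (.inr (.inr (.inr j))) :=
      and_iff_right hv
  rw [h3]
  simp [ineqForm, ineqVal]

theorem isClearing_of_mem_cell (hε : 0 < ε) (hδ : 0 < δ) (hv : v ∈ P.cell o ε m δ σ) :
    P.IsClearing (vr v) (vp v) (vf v) := by
  obtain ⟨h1, h2, h3, h4, -, -, h7⟩ := mem_cell.1 hv
  have hs : ∀ j, 0 < P.sgn j * vp v j := fun j => hδ.trans_le (h7 j)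
  have hle : ∀ t, 0 ≤ P.sgn (P.item t) * (P.len t * vp v (P.item t)) := fun t => by
    have := mul_pos (P.len_pos t) (hs (P.item t)); linarith
  have key : ∀ t, (0 ≤ P.sgn (P.item t) * vf v t) ∧
      (P.sgn (P.item t) * vf v t ≤ P.sgn (P.item t) * (P.len t * vp v (P.item t))) ∧
      (vf v t ≠ P.len t * vp v (P.item t) → vr v (P.agent t) * P.slope t ≤ vp v (P.item t)) ∧
      (vf v t ≠ 0 → vp v (P.item t) ≤ vr v (P.agent t) * P.slope t) := by
    intro t
    have h := h1 t
    rcases hst : σ.1 t with _ | (_ | _) <;> rw [hst] at h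
    · obtain ⟨h5, h6⟩ := h
      have hf := h6 false
      have ht := h6 true
      simp only [eta, cap, if_true, Bool.false_eq_true, if_false] at hf ht
      exact ⟨by linarith, by linarith, fun _ => h5.ge, fun _ => h5.le⟩
    · obtain ⟨h5, h6⟩ := h
      simp only [eta, cap, Bool.false_eq_true, if_false] at h5 h6
      rw [h5]
      exact ⟨by simp, by simpa using hle t, fun _ => by linarith, fun h => absurd rfl h⟩
    · obtain ⟨h5, h6⟩ := h
      simp only [eta, cap, if_true] at h5 h6
      rw [h5]
      exact ⟨hle t, le_rfl, fun h => absurd rfl h, fun _ => by linarith⟩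
  refine ⟨fun i => ?_, hs, fun t => (key t).1, fun t => (key t).2.1, fun t => (key t).2.2.1,
    fun t => (key t).2.2.2, h2⟩
  by_cases hi : i = o
  · rw [hi, h4]; exact one_pos
  · have h := h3 ⟨i, hi⟩
    rcases hst : σ.2 ⟨i, hi⟩ with _ | _ <;> rw [hst] at h
    · exact h.1 ▸ hε
    · exact hε.trans_le h.2

/-- The state is read off from the solution. At a point where an alternative switches this selects
one of the adjacent states. -/
theorem exists_mem_cell (h : P.IsClearing (vr v) (vp v) (vf v)) (ho : vr v o = 1)
    (hi : ∀ i, i ≠ o → ε ≤ vr v i ∧ P.excess (vp v) (vf v) i ≤ vm v ∧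
      (vr v i = ε ∨ P.excess (vp v) (vf v) i = vm v))
    (h0 : 0 ≤ vm v) (hm : vm v ≤ m) (hp : ∀ j, δ ≤ P.sgn j * vp v j) :
    ∃ σ, v ∈ P.cell o ε m δ σ := by
  classical
  refine ⟨(fun t => if vf v t = 0 then some false else if vf v t = P.len t * vp v (P.item t) then
    some true else none, fun i => decide (P.excess (vp v) (vf v) i = vm v)),
    mem_cell.2 ⟨fun t => ?_, h.clear, fun i => ?_, ho, h0, hm, hp⟩⟩
  · have h1 := h.nonneg t
    have h2 := h.le t
    have h3 := h.sgn_pos (P.item t)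
    have h4 := P.len_pos t
    dsimp only
    split_ifs with hf hf'
    · refine ⟨by simpa [cap] using hf, ?_⟩
      have : vf v t ≠ P.len t * vp v (P.item t) := by
        rw [hf]
        intro h5
        rcases mul_eq_zero.1 h5.symm with h6 | h6
        · exact h4.ne' h6
        · simp [h6] at h3
      simpa [eta] using h.of_not_full t this
    · refine ⟨by simpa [cap] using hf', ?_⟩
      simpa [eta] using h.of_not_empty t hf
    · refine ⟨le_antisymm (h.of_not_empty t hf) (h.of_not_full t hf'), fun β => ?_⟩
      cases β
      · simpa [eta, cap] using h1
      · simp only [eta, cap, if_true]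
        linarith
  · obtain ⟨h1, h2, h3⟩ := hi i i.2
    dsimp only
    by_cases h4 : P.excess (vp v) (vf v) i = vm v
    · simp only [h4, decide_true]
      exact ⟨h4, h1⟩
    · simp only [h4, decide_false]
      exact ⟨h3.resolve_right h4, h2⟩

theorem agent_of_mem_cell (hv : v ∈ P.cell o ε m δ σ) {i : N} (hi : i ≠ o) :
    ε ≤ vr v i ∧ P.excess (vp v) (vf v) i ≤ vm v ∧
      (vr v i = ε ∨ P.excess (vp v) (vf v) i = vm v) := by
  have h := (mem_cell.1 hv).2.2.1 ⟨i, hi⟩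
  rcases hst : σ.2 ⟨i, hi⟩ with _ | _ <;> rw [hst] at h
  · exact ⟨h.1.ge, h.2, Or.inl h.1⟩
  · exact ⟨h.2, h.1.le, Or.inr h.1⟩

variable (T) in
open Classical in
/-- The state on the other side of an inequality. -/
noncomputable def flipState (σ : State T o) : Ineq M T o → State T o
  | .inl (t, β) => (Function.update σ.1 t (if σ.1 t = none then some β else none), σ.2)
  | .inr (.inl i) => (σ.1, Function.update σ.2 i (!σ.2 i))
  | .inr (.inr _) => σ

/-- Complementarity: when an inequality is tight, it can become the equation of the neighbouring
state, and the former equation supplies the tight inequality there. Only the bounds on the parameter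
and the prices have no neighbour. -/
theorem flip_mem_flags (hδ : 0 < δ) {a : Ineq M T o} (ha : ∀ x, a ≠ .inr (.inr x))
    (h : (v, a) ∈ P.flags o ε m δ σ) :
    (v, a) ∈ P.flags o ε m δ (flipState T σ a) ∧
      flipState T (flipState T σ a) a = σ ∧ flipState T σ a ≠ σ := by
  classical
  have hv : v ∈ P.cell o ε m δ σ := h.1
  obtain ⟨h1, h2, h3, h4, h5, h6, h7⟩ := mem_cell.1 hv
  rcases a with ⟨t, β⟩ | i | x
  · rw [tight_piece hv] at h
    have hs := hδ.trans_le (h7 (P.item t))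
    have hl := mul_pos (P.len_pos t) hs
    have h1t := h1 t
    have hσ : P.PieceOK v t (if σ.1 t = none then some β else none) ∧
        P.PieceTight v t β (if σ.1 t = none then some β else none) ∧
        (if (if σ.1 t = none then some β else none) = none then some β else none) = σ.1 t ∧
        (if σ.1 t = none then some β else none) ≠ σ.1 t := by
      rcases hst : σ.1 t with _ | β'
      · rw [hst] at h h1t
        simp only [if_true]
        exact ⟨⟨h, by simp [h1t.1]⟩, ⟨rfl, h1t.1⟩, by simp, by simp⟩
      · rw [hst] at h h1t
        obtain ⟨rfl, h⟩ := h
        refine ⟨⟨h, fun β' => ?_⟩, h1t.1, by simp, by simp⟩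
        rw [h1t.1]
        cases β <;> cases β' <;> simp [cap, eta] <;> linarith
    refine ⟨(tight_piece (σ := flipState T σ (.inl (t, β))) (mem_cell.2 ⟨fun t' => ?_, h2, h3, h4, h5, h6, h7⟩)).2 ?_, ?_, ?_⟩
    · by_cases ht : t' = t
      · subst ht
        simpa [flipState] using hσ.1
      · simpa [flipState, ht] using h1 t'
    · simpa [flipState] using hσ.2.1
    · simp only [flipState, Function.update_self, Function.update_idem, hσ.2.2.1,
        Function.update_eq_self]
    · intro heq
      have := congrFun (congrArg Prod.fst heq) t
      simp only [flipState, Function.update_self] at this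
      exact hσ.2.2.2 this
  · rw [tight_agent hv] at h
    have h3i := h3 i
    have hσ : P.AgentOK ε v i (!σ.2 i) ∧ P.AgentTight ε v i (!σ.2 i) := by
      rcases hst : σ.2 i with _ | _
      · rw [hst] at h h3i
        exact ⟨⟨h, h3i.1.ge⟩, h3i.1⟩
      · rw [hst] at h h3i
        exact ⟨⟨h, h3i.1.le⟩, h3i.1⟩
    refine ⟨(tight_agent (σ := flipState T σ (.inr (.inl i))) (mem_cell.2 ⟨h1, h2, fun i' => ?_, h4, h5, h6, h7⟩)).2 ?_, ?_, ?_⟩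
    · by_cases ht : i' = i
      · subst ht
        simpa [flipState] using hσ.1
      · simpa [flipState, ht] using h3 i'
    · simpa [flipState] using hσ.2
    · simp [flipState]
    · intro heq
      have := congrFun (congrArg Prod.snd heq) i
      simp [flipState] at this
  · exact absurd rfl (ha x)

end PieceMarket

/-! ### Genericity: each relation determines an entry of its own -/

theorem Subfield.mem_of_sum_mem {ι : Type*} {K : Subfield ℝ} {s : Finset ι} {f : ι → ℝ} {t₀ : ι}
    (h₀ : t₀ ∈ s) (hs : ∑ t ∈ s, f t ∈ K) (h : ∀ t ∈ s, t ≠ t₀ → f t ∈ K) : f t₀ ∈ K := by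
  classical
  rw [← Finset.add_sum_erase _ _ h₀] at hs
  have h1 : ∑ t ∈ s.erase t₀, f t ∈ K := K.sum_mem fun t ht =>
    h t (Finset.mem_of_mem_erase ht) (Finset.ne_of_mem_erase ht)
  simpa using K.sub_mem hs h1

theorem Subfield.mem_of_mul_mem {K : Subfield ℝ} {a b : ℝ} (hb : b ≠ 0) (hbK : b ∈ K)
    (h : a * b ∈ K) : a ∈ K := by
  have := K.div_mem h hbK
  rwa [mul_div_cancel_right₀ _ hb] at this

namespace PieceMarket

variable {N M T : Type*} [Fintype N] [Fintype M] [Fintype T] (P : PieceMarket N M T) (o : N)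

/-- The free parameters: slopes, bounded lengths, endowments of the agents other than `o`, and
nonzero base amounts. -/
abbrev Par := T ⊕ {t // P.bdd t} ⊕ ({i // i ≠ o} × M) ⊕ {x : N × M // P.base x.1 x.2 ≠ 0}

/-- The values of the free parameters. -/
def parVal : P.Par o → ℝ
  | .inl t => P.slope t
  | .inr (.inl t) => P.len t
  | .inr (.inr (.inl x)) => P.W x.1 x.2
  | .inr (.inr (.inr x)) => P.base x.1.1 x.1.2

/-- The free parameters are algebraically independent. -/
def Generic : Prop := AlgebraicIndependent ℚ (P.parVal o)

abbrev zU (t : T) : P.Par o ⊕ Var N M T := .inl (.inl t)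
abbrev zL (t : {t // P.bdd t}) : P.Par o ⊕ Var N M T := .inl (.inr (.inl t))
abbrev zW (x : {i // i ≠ o} × M) : P.Par o ⊕ Var N M T := .inl (.inr (.inr (.inl x)))
abbrev zB (x : {x : N × M // P.base x.1 x.2 ≠ 0}) : P.Par o ⊕ Var N M T :=
  .inl (.inr (.inr (.inr x)))
abbrev zR (i : N) : P.Par o ⊕ Var N M T := .inr (.inl i)
abbrev zP (j : M) : P.Par o ⊕ Var N M T := .inr (.inr (.inl j))
abbrev zF (t : T) : P.Par o ⊕ Var N M T := .inr (.inr (.inr (.inl t)))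
abbrev zM : P.Par o ⊕ Var N M T := .inr (.inr (.inr (.inr ())))

variable {P o} {ε m δ : ℝ} {v : Var N M T → ℝ} {σ : State T o}

/-- The parameter or unknown that is determined by the clearing of item `j`. -/
def ClearVar (v : Var N M T → ℝ) (σ : State T o) (j : M) (z : P.Par o ⊕ Var N M T) : Prop :=
  (∃ t, P.item t = j ∧ z = P.zF o t ∧ σ.1 t = none ∧ vf v t ≠ 0 ∧
      vf v t ≠ P.len t * vp v (P.item t)) ∨
    (∃ t : {t // P.bdd t}, P.item t = j ∧ z = P.zL o t ∧ vf v t = P.len t * vp v (P.item t)) ∨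
    ∃ x : {x : N × M // P.base x.1 x.2 ≠ 0}, x.1.2 = j ∧ z = P.zB o x

/-- The base amounts do not exhaust item `j`, so some piece of it is bought. If it is partial, its
spending can be solved for; otherwise it is full, hence bounded, and its length can be. -/
theorem exists_clearVar (hε : 0 < ε) (hδ : 0 < δ) (hv : v ∈ P.cell o ε m δ σ) (j : M) :
    ∃ z, ClearVar (P := P) v σ j z := by
  have h := isClearing_of_mem_cell hε hδ hv
  by_contra! hc
  simp only [ClearVar, not_or, not_exists, not_and] at hc
  have hF : ∀ t ∈ P.pieces j, vf v t = 0 := by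
    intro t ht
    rw [mem_pieces] at ht
    by_contra h0
    have h1 : vf v t = P.len t * vp v (P.item t) := by
      by_contra h1
      have hp := (mem_cell.1 hv).1 t
      rcases hst : σ.1 t with _ | (_ | _) <;> rw [hst] at hp
      · exact (hc (P.zF o t)).1 t ht rfl hst h0 h1
      · exact h0 (by simpa [cap] using hp.1)
      · exact h1 (by simpa [cap] using hp.1)
    by_cases hb : P.bdd t
    · exact (hc (P.zL o ⟨t, hb⟩)).2.1 ⟨t, hb⟩ ht rfl h1
    · exact h.not_full_of_unbounded hb h1
  obtain ⟨t, ht, ht0⟩ := h.exists_not_empty j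
  exact ht0 (hF t (P.mem_pieces.2 ht))

open Classical in
/-- The parameter or unknown that is determined by an equation. -/
noncomputable def elimEqn (σ : State T o) (j₀ : M) (z : M → P.Par o ⊕ Var N M T) :
    Eqn M T o → P.Par o ⊕ Var N M T
  | .inl t => if σ.1 t = none then P.zU o t else P.zF o t
  | .inr (.inl j) => z j
  | .inr (.inr (.inl i)) => if σ.2 i then P.zW o (i, j₀) else P.zR o i
  | .inr (.inr (.inr _)) => P.zR o o

open Classical in
/-- The parameter or unknown that is determined by a tight inequality. -/
noncomputable def elimIneq (σ : State T o) (j₀ : M) : Ineq M T o → P.Par o ⊕ Var N M T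
  | .inl (t, _) => if σ.1 t = none then P.zF o t else P.zU o t
  | .inr (.inl i) => if σ.2 i then P.zR o i else P.zW o (i, j₀)
  | .inr (.inr _) => P.zM o

/-- The entry `z j` is never a slope, an endowment or an `r`. It is a spending only for a partial
piece, and the equation of such a piece takes the slope instead. -/
theorem elimEqn_injective {j₀ : M} {z : M → P.Par o ⊕ Var N M T}
    (hz : ∀ j, ClearVar v σ j (z j)) : Function.Injective (elimEqn σ j₀ z) := by
  have hzF : ∀ j t, z j = P.zF o t → P.item t = j ∧ σ.1 t = none := by
    intro j t h
    rcases hz j with ⟨t', h1, h2, h3, -⟩ | ⟨t', h1, h2, -⟩ | ⟨x, h1, h2⟩ <;> rw [h2] at h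
    · simp at h; subst h; exact ⟨h1, h3⟩
    · simp at h
    · simp at h
  have hz' : ∀ j, (∀ t, z j ≠ P.zU o t) ∧ (∀ x, z j ≠ P.zW o x) ∧ (∀ i, z j ≠ P.zR o i) := by
    intro j
    rcases hz j with ⟨t', h1, h2, h3, -⟩ | ⟨t', h1, h2, -⟩ | ⟨x, h1, h2⟩ <;> simp [h2]
  have hzinj : ∀ j j', z j = z j' → j = j' := by
    intro j j' h
    rcases hz j with ⟨t, h1, h2, -⟩ | ⟨t, h1, h2, -⟩ | ⟨x, h1, h2⟩ <;>
    rcases hz j' with ⟨t', h1', h2', -⟩ | ⟨t', h1', h2', -⟩ | ⟨x', h1', h2'⟩ <;>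
    rw [h2, h2'] at h <;> simp at h <;> subst h <;> rw [← h1, ← h1']
  rintro (t | j | i | _) (t' | j' | i' | _) h <;> simp only [elimEqn] at h
  · split_ifs at h <;> simp at h <;> rw [h]
  · split_ifs at h with h1
    · exact absurd h.symm ((hz' _).1 _)
    · exact absurd (hzF _ _ h.symm).2 h1
  · split_ifs at h <;> simp at h
  · split_ifs at h; simp at h
  · split_ifs at h with h1
    · exact absurd h ((hz' _).1 _)
    · exact absurd (hzF _ _ h).2 h1
  · rw [hzinj _ _ h]
  · split_ifs at h with h1
    · exact absurd h ((hz' _).2.1 _)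
    · exact absurd h ((hz' _).2.2 _)
  · exact absurd h ((hz' _).2.2 _)
  · split_ifs at h <;> simp at h
  · split_ifs at h with h1
    · exact absurd h.symm ((hz' _).2.1 _)
    · exact absurd h.symm ((hz' _).2.2 _)
  · split_ifs at h <;> simp at h <;> first | rw [h] | rw [Subtype.ext h]
  · split_ifs at h; simp at h
    exact absurd h i.2
  · split_ifs at h; simp at h
  · exact absurd h.symm ((hz' _).2.2 _)
  · split_ifs at h; simp at h
    exact absurd h.symm i'.2
  · rfl

/-- Equation and inequality of a piece or agent take complementary entries. The remaining collision,
a spending `z j`, is excluded because `ClearVar` asks for a piece that is neither empty nor full, so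
that neither of its inequalities is tight. -/
theorem elimIneq_ne_elimEqn {j₀ : M} {z : M → P.Par o ⊕ Var N M T}
    (hz : ∀ j, ClearVar v σ j (z j)) (hv : v ∈ P.cell o ε m δ σ) {a : Ineq M T o}
    (ha : (v, a) ∈ P.flags o ε m δ σ) (q : Eqn M T o) : elimEqn σ j₀ z q ≠ elimIneq σ j₀ a := by
  have hz' : ∀ j, (∀ t, z j ≠ P.zU o t) ∧ (∀ x, z j ≠ P.zW o x) ∧ (∀ i, z j ≠ P.zR o i) ∧
      z j ≠ P.zM o := by
    intro j
    rcases hz j with ⟨t', h1, h2, h3, -⟩ | ⟨t', h1, h2, -⟩ | ⟨x, h1, h2⟩ <;> simp [h2]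
  intro h
  rcases a with ⟨t, β⟩ | i | x
  · rcases q with t' | j | i' | _ <;> simp only [elimEqn, elimIneq] at h
    · split_ifs at h with h1 h2 <;> simp at h <;> subst h <;> contradiction
    · split_ifs at h with h1
      · rcases hz j with ⟨t', h1', h2, h3, h4, h5⟩ | ⟨t', h1', h2, -⟩ | ⟨x, h1', h2⟩ <;> rw [h2] at h
        · simp at h
          subst h
          rw [tight_piece hv, h1] at ha
          cases β
          · exact h4 (by simpa [PieceTight, cap] using ha)
          · exact h5 (by simpa [PieceTight, cap] using ha)
        · simp at h
        · simp at h
      · exact (hz' j).1 _ h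
    · split_ifs at h <;> simp at h
    · split_ifs at h; simp at h
  · rcases q with t' | j | i' | _ <;> simp only [elimEqn, elimIneq] at h
    · split_ifs at h <;> simp at h
    · split_ifs at h with h1
      · exact (hz' j).2.2.1 _ h
      · exact (hz' j).2.1 _ h
    · split_ifs at h with h1 h2 <;> simp at h <;>
        first
        | (subst h; contradiction)
        | (have := Subtype.ext h; subst this; contradiction)
    · split_ifs at h; simp at h
      exact i.2 h.symm
  · rcases q with t' | j | i' | _ <;> simp only [elimEqn, elimIneq] at h
    · split_ifs at h; simp at h
    · exact (hz' j).2.2.2 h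
    · split_ifs at h; simp at h
    · simp at h

/-- Two inequalities share an entry only as two sides of one piece or as the two ends of the
parameter interval, and these are not tight together since `P.len t * vp v (P.item t) ≠ 0` and `m ≠
0`. -/
theorem elimIneq_injOn {j₀ : M} (hm : 0 < m) (hδ : 0 < δ) (hp : ∀ j, P.sgn j * vp v j ≠ δ)
    (hv : v ∈ P.cell o ε m δ σ) {a b : Ineq M T o}
    (ha : (v, a) ∈ P.flags o ε m δ σ) (hb : (v, b) ∈ P.flags o ε m δ σ)
    (h : elimIneq (P := P) σ j₀ a = elimIneq σ j₀ b) : a = b := by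
  have hpos : ∀ t, P.len t * vp v (P.item t) ≠ 0 := fun t => by
    refine mul_ne_zero (P.len_pos t).ne' fun h0 => ?_
    have := (mem_cell.1 hv).2.2.2.2.2.2 (P.item t)
    rw [h0, mul_zero] at this
    linarith
  rcases a with ⟨t, β⟩ | i | β | j <;> rcases b with ⟨t', β'⟩ | i' | β' | j' <;>
    simp only [elimIneq] at h
  · have htt : t = t' := by
      split_ifs at h <;> simpa using h
    subst htt
    rw [tight_piece hv] at ha hb
    rcases hst : σ.1 t with _ | γ <;> rw [hst] at ha hb
    · have hab : P.cap t β (vp v (P.item t)) = P.cap t β' (vp v (P.item t)) := ha.symm.trans hb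
      have := hpos t
      cases β <;> cases β' <;> simp_all [cap]
    · rw [ha.1, hb.1]
  · split_ifs at h <;> simp at h
  · split_ifs at h; simp at h
  · split_ifs at h; simp at h
  · split_ifs at h <;> simp at h
  · split_ifs at h <;> simp at h <;> first | rw [h] | rw [Subtype.ext h]
  · split_ifs at h; simp at h
  · split_ifs at h; simp at h
  · split_ifs at h; simp at h
  · split_ifs at h; simp at h
  · rw [tight_param hv] at ha hb
    cases β <;> cases β' <;> simp_all [hm.ne']
  · exact absurd ((tight_price hv).1 hb) (hp j')
  · split_ifs at h; simp at h
  · split_ifs at h; simp at h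
  · exact absurd ((tight_price hv).1 ha) (hp j)
  · exact absurd ((tight_price hv).1 ha) (hp j)

/-- What is known about a parameter or unknown that an equation or tight inequality determines. -/
def Determined (ε m : ℝ) (v : Var N M T → ℝ) (j₀ : M) (z : M → P.Par o ⊕ Var N M T) :
    P.Par o ⊕ Var N M T → Prop
  | .inl (.inl t) => vp v (P.item t) = vr v (P.agent t) * P.slope t
  | .inl (.inr (.inl t)) => z (P.item t) = P.zL o t
  | .inl (.inr (.inr (.inl x))) => x.2 = j₀ ∧ P.excess (vp v) (vf v) x.1 = vm v
  | .inl (.inr (.inr (.inr x))) => z x.1.2 = P.zB o x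
  | .inr (.inl i) => i = o ∨ vr v i = ε
  | .inr (.inr (.inl _)) => False
  | .inr (.inr (.inr (.inl t))) => vf v t = 0 ∨ vf v t = P.len t * vp v (P.item t) ∨
      z (P.item t) = P.zF o t
  | .inr (.inr (.inr (.inr _))) => vm v = 0 ∨ vm v = m

theorem determined_elimEqn {j₀ : M} {z : M → P.Par o ⊕ Var N M T}
    (hz : ∀ j, ClearVar v σ j (z j)) (hv : v ∈ P.cell o ε m δ σ) (q : Eqn M T o) :
    Determined ε m v j₀ z (elimEqn σ j₀ z q) := by
  obtain ⟨h1, -, h3, -⟩ := mem_cell.1 hv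
  rcases q with t | j | i | _ <;> simp only [elimEqn]
  · have h := h1 t
    rcases hst : σ.1 t with _ | β <;> rw [hst] at h
    · simpa [Determined] using h.1
    · have h2 := h.1
      cases β <;> simp only [cap, if_true, Bool.false_eq_true, if_false] at h2 <;>
        simp [Determined, h2]
  · rcases hz j with ⟨t', h1', h2, -⟩ | ⟨t', h1', h2, -⟩ | ⟨x, h1', h2⟩ <;> rw [h2]
    · exact Or.inr (Or.inr (by rw [h1', h2]))
    · simp only [Determined]; rw [h1', h2]
    · simp only [Determined]; rw [h1', h2]
  · have h := h3 i
    rcases hst : σ.2 i with _ | _ <;> rw [hst] at h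
    · exact Or.inr h.1
    · exact ⟨rfl, h.1⟩
  · exact Or.inl rfl

theorem determined_elimIneq {j₀ : M} {z : M → P.Par o ⊕ Var N M T}
    (hp : ∀ j, P.sgn j * vp v j ≠ δ) (hv : v ∈ P.cell o ε m δ σ) {a : Ineq M T o}
    (ha : (v, a) ∈ P.flags o ε m δ σ) : Determined ε m v j₀ z (elimIneq σ j₀ a) := by
  rcases a with ⟨t, β⟩ | i | β | j <;> simp only [elimIneq]
  · rw [tight_piece hv] at ha
    rcases hst : σ.1 t with _ | β' <;> rw [hst] at ha
    · cases β <;> simp only [PieceTight, cap, if_true, Bool.false_eq_true, if_false] at ha <;>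
        simp [Determined, ha]
    · simpa [Determined] using ha.2
  · rw [tight_agent hv] at ha
    rcases hst : σ.2 i with _ | _ <;> rw [hst] at ha
    · exact ⟨rfl, ha⟩
    · exact Or.inr ha
  · rw [tight_param hv] at ha
    cases β
    · exact Or.inl ha
    · exact Or.inr ha
  · exact absurd ((tight_price hv).1 ha) (hp j)

/-- A subfield that contains all entries that are not determined contains all parameters. -/
theorem parVal_mem {j₀ : M} {z : M → P.Par o ⊕ Var N M T} {K : Subfield ℝ} (hεK : ε ∈ K)
    (hmK : m ∈ K) (hz : ∀ j, ClearVar v σ j (z j)) (h : P.IsClearing (vr v) (vp v) (vf v))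
    (ho : vr v o = 1)
    (hK : ∀ x, ¬ Determined ε m v j₀ z x → Sum.elim (P.parVal o) v x ∈ K) (x : P.Par o) :
    P.parVal o x ∈ K := by
  classical
  have hpne : ∀ j, vp v j ≠ 0 := fun j h0 => by
    have := h.sgn_pos j
    simp [h0] at this
  -- The order of solving: `r` and the deformation parameter, slopes (prices are never eliminated),
  -- then item by item lengths, base amounts and spending, and endowments at the end.
  have hr : ∀ i, vr v i ∈ K := by
    intro i
    by_cases hd : Determined ε m v j₀ z (P.zR o i)
    · rcases hd with rfl | hd
      · rw [ho]; exact K.one_mem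
      · rw [hd]; exact hεK
    · exact hK _ hd
  have hμ : vm v ∈ K := by
    by_cases hd : Determined ε m v j₀ z (P.zM o)
    · rcases hd with hd | hd <;> rw [hd]
      · exact K.zero_mem
      · exact hmK
    · exact hK _ hd
  have hp : ∀ j, vp v j ∈ K := fun j => hK (P.zP o j) id
  have hU : ∀ t, P.slope t ∈ K := by
    intro t
    by_cases hd : Determined ε m v j₀ z (P.zU o t)
    · refine Subfield.mem_of_mul_mem (h.pos (P.agent t)).ne' (hr _) ?_
      rw [mul_comm, ← show _ = _ from hd]
      exact hp _
    · exact hK _ hd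
  have hL : ∀ t, (∀ hb : P.bdd t, z (P.item t) ≠ P.zL o ⟨t, hb⟩) → P.len t ∈ K := by
    intro t ht
    by_cases hb : P.bdd t
    · exact hK (P.zL o ⟨t, hb⟩) (ht hb)
    · rw [P.len_eq t hb]
      exact ofNat_mem K 2
  have hB : ∀ i j, (∀ hb : P.base i j ≠ 0, z j ≠ P.zB o ⟨(i, j), hb⟩) → P.base i j ∈ K := by
    intro i j ht
    by_cases hb : P.base i j = 0
    · rw [hb]; exact K.zero_mem
    · exact hK (P.zB o ⟨(i, j), hb⟩) (ht hb)
  have hF : ∀ t, P.len t ∈ K → z (P.item t) ≠ P.zF o t → vf v t ∈ K := by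
    intro t hLt ht
    by_cases hd : Determined ε m v j₀ z (P.zF o t)
    · rcases hd with hd | hd | hd
      · rw [hd]; exact K.zero_mem
      · rw [hd]; exact K.mul_mem hLt (hp _)
      · exact absurd hd ht
    · exact hK _ hd
  -- The clearing equation of item `j` yields the entry `z j`: a partial spending, the length of a
  -- full piece by way of its spending, or a base amount.
  have hitem : ∀ j, (∀ t, P.item t = j → P.len t ∈ K ∧ vf v t ∈ K) ∧ ∀ i, P.base i j ∈ K := by
    intro j
    have hcl := h.clear j
    rcases hz j with ⟨t₀, rfl, hz', -⟩ | ⟨t₀, rfl, hz', hfull⟩ | ⟨x, rfl, hz'⟩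
    · have hB' : ∀ i, P.base i (P.item t₀) ∈ K := fun i => hB i _ fun hb => by simp [hz']
      have hL' : ∀ t, P.item t = P.item t₀ → P.len t ∈ K := fun t ht =>
        hL t fun hb => by rw [ht, hz']; simp
      refine ⟨fun t ht => ⟨hL' t ht, ?_⟩, hB'⟩
      have hF' : ∀ t ∈ P.pieces (P.item t₀), t ≠ t₀ → vf v t ∈ K := fun t ht hne => by
        rw [mem_pieces] at ht
        refine hF t (hL' t ht) ?_
        rw [ht, hz']
        simpa using hne.symm
      by_cases hne : t = t₀
      · subst hne
        refine Subfield.mem_of_sum_mem (P.mem_pieces.2 rfl) ?_ hF'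
        rw [hcl]
        exact K.mul_mem (K.sub_mem K.one_mem (K.sum_mem fun i _ => hB' i)) (hp _)
      · exact hF' t (P.mem_pieces.2 ht) hne
    · have hB' : ∀ i, P.base i (P.item t₀) ∈ K := fun i => hB i _ fun hb => by simp [hz']
      have hL' : ∀ t, P.item t = P.item t₀ → t ≠ t₀ → P.len t ∈ K := fun t ht hne =>
        hL t fun hb => by
          rw [ht, hz']
          simp only [ne_eq, Sum.inl.injEq, Sum.inr.injEq]
          rintro rfl
          exact hne rfl
      have hF' : ∀ t ∈ P.pieces (P.item t₀), t ≠ t₀ → vf v t ∈ K := fun t ht hne => by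
        rw [mem_pieces] at ht
        refine hF t (hL' t ht hne) ?_
        rw [ht, hz']
        simp
      have hf₀ : vf v t₀ ∈ K := by
        refine Subfield.mem_of_sum_mem (P.mem_pieces.2 rfl) ?_ hF'
        rw [hcl]
        exact K.mul_mem (K.sub_mem K.one_mem (K.sum_mem fun i _ => hB' i)) (hp _)
      refine ⟨fun t ht => ?_, hB'⟩
      by_cases hne : t = t₀
      · subst hne
        exact ⟨Subfield.mem_of_mul_mem (hpne _) (hp _) (hfull ▸ hf₀), hf₀⟩
      · exact ⟨hL' t ht hne, hF' t (P.mem_pieces.2 ht) hne⟩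
    · have hL' : ∀ t, P.item t = x.1.2 → P.len t ∈ K := fun t ht =>
        hL t fun hb => by rw [ht, hz']; simp
      have hF' : ∀ t, P.item t = x.1.2 → vf v t ∈ K := fun t ht => by
        refine hF t (hL' t ht) ?_
        rw [ht, hz']
        simp
      refine ⟨fun t ht => ⟨hL' t ht, hF' t ht⟩, fun i => ?_⟩
      have hB' : ∀ i ∈ Finset.univ, i ≠ x.1.1 → P.base i x.1.2 ∈ K := fun i _ hi =>
        hB i _ fun hb => by
          rw [hz']
          simp only [ne_eq, Sum.inl.injEq, Sum.inr.injEq]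
          intro hx
          exact hi (congrArg (fun y => y.1.1) hx).symm
      by_cases hi : i = x.1.1
      · subst hi
        refine Subfield.mem_of_sum_mem (f := fun i => P.base i x.1.2) (Finset.mem_univ _) ?_ hB'
        have h1 : (1 - ∑ i, P.base i x.1.2) ∈ K := by
          refine Subfield.mem_of_mul_mem (hpne x.1.2) (hp _) ?_
          rw [← hcl]
          exact K.sum_mem fun t ht => hF' t (P.mem_pieces.1 ht)
        simpa using K.sub_mem K.one_mem h1
      · exact hB' i (Finset.mem_univ _) hi
  rcases x with t | t | x | x
  · exact hU t
  · exact ((hitem _).1 t rfl).1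
  · by_cases hd : Determined ε m v j₀ z (P.zW o x)
    · obtain ⟨i, j⟩ := x
      obtain ⟨hj, hd⟩ := hd
      simp only at hj hd
      subst hj
      -- The budget equation of agent `i` is solved for its endowment of the distinguished item.
      have h1 : ∑ j', (P.W i j' - P.base i j') * vp v j' ∈ K := by
        have h2 : ∑ t ∈ P.agentPieces i, vf v t ∈ K := K.sum_mem fun t _ => ((hitem _).1 t rfl).2
        have h3 := K.add_mem hμ h2
        rw [← hd, excess] at h3
        simpa using h3
      have h2 : (P.W i j - P.base i j) * vp v j ∈ K := by
        refine Subfield.mem_of_sum_mem (f := fun j' => (P.W i j' - P.base i j') * vp v j')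
          (Finset.mem_univ _) h1 fun j' _ hj' => ?_
        refine K.mul_mem (K.sub_mem ?_ ((hitem j').2 i)) (hp j')
        exact hK (P.zW o (i, j')) fun hd' => hj' hd'.1
      have h3 := K.add_mem (Subfield.mem_of_mul_mem (hpne j) (hp j) h2) ((hitem j).2 i)
      simpa [parVal] using h3
    · exact hK _ hd
  · exact (hitem _).2 _

/-- At most one inequality is tight at a solution. -/
theorem Generic.tight_unique [Nonempty M] (hgen : P.Generic o) {ε m : ℚ} (hε : (0 : ℝ) < ε)
    (hm : (0 : ℝ) < m) (hδ : 0 < δ) (hv : v ∈ P.cell o ε m δ σ) (hp : ∀ j, P.sgn j * vp v j ≠ δ)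
    {a b : Ineq M T o} (ha : (v, a) ∈ P.flags o ε m δ σ) (hb : (v, b) ∈ P.flags o ε m δ σ) :
    a = b := by
  classical
  by_contra hab
  obtain ⟨j₀⟩ := ‹Nonempty M›
  have h := isClearing_of_mem_cell hε hδ hv
  choose z hz using exists_clearVar hε hδ hv
  let c : Bool → Ineq M T o := fun β => if β then a else b
  have hc : ∀ β, (v, c β) ∈ P.flags o ε m δ σ := by
    intro β; cases β
    · exact hb
    · exact ha
  have hcinj : Function.Injective c := by
    intro β β' h
    cases β <;> cases β' <;> simp_all [c, eq_comm]
  -- There are `card N + card M + card T` equations and one unknown more, so two tight inequalities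
  -- give too many relations. Rationality of `ε` and `m` puts them into every subfield.
  have hcard := card_le_of_determined hgen v
    (Sum.elim (elimEqn σ j₀ z) fun β => elimIneq σ j₀ (c β))
    ((elimEqn_injective hz).sumElim
      (fun β β' hβ => hcinj (elimIneq_injOn hm hδ hp hv (hc β) (hc β') hβ))
      fun q β => elimIneq_ne_elimEqn hz hv (hc β) q)
    (fun K hK => parVal_mem (j₀ := j₀) (SubfieldClass.ratCast_mem K ε)
      (SubfieldClass.ratCast_mem K m) hz h (mem_cell.1 hv).2.2.2.1 fun x hx => hK x ?_)
  · have h1 : Fintype.card {i // i ≠ o} + 1 = Fintype.card N := by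
      have : Fintype.card {i // i ≠ o} = Fintype.card N - 1 := by simp
      have h2 := Fintype.card_pos_iff.2 ⟨o⟩
      omega
    simp only [Eqn, Var, Fintype.card_sum, Fintype.card_bool, Fintype.card_unit] at hcard
    omega
  · rintro ⟨q | β, rfl⟩
    · exact hx (determined_elimEqn hz hv q)
    · exact hx (determined_elimIneq hp hv (hc β))

end PieceMarket

/-! ### Comparison of states and the parity theorem for markets -/

namespace PieceMarket

variable {N M T : Type*} [Fintype N] [Fintype M] [Fintype T] {P : PieceMarket N M T} {o : N}
  {ε m δ : ℝ} {v v' : Var N M T → ℝ} {σ σ' : State T o}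

variable (P o) in
/-- The equilibria of a market of pieces, with `r o = 1`. -/
def eqSet : Set (Var N M T → ℝ) :=
  {v | P.IsClearing (vr v) (vp v) (vf v) ∧ vr v o = 1 ∧
    (∀ i, P.excess (vp v) (vf v) i = 0) ∧ vm v = 0}

/-- No inequality of a piece or an agent is tight. -/
def Strict (P : PieceMarket N M T) (ε m δ : ℝ) (v : Var N M T → ℝ) (σ : State T o) : Prop :=
  ∀ a : Ineq M T o, (∀ x, a ≠ .inr (.inr x)) → (v, a) ∉ P.flags o ε m δ σ

theorem len_mul_ne_zero (hδ : 0 < δ) (hv : v ∈ P.cell o ε m δ σ) (t : T) :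
    P.len t * vp v (P.item t) ≠ 0 := by
  refine mul_ne_zero (P.len_pos t).ne' fun h0 => ?_
  have := (mem_cell.1 hv).2.2.2.2.2.2 (P.item t)
  rw [h0, mul_zero] at this
  linarith

theorem Strict.not_tight (hs : P.Strict ε m δ v σ) (hv : v ∈ P.cell o ε m δ σ) (t : T)
    (β : Bool) : ¬ P.PieceTight v t β (σ.1 t) := fun h =>
  hs (.inl (t, β)) (by simp) ((tight_piece hv).2 h)

theorem Strict.eq_none_iff (hs : P.Strict ε m δ v σ) (hv : v ∈ P.cell o ε m δ σ) (t : T) :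
    σ.1 t = none ↔ vp v (P.item t) = vr v (P.agent t) * P.slope t := by
  have h := (mem_cell.1 hv).1 t
  have h2 := hs.not_tight hv t
  rcases hst : σ.1 t with _ | β <;> rw [hst] at h h2
  · simpa using h.1
  · simpa using fun h3 => h2 β ⟨rfl, h3⟩

theorem Strict.eq_some_iff (hδ : 0 < δ) (hs : P.Strict ε m δ v σ) (hv : v ∈ P.cell o ε m δ σ)
    (t : T) (β : Bool) : σ.1 t = some β ↔ vf v t = P.cap t β (vp v (P.item t)) := by
  have h := (mem_cell.1 hv).1 t
  have h2 := hs.not_tight hv t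
  have h3 := len_mul_ne_zero hδ hv t
  rcases hst : σ.1 t with _ | β' <;> rw [hst] at h h2
  · simpa [PieceTight] using h2 β
  · rw [h.1]
    cases β <;> cases β' <;> simp [cap, h3, h3.symm]

theorem Strict.state_eq (hs : P.Strict ε m δ v σ) (hs' : P.Strict ε m δ v' σ')
    (hδ : 0 < δ) (hv : v ∈ P.cell o ε m δ σ) (hv' : v' ∈ P.cell o ε m δ σ') (t : T)
    (h : ∀ β, vf v t = P.cap t β (vp v (P.item t)) ↔ vf v' t = P.cap t β (vp v' (P.item t))) :
    σ.1 t = σ'.1 t := by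
  refine Option.ext fun β => ?_
  rw [hs.eq_some_iff hδ hv, hs'.eq_some_iff hδ hv', h]

/-- The state of a strict solution is the sign of price minus `r * slope`. -/
theorem Strict.state_eq_of_price_eq (hs : P.Strict ε m δ v σ) (hs' : P.Strict ε m δ v' σ')
    (hv : v ∈ P.cell o ε m δ σ) (hv' : v' ∈ P.cell o ε m δ σ') (t : T)
    (hr : vr v (P.agent t) = vr v' (P.agent t)) (hp : vp v (P.item t) = vp v' (P.item t)) :
    σ.1 t = σ'.1 t := by
  have h1 := hs.eq_none_iff hv t
  have h2 := hs'.eq_none_iff hv' t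
  rw [← hr, ← hp, ← h1] at h2
  have h3 := (mem_cell.1 hv).1 t
  have h4 := (mem_cell.1 hv').1 t
  rcases hst : σ.1 t with _ | β
  · rw [hst] at h2
    exact (h2.2 rfl).symm
  · rcases hst' : σ'.1 t with _ | β'
    · rw [hst, hst'] at h2
      simp at h2
    · rw [hst] at h1 h3
      rw [hst'] at h4
      have h5 := h3.2
      have h6 := h4.2
      rw [← hr, ← hp] at h6
      have h7 : vp v (P.item t) - vr v (P.agent t) * P.slope t ≠ 0 :=
        fun h => by simp [sub_eq_zero.1 h] at h1
      rcases lt_or_gt_of_ne h7 with h8 | h8 <;> cases β <;> cases β' <;> simp_all [eta] <;> linarith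

/-- Whatever is bought at the higher price is strictly worth buying at the lower one, hence full
there. So no amount decreases when passing to the lower price; the totals agree, so all amounts
agree, and with them the empty and full pieces. -/
theorem Strict.state_eq_of_price_lt (hs : P.Strict ε m δ v σ) (hs' : P.Strict ε m δ v' σ')
    (hε : 0 < ε) (hδ : 0 < δ) (hv : v ∈ P.cell o ε m δ σ) (hv' : v' ∈ P.cell o ε m δ σ') (t : T)
    (hr : vr v = vr v') (hp : vp v (P.item t) < vp v' (P.item t)) :
    σ.1 t = σ'.1 t := by
  have h := isClearing_of_mem_cell hε hδ hv
  have h' := isClearing_of_mem_cell hε hδ hv'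
  obtain ⟨j, hj⟩ : ∃ j, P.item t = j := ⟨_, rfl⟩
  rw [hj] at hp
  have hpj : vp v j ≠ 0 := fun h0 => by have := h.sgn_pos j; simp [h0] at this
  have hpj' : vp v' j ≠ 0 := fun h0 => by have := h'.sgn_pos j; simp [h0] at this
  have hfull : ∀ t ∈ P.pieces j, vf v' t ≠ 0 → vf v t = P.len t * vp v j := by
    intro t ht h0
    rw [mem_pieces] at ht
    subst ht
    by_contra h1
    have h2 := h.of_not_full t h1
    have h3 := h'.of_not_empty t h0
    rw [← hr] at h3
    linarith
  have hx : ∀ t ∈ P.pieces j, 0 ≤ vf v t / vp v j ∧ vf v' t / vp v' j ≤ P.len t := by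
    intro t ht
    rw [mem_pieces] at ht
    subst ht
    have h1 := h.nonneg t
    have h2 := h'.le t
    have h3 := h.sgn_pos (P.item t)
    have h4 := h'.sgn_pos (P.item t)
    rcases P.sgn_eq (P.item t) with hs | hs <;> rw [hs] at h1 h2 h3 h4
    · exact ⟨div_nonneg (by linarith) (by linarith), (div_le_iff₀ (by linarith)).2 (by linarith)⟩
    · exact ⟨div_nonneg_of_nonpos (by linarith) (by linarith),
        (div_le_iff_of_neg (by linarith)).2 (by linarith)⟩
  have hle : ∀ t ∈ P.pieces j, vf v' t / vp v' j ≤ vf v t / vp v j := by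
    intro t ht
    by_cases h0 : vf v' t = 0
    · rw [h0, zero_div]
      exact (hx t ht).1
    · rw [hfull t ht h0, mul_div_cancel_right₀ _ hpj]
      exact (hx t ht).2
  have hsum : ∑ t ∈ P.pieces j, vf v' t / vp v' j = ∑ t ∈ P.pieces j, vf v t / vp v j := by
    rw [← Finset.sum_div, ← Finset.sum_div, h.clear, h'.clear, mul_div_cancel_right₀ _ hpj,
      mul_div_cancel_right₀ _ hpj']
  have heq := (Finset.sum_eq_sum_iff_of_le hle).1 hsum t (P.mem_pieces.2 hj)
  rw [div_eq_div_iff hpj' hpj] at heq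
  refine hs.state_eq hs' hδ hv hv' t fun β => ?_
  rw [hj]
  cases β
  · simp only [cap, Bool.false_eq_true, if_false]
    constructor
    · intro h0
      rw [h0, zero_mul] at heq
      exact (mul_eq_zero.1 heq).resolve_right hpj
    · intro h0
      rw [h0, zero_mul] at heq
      exact (mul_eq_zero.1 heq.symm).resolve_right hpj'
  · simp only [cap, if_true]
    constructor
    · intro h0
      rw [h0] at heq
      exact mul_right_cancel₀ hpj (by linarith)
    · intro h0
      rw [h0] at heq
      exact mul_right_cancel₀ hpj' (by linarith)

theorem card_eqn_lt [DecidableEq N] :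
    Fintype.card (Eqn M T o) < Module.finrank ℝ (Var N M T → ℝ) := by
  have : Fintype.card {i // i ≠ o} = Fintype.card N - 1 := by simp
  have h2 := Fintype.card_pos_iff.2 ⟨o⟩
  simp only [Eqn, Var, Module.finrank_fintype_fun_eq_card, Fintype.card_sum, Fintype.card_unit]
  omega

/-- The parity theorem for a generic market of pieces; moreover, an equilibrium is determined by
the sets of empty and full pieces. -/
theorem Generic.odd_eqSet [Nonempty M] (hgen : P.Generic o) :
    (P.eqSet o).Finite ∧ Odd (P.eqSet o).ncard ∧ ∀ v ∈ P.eqSet o, ∀ v' ∈ P.eqSet o,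
      (∀ t β, vf v t = P.cap t β (vp v (P.item t)) ↔ vf v' t = P.cap t β (vp v' (P.item t))) →
      v = v' := by
  classical
  obtain ⟨G, hG, hbd⟩ := P.exists_bounds o
  obtain ⟨K, hK0, hK⟩ : ∃ K : ℝ, 0 ≤ K ∧ ∀ t, |P.slope t| ≤ K := by
    obtain ⟨K, hK⟩ := (Set.finite_range fun t => |P.slope t|).bddAbove
    exact ⟨max K 0, le_max_right _ _, fun t => (hK ⟨t, rfl⟩).trans (le_max_left _ _)⟩
  obtain ⟨k, hk0, hk⟩ := exists_pos_le fun t => |P.slope t|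
  replace hk : ∀ t, k ≤ |P.slope t| := fun t => hk t (abs_pos.2 fun h => by
    have := P.slope_pos t
    simp [h] at this)
  have hG0 : 0 < G := by linarith
  -- Below the a priori bound `G⁻¹`, so that no agent is low when the parameter is `0`.
  obtain ⟨ε, hε0, hεG⟩ := exists_rat_btwn (inv_pos.2 hG0)
  have hε1 : (ε : ℝ) < 1 := hεG.trans (inv_lt_one_of_one_lt₀ hG)
  -- Above every possible excess, so that every agent is low when the parameter is `m`.
  obtain ⟨m, hm⟩ := exists_rat_gt (G * K * (2 * Fintype.card M + Fintype.card T))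
  have hm0 : (0 : ℝ) < m := lt_of_le_of_lt (by positivity) hm
  -- Signed prices are at least `ε * k` at solutions, so half of this is never attained.
  set δ : ℝ := ε * k / 2 with hδ
  have hδ0 : 0 < δ := by positivity
  have hδk : δ < ε * k := by rw [hδ]; linarith [mul_pos hε0 hk0]
  -- bounds at solutions
  have hbounds : ∀ σ v, v ∈ P.cell o ε m δ σ → P.IsClearing (vr v) (vp v) (vf v) ∧
      (∀ i, ε ≤ vr v i) ∧ (∀ i, vr v i ≤ G) ∧ (∀ j, P.sgn j * vp v j ≠ δ) ∧
      ∀ i, P.excess (vp v) (vf v) i < m := by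
    intro σ v hv
    have h := isClearing_of_mem_cell hε0 hδ0 hv
    have ho := (mem_cell.1 hv).2.2.2.1
    -- An agent with `r > 1 > ε` is high, so its excess is the parameter and hence nonnegative.
    have hr : ∀ i, vr v i ≤ G := (hbd _ _ _ h ho).1 fun i hi => by
      have hio : i ≠ o := by rintro rfl; linarith
      have h1 := (agent_of_mem_cell hv hio).2.2.resolve_left (by linarith)
      rw [h1]
      exact (mem_cell.1 hv).2.2.2.2.1
    have hr' : ∀ i, ε ≤ vr v i := fun i => by
      by_cases hio : i = o
      · rw [hio, ho]; exact hε1.le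
      · exact (agent_of_mem_cell hv hio).1
    refine ⟨h, hr', hr, fun j => ?_, fun i => ?_⟩
    · have := h.abs_ge (j := j) hk0.le hk hr'
      linarith
    · exact (h.excess_le i fun j => h.abs_le hK hr).trans_lt hm
  have hbounded : ∀ σ : State T o, Bornology.IsBounded (P.cell o ε m δ σ) := by
    intro σ
    refine isBounded_iff_forall_norm_le.2 ⟨G + G * K + m, fun v hv => ?_⟩
    obtain ⟨h, h1, h2, -, -⟩ := hbounds σ v hv
    have hGK : 0 ≤ G * K := by positivity
    have hp := fun j => h.abs_le (j := j) hK h2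
    rw [pi_norm_le_iff_of_nonneg (by positivity)]
    rintro (i | j | t | u)
    · change |vr v i| ≤ _
      rw [abs_of_pos (h.pos i)]
      linarith [h2 i]
    · change |vp v j| ≤ _
      linarith [hp j]
    · change |vf v t| ≤ _
      linarith [h.abs_spending_le t, hp (P.item t)]
    · change |vm v| ≤ _
      obtain ⟨-, -, -, -, h5, h6, -⟩ := mem_cell.1 hv
      rw [abs_of_nonneg h5]
      linarith
  have hnd : ∀ (σ : State T o), ∀ v ∈ P.cell o ε m δ σ, ∀ a a',
      P.ineqForm o σ a v = ineqVal o ε m δ σ a → P.ineqForm o σ a' v = ineqVal o ε m δ σ a' →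
      a = a' := fun σ v hv a a' ha ha' =>
    hgen.tight_unique hε0 hm0 hδ0 hv (hbounds σ v hv).2.2.2.1 ⟨hv, ha⟩ ⟨hv, ha'⟩
  obtain ⟨hfin, heven⟩ := even_boundary_flags (card_eqn_lt (N := N) (M := M) (T := T) (o := o))
    (P.eqnForm o) (eqnVal o ε) (P.ineqForm o) (ineqVal o ε m δ) hbounded hnd
    {a | ∀ x, a ≠ .inr (.inr x)} (flipState T) fun σ v a ha h => flip_mem_flags hδ0 ha h
  -- boundary flags
  let A : Bool → Set (State T o × (Var N M T → ℝ) × Ineq M T o) := fun β =>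
    {x | x.2 ∈ P.flags o ε m δ x.1 ∧ x.2.2 = .inr (.inr (.inl β))}
  have hAfin : ∀ β, (A β).Finite := fun β => hfin.subset fun x hx => hx.1
  have hAunion : {x : State T o × (Var N M T → ℝ) × Ineq M T o |
      x.2 ∈ P.flags o ε m δ x.1 ∧ x.2.2 ∉ {a : Ineq M T o | ∀ x, a ≠ .inr (.inr x)}} =
      A false ∪ A true := by
    ext ⟨σ, v, a⟩
    constructor
    · rintro ⟨h1, h2⟩
      rcases a with a | a | (_ | _) | j
      · exact absurd (fun x => by simp) h2
      · exact absurd (fun x => by simp) h2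
      · exact Or.inl ⟨h1, rfl⟩
      · exact Or.inr ⟨h1, rfl⟩
      · exact absurd ((tight_price h1.1).1 h1) ((hbounds σ v h1.1).2.2.2.1 j)
    · rintro (⟨h1, h2⟩ | ⟨h1, h2⟩) <;> exact ⟨h1, fun h => h _ h2⟩
  have hdisj : Disjoint (A false) (A true) := Set.disjoint_left.2 fun x h1 h2 => by
    have := h1.2.symm.trans h2.2
    simp at this
  -- The bound on the parameter is already the one inequality allowed to be tight.
  have hstrict : ∀ β, ∀ x ∈ A β, P.Strict ε m δ x.2.1 x.1 := by
    rintro β ⟨σ, v, a⟩ ⟨h1, rfl⟩ a' ha' h2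
    exact ha' _ (hnd σ v h1.1 a' _ h2.2 h1.2)
  have huniq : ∀ β, ∀ x ∈ A β, ∀ x' ∈ A β, x.1 = x'.1 → x = x' := by
    rintro β ⟨σ, v, a⟩ ⟨h1, rfl⟩ ⟨σ', v', a'⟩ ⟨h1', rfl⟩ rfl
    obtain rfl : v = v' := eq_of_tight (hbounded σ) (hnd σ) h1.1 h1'.1 h1.2 h1'.2
    rfl
  -- the only solution at the end of the deformation
  have hlow : ∀ x ∈ A true, (∀ i, x.1.2 i = false) ∧
      vr x.2.1 = fun i => if i = o then 1 else (ε : ℝ) := by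
    rintro ⟨σ, v, a⟩ ⟨h1, rfl⟩
    have hv : v ∈ P.cell o ε m δ σ := h1.1
    have h2 : vm v = m := by simpa using (tight_param hv).1 h1
    have h3 := (hbounds σ v hv).2.2.2.2
    have h4 : ∀ i : {i // i ≠ o}, σ.2 i = false ∧ vr v i = ε := fun i => by
      have h5 := (mem_cell.1 hv).2.2.1 i
      rcases hst : σ.2 i with _ | _ <;> rw [hst] at h5
      · exact ⟨rfl, h5.1⟩
      · have := h3 i
        rw [h5.1, h2] at this
        exact absurd this (lt_irrefl _)
    refine ⟨fun i => (h4 i).1, funext fun i => ?_⟩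
    split_ifs with hi
    · rw [hi]; exact (mem_cell.1 hv).2.2.2.1
    · exact (h4 ⟨i, hi⟩).2
  have hhigh : (A true).ncard = 1 := by
    rw [Set.ncard_eq_one]
    have hr0 : ∀ i, 0 < (fun i => if i = o then 1 else (ε : ℝ)) i := fun i => by
      dsimp only; split_ifs <;> positivity
    obtain ⟨p, f, h⟩ := P.exists_isClearing _ hr0
    let v : Var N M T → ℝ := Sum.elim (fun i => if i = o then 1 else (ε : ℝ))
      (Sum.elim p (Sum.elim f fun _ => m))
    have hrG : ∀ i, (fun i => if i = o then 1 else (ε : ℝ)) i ≤ G := fun i => by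
      dsimp only; split_ifs <;> linarith
    have hrε : ∀ i, (ε : ℝ) ≤ (fun i => if i = o then 1 else (ε : ℝ)) i := fun i => by
      dsimp only; split_ifs <;> linarith
    obtain ⟨σ, hσ⟩ : ∃ σ, v ∈ P.cell o ε m δ σ := by
      refine exists_mem_cell (v := v) h (if_pos rfl) (fun i hi => ?_) hm0.le le_rfl fun j => ?_
      · exact ⟨hrε i, ((h.excess_le i fun j => h.abs_le hK hrG).trans_lt hm).le,
          Or.inl (if_neg hi)⟩
      · exact hδk.le.trans (h.abs_ge (j := j) hk0.le hk hrε)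
    have hx : (σ, v, .inr (.inr (.inl true))) ∈ A true :=
      ⟨(tight_param hσ).2 rfl, rfl⟩
    refine ⟨_, Set.eq_singleton_iff_unique_mem.2 ⟨hx, fun x' hx' => ?_⟩⟩
    refine (huniq true _ hx _ hx' ?_).symm
    have hs := hstrict true _ hx
    have hs' := hstrict true _ hx'
    have hrr := (hlow _ hx).2.trans (hlow _ hx').2.symm
    refine Prod.ext (funext fun t => ?_) (funext fun i => ?_)
    -- At this end `r` is known, but the price of an item need not be unique a priori; the states
    -- agree in each case, and a state has at most one such end.
    · rcases lt_trichotomy (vp v (P.item t)) (vp x'.2.1 (P.item t)) with h1 | h1 | h1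
      · exact hs.state_eq_of_price_lt hs' hε0 hδ0 hσ hx'.1.1 t hrr h1
      · exact hs.state_eq_of_price_eq hs' hσ hx'.1.1 t (congrFun hrr _) h1
      · exact (hs'.state_eq_of_price_lt hs hε0 hδ0 hx'.1.1 hσ t hrr.symm h1).symm
    · rw [(hlow _ hx).1 i, (hlow _ hx').1 i]
  change Even ({x : State T o × (Var N M T → ℝ) × Ineq M T o |
      x.2 ∈ P.flags o ε m δ x.1 ∧ x.2.2 ∉ {a : Ineq M T o | ∀ x, a ≠ .inr (.inr x)}}).ncard
    at heven
  rw [hAunion, Set.ncard_union_eq hdisj (hAfin _) (hAfin _), hhigh] at heven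
  have hodd : Odd (A false).ncard := by
    rcases Nat.even_or_odd (A false).ncard with h | h
    · exact absurd heven (Nat.not_even_iff_odd.2 h.add_one)
    · exact h
  -- the solutions at the start are the equilibria
  have hmem : ∀ v ∈ P.eqSet o, ∃ σ, (σ, v, .inr (.inr (.inl false))) ∈ A false := by
    rintro v ⟨h, ho, hex, h0⟩
    have hr := (hbd _ _ _ h ho).2 fun i _ => (hex i).le
    have hrε : ∀ i, (ε : ℝ) ≤ vr v i := fun i => hεG.le.trans (hr i)
    obtain ⟨σ, hσ⟩ := exists_mem_cell (P := P) (o := o) (ε := ε) (m := m) (δ := δ) h ho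
      (fun i _ => ⟨hrε i, by rw [hex, h0], Or.inr (by rw [hex, h0])⟩) h0.ge (h0 ▸ hm0.le)
      fun j => hδk.le.trans (h.abs_ge (j := j) hk0.le hk hrε)
    exact ⟨σ, (tight_param hσ).2 (by simpa using h0), rfl⟩
  have hhighAll : ∀ x ∈ A false, (∀ i, x.1.2 i = true) ∧ x.2.1 ∈ P.eqSet o := by
    rintro ⟨σ, v, a⟩ ⟨h1, rfl⟩
    have hv : v ∈ P.cell o ε m δ σ := h1.1
    have h2 : vm v = 0 := by simpa using (tight_param hv).1 h1
    obtain ⟨h, -⟩ := hbounds σ v hv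
    have ho := (mem_cell.1 hv).2.2.2.1
    -- At parameter `0` the excess of every agent other than `o` is at most `0`, so `r` is at least
    -- `G⁻¹ > ε` and all agents are high. The excess of `o` then vanishes by Walras' law.
    have hr := (hbd _ _ _ h ho).2 fun i hi => h2 ▸ (agent_of_mem_cell hv hi).2.1
    have h4 : ∀ i : {i // i ≠ o}, σ.2 i = true ∧ P.excess (vp v) (vf v) i = 0 := fun i => by
      have h5 := (mem_cell.1 hv).2.2.1 i
      rcases hst : σ.2 i with _ | _ <;> rw [hst] at h5
      · exact absurd h5.1 (hεG.trans_le (hr i)).ne'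
      · exact ⟨rfl, h5.1.trans h2⟩
    refine ⟨fun i => (h4 i).1, h, ho, fun i => ?_, h2⟩
    by_cases hi : i = o
    · subst hi
      have := h.sum_excess
      rw [← Finset.add_sum_erase _ _ (Finset.mem_univ i), Finset.sum_eq_zero fun k hk =>
        (h4 ⟨k, Finset.ne_of_mem_erase hk⟩).2] at this
      simpa using this
    · exact (h4 ⟨i, hi⟩).2
  have hdet : ∀ x ∈ A false, ∀ x' ∈ A false, (∀ t β, vf x.2.1 t = P.cap t β (vp x.2.1 (P.item t)) ↔
      vf x'.2.1 t = P.cap t β (vp x'.2.1 (P.item t))) → x = x' := by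
    intro x hx x' hx' h
    refine huniq false _ hx _ hx' (Prod.ext (funext fun t => ?_) (funext fun i => ?_))
    · exact (hstrict _ x hx).state_eq (hstrict _ x' hx') hδ0 hx.1.1 hx'.1.1 t (h t)
    · rw [(hhighAll x hx).1, (hhighAll x' hx').1]
  have himage : (fun x : State T o × (Var N M T → ℝ) × Ineq M T o => x.2.1) '' A false =
      P.eqSet o := by
    ext v
    constructor
    · rintro ⟨x, hx, rfl⟩
      exact (hhighAll x hx).2
    · intro hv
      obtain ⟨σ, hσ⟩ := hmem v hv
      exact ⟨_, hσ, rfl⟩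
  have hinj : Set.InjOn (fun x : State T o × (Var N M T → ℝ) × Ineq M T o => x.2.1) (A false) :=
    fun x hx x' hx' h => hdet x hx x' hx' fun t β => by
      simp only at h
      rw [h]
  refine ⟨himage ▸ (hAfin false).image _, ?_, fun v hv v' hv' h => ?_⟩
  · rw [← himage, hinj.ncard_image]
    exact hodd
  · obtain ⟨σ, hσ⟩ := hmem v hv
    obtain ⟨σ', hσ'⟩ := hmem v' hv'
    exact congrArg (fun x => x.2.1) (hdet _ hσ _ hσ' h)

end PieceMarket

/-! ### Piecewise linear utilities by segments -/

namespace MannaInstance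

variable {N M : Type*} [Fintype N] [Fintype M] (I : MannaInstance N M) (i : N) (j : M)

/-- The amount of `[0, t]` that lies in segment `k`. -/
noncomputable def segAmt (k : Fin (I.K i j + 1)) (t : ℝ) : ℝ :=
  if h : k.val < I.K i j then min (I.L i j ⟨k.val, h⟩) (max 0 (t - I.segStart i j k))
  else max 0 (t - I.segStart i j k)

/-- Segment `k` is full at `t`. -/
def SegFull (k : Fin (I.K i j + 1)) (t : ℝ) : Prop :=
  ∃ h : k.val < I.K i j, I.segAmt i j k t = I.L i j ⟨k.val, h⟩

theorem itemUtility_eq (t : ℝ) : I.itemUtility i j t = ∑ k, I.U i j k * I.segAmt i j k t := by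
  rw [Fin.sum_univ_castSucc]
  simp [itemUtility, segAmt]

variable {I i j}

theorem segAmt_nonneg (k : Fin (I.K i j + 1)) (t : ℝ) : 0 ≤ I.segAmt i j k t := by
  unfold segAmt
  split_ifs with h
  · exact le_min (I.L_pos i j _).le (le_max_left _ _)
  · exact le_max_left _ _

theorem segAmt_mono (k : Fin (I.K i j + 1)) : Monotone (I.segAmt i j k) := by
  intro s t hst
  unfold segAmt
  split_ifs with h
  · exact min_le_min le_rfl (max_le_max le_rfl (by linarith))
  · exact max_le_max le_rfl (by linarith)

theorem segAmt_le {k : Fin (I.K i j + 1)} (h : k.val < I.K i j) (t : ℝ) :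
    I.segAmt i j k t ≤ I.L i j ⟨k.val, h⟩ := by
  rw [segAmt, dif_pos h]
  exact min_le_left _ _

theorem segStart_nonneg (k : Fin (I.K i j + 1)) : 0 ≤ I.segStart i j k :=
  Finset.sum_nonneg fun l _ => (I.L_pos i j l).le

theorem segStart_add_le {k l : Fin (I.K i j + 1)} (h : k.val < I.K i j) (hkl : k < l) :
    I.segStart i j k + I.L i j ⟨k.val, h⟩ ≤ I.segStart i j l := by
  classical
  unfold segStart
  rw [add_comm, ← Finset.sum_insert (a := (⟨k.val, h⟩ : Fin (I.K i j))) (by simp)]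
  refine Finset.sum_le_sum_of_subset_of_nonneg (fun x hx => ?_) fun x _ _ => (I.L_pos i j x).le
  simp only [Finset.mem_insert, Finset.mem_filter, Finset.mem_univ, true_and] at hx ⊢
  rcases hx with rfl | hx
  · exact hkl
  · exact hx.trans hkl

theorem lt_of_segAmt_ne_zero {k : Fin (I.K i j + 1)} {t : ℝ} (h : I.segAmt i j k t ≠ 0) :
    I.segStart i j k < t := by
  by_contra! hc
  apply h
  have : max 0 (t - I.segStart i j k) = 0 := max_eq_left (by linarith)
  unfold segAmt
  rw [this]
  split_ifs with h1
  · exact min_eq_right (I.L_pos i j _).le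
  · rfl

theorem segAmt_eq_zero {k : Fin (I.K i j + 1)} {t : ℝ} (h : t ≤ I.segStart i j k) :
    I.segAmt i j k t = 0 := by
  by_contra h1
  exact absurd (lt_of_segAmt_ne_zero h1) (not_lt.2 h)

theorem segAmt_eq_L {k : Fin (I.K i j + 1)} (h : k.val < I.K i j) {t : ℝ}
    (ht : I.segStart i j k + I.L i j ⟨k.val, h⟩ ≤ t) :
    I.segAmt i j k t = I.L i j ⟨k.val, h⟩ := by
  rw [segAmt, dif_pos h]
  exact min_eq_left (le_max_of_le_right (by linarith))

theorem segFull_of_lt {k l : Fin (I.K i j + 1)} (hkl : k < l) {t : ℝ}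
    (h : I.segStart i j l ≤ t) : I.SegFull i j k t := by
  have hk : k.val < I.K i j := lt_of_lt_of_le hkl (Nat.lt_succ_iff.1 l.2)
  exact ⟨hk, segAmt_eq_L hk ((segStart_add_le hk hkl).trans h)⟩

theorem sum_lt_succ (f : Fin (I.K i j) → ℝ) (n : ℕ) (h : n < I.K i j) :
    ∑ l with l.val < n + 1, f l = ∑ l with l.val < n, f l + f ⟨n, h⟩ := by
  classical
  rw [show (Finset.univ.filter fun l : Fin (I.K i j) => l.val < n + 1) =
    insert ⟨n, h⟩ (Finset.univ.filter fun l : Fin (I.K i j) => l.val < n) by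
      ext x
      simp only [Finset.mem_filter, Finset.mem_univ, true_and, Finset.mem_insert, Fin.ext_iff]
      omega, Finset.sum_insert (by simp), add_comm]

theorem sum_segAmt {t : ℝ} (ht : 0 ≤ t) : ∑ k, I.segAmt i j k t = t := by
  classical
  -- The part of `[0, t]` in the first `n` segments; the amounts are its increments, so their sum
  -- telescopes.
  set c : ℕ → ℝ := fun n => min t (∑ l : Fin (I.K i j) with l.val < n, I.L i j l) with hc
  have h1 : ∀ k : Fin (I.K i j), I.segAmt i j k.castSucc t = c (k + 1) - c k := by
    intro k
    have hL := I.L_pos i j k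
    simp only [segAmt, Fin.val_castSucc, k.2, dif_pos, segStart, hc, sum_lt_succ _ _ k.2, Fin.eta]
    set s := ∑ l : Fin (I.K i j) with l.val < k.val, I.L i j l
    rcases le_total t s with h | h
    · rw [min_eq_left h, min_eq_left (show t ≤ s + I.L i j k by linarith),
        max_eq_left (by linarith), min_eq_right hL.le, sub_self]
    · rw [min_eq_right h, max_eq_right (by linarith)]
      rcases le_total t (s + I.L i j k) with h' | h'
      · rw [min_eq_left h', min_eq_right (by linarith)]
      · rw [min_eq_right h', min_eq_left (by linarith)]; ring
  have h2 : I.segAmt i j (Fin.last _) t = t - c (I.K i j) := by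
    simp only [segAmt, Fin.val_last, lt_irrefl, dif_neg, not_false_eq_true, segStart, hc]
    set s := ∑ l : Fin (I.K i j) with l.val < I.K i j, I.L i j l
    rcases le_total t s with h | h
    · rw [min_eq_left h, max_eq_left (by linarith), sub_self]
    · rw [min_eq_right h, max_eq_right (by linarith)]
  rw [Fin.sum_univ_castSucc, h2, Finset.sum_congr rfl fun k _ => h1 k,
    Fin.sum_univ_eq_sum_range (fun n => c (n + 1) - c n), Finset.sum_range_sub]
  have h0 : c 0 = 0 := by simp [hc, ht]
  rw [h0]; ring

/-- Amounts that fill the segments in order are the amounts in the segments of their sum. -/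
theorem segAmt_sum_eq (x : Fin (I.K i j + 1) → ℝ) (h0 : ∀ k, 0 ≤ x k)
    (hle : ∀ k (h : k.val < I.K i j), x k ≤ I.L i j ⟨k.val, h⟩)
    (hfill : ∀ l k, l < k → x k ≠ 0 → ∀ h : l.val < I.K i j, x l = I.L i j ⟨l.val, h⟩)
    (k : Fin (I.K i j + 1)) : I.segAmt i j k (∑ l, x l) = x k := by
  classical
  have hlt : ∀ l k : Fin (I.K i j + 1), l < k → l.val < I.K i j := fun l k h =>
    lt_of_lt_of_le h (Nat.lt_succ_iff.1 k.2)
  -- sums over the segments before `k`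
  have hbefore : ∀ k : Fin (I.K i j + 1), (∀ l < k, ∀ h : l.val < I.K i j,
      x l = I.L i j ⟨l.val, h⟩) → ∑ l with l < k, x l = I.segStart i j k := by
    intro k hk
    unfold segStart
    refine Finset.sum_bij' (fun l hl => ⟨l.val, hlt l k (Finset.mem_filter.1 hl).2⟩)
      (fun l _ => l.castSucc) ?_ ?_ ?_ ?_ ?_
    · intro l hl; simpa using (Finset.mem_filter.1 hl).2
    · intro l hl
      simp only [Finset.mem_filter, Finset.mem_univ, true_and] at hl ⊢
      exact hl
    · intro l hl; rfl
    · intro l hl; rfl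
    · intro l hl; exact hk l (Finset.mem_filter.1 hl).2 _
  have hbefore' : ∀ k : Fin (I.K i j + 1), ∑ l with l < k, x l ≤ I.segStart i j k := by
    intro k
    unfold segStart
    have h1 : ∀ l ∈ Finset.univ.filter (fun l => l < k), x l ≤
        if h : l.val < I.K i j then I.L i j ⟨l.val, h⟩ else 0 := fun l hl => by
      rw [dif_pos (hlt l k (Finset.mem_filter.1 hl).2)]
      exact hle l _
    refine (Finset.sum_le_sum h1).trans (le_of_eq ?_)
    refine Finset.sum_bij' (fun l hl => ⟨l.val, hlt l k (Finset.mem_filter.1 hl).2⟩)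
      (fun l _ => l.castSucc) ?_ ?_ ?_ ?_ ?_
    · intro l hl; simpa using (Finset.mem_filter.1 hl).2
    · intro l hl
      simp only [Finset.mem_filter, Finset.mem_univ, true_and] at hl ⊢
      exact hl
    · intro l hl; rfl
    · intro l hl; rfl
    · intro l hl; rw [dif_pos (hlt l k (Finset.mem_filter.1 hl).2)]
  have hsplit : ∑ l, x l = ∑ l with l < k, x l + (x k + ∑ l with k < l, x l) := by
    rw [← Finset.sum_filter_add_sum_filter_not Finset.univ (fun l => l < k) x]
    congr 1
    rw [show (Finset.univ.filter fun l => ¬ l < k) = insert k (Finset.univ.filter fun l => k < l) by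
      ext l; simp [le_iff_eq_or_lt, eq_comm], Finset.sum_insert (by simp)]
  have hafter : 0 ≤ ∑ l with k < l, x l := Finset.sum_nonneg fun l _ => h0 l
  -- If a later segment is used, then `k` and all segments before it are full; otherwise the sum
  -- ends in `k` or does not reach beyond its start.
  by_cases hl : ∃ l, k < l ∧ x l ≠ 0
  · obtain ⟨l, hkl, hl⟩ := hl
    have hk := hlt k l hkl
    rw [hfill k l hkl hl hk]
    apply segAmt_eq_L hk
    rw [hsplit, hbefore k fun l' h' => hfill l' l (h'.trans hkl) hl, hfill k l hkl hl hk]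
    linarith
  · push Not at hl
    rw [Finset.sum_eq_zero (s := Finset.univ.filter fun l => k < l) fun l h =>
      hl l (Finset.mem_filter.1 h).2, add_zero] at hsplit
    by_cases hk : x k = 0
    · rw [hk]
      apply segAmt_eq_zero
      rw [hsplit, hk, add_zero]
      exact hbefore' k
    · rw [hbefore k fun l' h' => hfill l' k h' hk] at hsplit
      have hk0 := h0 k
      rw [hsplit]
      unfold segAmt
      rw [add_sub_cancel_left, max_eq_right hk0]
      split_ifs with h
      · exact min_eq_right (hle k h)
      · rfl

theorem segFull_last (t : ℝ) : ¬ I.SegFull i j (Fin.last _) t := fun ⟨h, _⟩ => by simp at h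

theorem segAmt_le_of_segFull {k : Fin (I.K i j + 1)} {s t : ℝ} (h : I.SegFull i j k s) :
    I.segAmt i j k t ≤ I.segAmt i j k s := by
  obtain ⟨hk, h⟩ := h
  rw [h]
  exact segAmt_le hk t

/-- Supporting slopes bound the utility from above. -/
theorem itemUtility_sub_le {c x y : ℝ} (hx : 0 ≤ x) (hy : 0 ≤ y)
    (h1 : ∀ k, ¬ I.SegFull i j k x → I.U i j k ≤ c)
    (h2 : ∀ k, I.segAmt i j k x ≠ 0 → c ≤ I.U i j k) :
    I.itemUtility i j y - c * y ≤ I.itemUtility i j x - c * x := by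
  -- Termwise: segments steeper than `c` are full at `x`, and flatter ones are empty.
  have key : ∑ k, (I.U i j k - c) * I.segAmt i j k y ≤ ∑ k, (I.U i j k - c) * I.segAmt i j k x := by
    refine Finset.sum_le_sum fun k _ => ?_
    rcases lt_trichotomy (I.U i j k) c with h | h | h
    · have h3 : I.segAmt i j k x = 0 := by
        by_contra h3
        exact absurd (h2 k h3) (not_le.2 h)
      have := segAmt_nonneg (I := I) k y
      rw [h3, mul_zero]
      nlinarith
    · simp [h]
    · have h3 : I.SegFull i j k x := by
        by_contra h3
        exact absurd (h1 k h3) (not_le.2 h)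
      exact mul_le_mul_of_nonneg_left (segAmt_le_of_segFull h3) (by linarith)
  simp only [sub_mul, Finset.sum_sub_distrib, ← Finset.mul_sum, sum_segAmt hx, sum_segAmt hy,
    ← itemUtility_eq] at key
  exact key

/-- The slope of the first segment that is not full works; the last segment is never full, so there
is one. -/
theorem exists_supporting_slope {x : ℝ} (hx : 0 ≤ x) : ∃ c, ∀ y, 0 ≤ y →
    I.itemUtility i j y - c * y ≤ I.itemUtility i j x - c * x := by
  classical
  have hne : (Finset.univ.filter fun k => ¬ I.SegFull i j k x).Nonempty :=
    ⟨Fin.last _, by simpa using segFull_last x⟩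
  obtain ⟨k, hk, hmin⟩ := Finset.exists_min_image _ id hne
  refine ⟨I.U i j k, fun y hy => itemUtility_sub_le hx hy (fun l hl => ?_) fun l hl => ?_⟩
  · exact (I.U_strictAnti i j).antitone (hmin l (by simpa using hl))
  · refine (I.U_strictAnti i j).antitone ?_
    by_contra! hlt
    exact (Finset.mem_filter.1 hk).2 (segFull_of_lt hlt (lt_of_segAmt_ne_zero hl).le)

/-- Going up to the end of segment `k` touches no flatter segment. This finite difference replaces
the right derivative, as `exists_loss` replaces the left one. -/
theorem exists_gain {x : ℝ} (hx : 0 ≤ x) {k : Fin (I.K i j + 1)} (hk : ¬ I.SegFull i j k x) :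
    ∃ y, x < y ∧ I.U i j k * (y - x) ≤ I.itemUtility i j y - I.itemUtility i j x := by
  obtain ⟨y, hxy, hy⟩ : ∃ y, x < y ∧ ∀ l, k < l → y ≤ I.segStart i j l := by
    by_cases h : k.val < I.K i j
    · refine ⟨I.segStart i j k + I.L i j ⟨k.val, h⟩, ?_, fun l hl => segStart_add_le h hl⟩
      by_contra! hc
      exact hk ⟨h, segAmt_eq_L h hc⟩
    · exact ⟨x + 1, by linarith, fun l hl =>
        absurd (lt_of_lt_of_le (Fin.lt_def.1 hl) (Nat.lt_succ_iff.1 l.2)) h⟩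
  refine ⟨y, hxy, ?_⟩
  have hy0 : 0 ≤ y := hx.trans hxy.le
  have key : ∑ l, I.U i j k * (I.segAmt i j l y - I.segAmt i j l x) ≤
      ∑ l, I.U i j l * (I.segAmt i j l y - I.segAmt i j l x) := by
    refine Finset.sum_le_sum fun l _ => ?_
    have h1 := segAmt_mono (I := I) l hxy.le
    rcases le_or_gt l k with h | h
    · exact mul_le_mul_of_nonneg_right ((I.U_strictAnti i j).antitone h) (by linarith)
    · rw [segAmt_eq_zero (hy l h), segAmt_eq_zero (hxy.le.trans (hy l h))]
      simp
  rw [← Finset.mul_sum, Finset.sum_sub_distrib, sum_segAmt hx, sum_segAmt hy0] at key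
  simp only [mul_sub, Finset.sum_sub_distrib, ← itemUtility_eq] at key
  linarith

theorem exists_loss {x : ℝ} {k : Fin (I.K i j + 1)} (hk : I.segAmt i j k x ≠ 0) :
    ∃ y, 0 ≤ y ∧ y < x ∧ I.itemUtility i j x - I.itemUtility i j y ≤ I.U i j k * (x - y) := by
  have hlt := lt_of_segAmt_ne_zero hk
  have h0 := segStart_nonneg (I := I) k
  refine ⟨I.segStart i j k, h0, hlt, ?_⟩
  set y := I.segStart i j k with hy
  have key : ∑ l, I.U i j l * (I.segAmt i j l x - I.segAmt i j l y) ≤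
      ∑ l, I.U i j k * (I.segAmt i j l x - I.segAmt i j l y) := by
    refine Finset.sum_le_sum fun l _ => ?_
    have h1 := segAmt_mono (I := I) l hlt.le
    rcases lt_or_ge l k with h | h
    · have h2 : I.segAmt i j l x = I.segAmt i j l y :=
        le_antisymm (segAmt_le_of_segFull (segFull_of_lt h le_rfl)) h1
      rw [h2]; simp
    · exact mul_le_mul_of_nonneg_right ((I.U_strictAnti i j).antitone h) (by linarith)
  rw [← Finset.mul_sum, Finset.sum_sub_distrib, sum_segAmt (h0.trans hlt.le), sum_segAmt h0] at key
  simp only [mul_sub, Finset.sum_sub_distrib, ← itemUtility_eq] at key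
  linarith

/-- A function with a supporting line from above at every point is concave. -/
theorem concaveOn_itemUtility : ConcaveOn ℝ (Set.Ici 0) (I.itemUtility i j) := by
  refine ⟨convex_Ici 0, fun x hx y hy a b ha hb hab => ?_⟩
  have hz : 0 ≤ a • x + b • y := add_nonneg (mul_nonneg ha hx) (mul_nonneg hb hy)
  obtain ⟨c, hc⟩ := exists_supporting_slope (I := I) (i := i) (j := j) hz
  have h1 := mul_le_mul_of_nonneg_left (hc x hx) ha
  have h2 := mul_le_mul_of_nonneg_left (hc y hy) hb
  have h3 : b = 1 - a := by linarith
  subst h3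
  simp only [smul_eq_mul] at *
  linarith

variable (I i) in
theorem concaveOn_utility : ConcaveOn ℝ {y : M → ℝ | ∀ j, 0 ≤ y j} (I.utility i) := by
  refine ⟨fun x hx y hy a b ha hb _ j => add_nonneg (mul_nonneg ha (hx j)) (mul_nonneg hb (hy j)),
    fun x hx y hy a b ha hb hab => ?_⟩
  simp only [utility, smul_eq_mul, Finset.mul_sum, ← Finset.sum_add_distrib]
  exact Finset.sum_le_sum fun j _ => concaveOn_itemUtility.2 (hx j) (hy j) ha hb hab

theorem utility_update [DecidableEq M] (x : M → ℝ) (j : M) (t : ℝ) :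
    I.utility i (Function.update x j t) - I.utility i x =
      I.itemUtility i j t - I.itemUtility i j (x j) := by
  simp only [utility]
  rw [← Finset.sum_sub_distrib, Finset.sum_eq_single j]
  · simp
  · intro k _ hk
    simp [hk]
  · simp

end MannaInstance

/-! ### A Lagrange multiplier for the budget constraint -/

theorem sum_update_mul {M : Type*} [Fintype M] [DecidableEq M] (x p : M → ℝ) (j : M) (t : ℝ) :
    ∑ k, Function.update x j t k * p k = ∑ k, x k * p k + (t - x j) * p j := by
  rw [← sub_eq_iff_eq_add', ← Finset.sum_sub_distrib, Finset.sum_eq_single j]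
  · simp [sub_mul]
  · intro k _ hk
    simp [hk]
  · simp

/-- A Lagrange multiplier for the maximization of a concave function under a budget constraint. -/
theorem exists_multiplier {M : Type*} [Fintype M] {u : (M → ℝ) → ℝ}
    (hu : ConcaveOn ℝ {y : M → ℝ | ∀ j, 0 ≤ y j} u) (p : M → ℝ) (b : ℝ) {x : M → ℝ}
    (hx0 : ∀ j, 0 ≤ x j) (hxb : ∑ j, x j * p j ≤ b)
    (hopt : ∀ y : M → ℝ, (∀ j, 0 ≤ y j) → ∑ j, y j * p j ≤ b → u y ≤ u x)
    (hslater : ∃ y : M → ℝ, (∀ j, 0 ≤ y j) ∧ ∑ j, y j * p j < b)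
    (hsat : ∃ y : M → ℝ, (∀ j, 0 ≤ y j) ∧ u x < u y) :
    ∑ j, x j * p j = b ∧ ∃ c : ℝ, 0 < c ∧ ∀ y : M → ℝ, (∀ j, 0 ≤ y j) →
      u y - c * ∑ j, y j * p j ≤ u x - c * ∑ j, x j * p j := by
  obtain ⟨y₀, hy₀, hy₀b⟩ := hslater
  obtain ⟨z, hz, hzu⟩ := hsat
  set C : (M → ℝ) → ℝ := fun y => ∑ j, y j * p j with hC
  have hlin : ∀ (a b : ℝ) (y y' : M → ℝ), C (a • y + b • y') = a * C y + b * C y' := by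
    intro a b y y'
    simp only [hC, Pi.add_apply, Pi.smul_apply, smul_eq_mul, add_mul, Finset.sum_add_distrib,
      Finset.mul_sum, mul_assoc]
  have hzb : b < C z := by
    by_contra! h
    exact absurd (hopt z hz h) (not_le.2 hzu)
  -- exchange of a bundle that is too expensive and one that is cheaper than the budget
  have hex : ∀ y y' : M → ℝ, (∀ j, 0 ≤ y j) → (∀ j, 0 ≤ y' j) → C y < b → b < C y' →
      (u y' - u x) * (b - C y) ≤ (u x - u y) * (C y' - b) := by
    intro y y' hy hy' h1 h2
    have hpos : 0 < C y' - C y := by linarith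
    -- With these weights the mixture of `y` and `y'` costs exactly `b`, so it is no better than
    -- `x`.
    have ha : 0 ≤ (C y' - b) / (C y' - C y) := div_nonneg (by linarith) hpos.le
    have hb : 0 ≤ (b - C y) / (C y' - C y) := div_nonneg (by linarith) hpos.le
    have hab : (C y' - b) / (C y' - C y) + (b - C y) / (C y' - C y) = 1 := by
      field_simp
      ring
    have h3 := hu.2 hy hy' ha hb hab
    have h4 := hopt _ (hu.1 hy hy' ha hb hab) (le_of_eq (by
      change C _ = b
      rw [hlin]
      field_simp
      ring))
    have h5 := h3.trans h4
    simp only [smul_eq_mul] at h5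
    have h6 := mul_le_mul_of_nonneg_right h5 hpos.le
    have h7 : ((C y' - b) / (C y' - C y) * u y + (b - C y) / (C y' - C y) * u y') * (C y' - C y) =
        (C y' - b) * u y + (b - C y) * u y' := by
      field_simp
    rw [h7] at h6
    linarith
  have hxC : C x = b := by
    refine le_antisymm hxb (not_lt.1 fun h => ?_)
    have := hex x z hx0 hz h hzb
    rw [sub_self, zero_mul] at this
    have h1 : 0 < (u z - u x) * (b - C x) := mul_pos (by linarith) (by linarith)
    linarith
  refine ⟨hxC, ?_⟩
  -- Utility gained per unit of overspending; its supremum is the multiplier. The cheap bundle `y₀`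
  -- bounds it, and the better bundle `z` makes it positive.
  let S : Set ℝ := {s | ∃ y : M → ℝ, (∀ j, 0 ≤ y j) ∧ b < C y ∧ s = (u y - u x) / (C y - b)}
  have hSne : S.Nonempty := ⟨_, z, hz, hzb, rfl⟩
  have hSle : ∀ y : M → ℝ, (∀ j, 0 ≤ y j) → C y < b → ∀ s ∈ S, s ≤ (u x - u y) / (b - C y) := by
    rintro y hy hyb s ⟨y', hy', hyb', rfl⟩
    rw [div_le_div_iff₀ (by linarith) (by linarith)]
    exact hex y y' hy hy' hyb hyb'
  have hSbdd : BddAbove S := ⟨_, hSle y₀ hy₀ hy₀b⟩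
  refine ⟨sSup S, lt_of_lt_of_le (div_pos (sub_pos.2 hzu) (sub_pos.2 hzb))
    (le_csSup hSbdd ⟨z, hz, hzb, rfl⟩), fun y hy => ?_⟩
  change u y - sSup S * C y ≤ u x - sSup S * C x
  rw [hxC]
  rcases lt_trichotomy (C y) b with h | h | h
  · have h1 := csSup_le hSne (hSle y hy h)
    rw [le_div_iff₀ (by linarith)] at h1
    linarith
  · have := hopt y hy h.le
    rw [h]
    linarith
  · have h1 := le_csSup hSbdd ⟨y, hy, h, rfl⟩
    rw [div_le_iff₀ (by linarith)] at h1
    linarith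

/-! ### First order conditions in equilibrium -/

namespace MannaInstance

variable {N M : Type*} [Fintype N] [Fintype M] {I : MannaInstance N M}
  {p : M → ℝ} {x : N → M → ℝ}

theorem isBad_iff_not_isGood {j : M} : I.IsBad j ↔ ¬ I.IsGood j := by
  simp [IsBad, IsGood]

theorem sum_clearing (e : I.IsEquilibrium p x) (j : M) : ∑ i, x i j = 1 := by
  rw [e.clearing, I.supply]

theorem not_improving (e : I.IsEquilibrium p x) (i : N) (j : M) {y : ℝ} (hy : 0 ≤ y)
    (hp : (y - x i j) * p j ≤ 0) : I.itemUtility i j y ≤ I.itemUtility i j (x i j) := by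
  classical
  have h := e.optimal i (Function.update (x i) j y) ⟨fun k => ?_, ?_⟩
  · have h1 := utility_update (I := I) (i := i) (x i) j y
    linarith
  · by_cases hk : k = j
    · subst hk; simpa using hy
    · simpa [hk] using (e.affordable i).1 k
  · rw [sum_update_mul]
    have := (e.affordable i).2
    linarith

theorem segLength_eq_of_segFull {i : N} {j : M} {k : Fin (I.K i j + 1)} {t : ℝ}
    (h : I.SegFull i j k t) : I.segLength i j k = ENNReal.ofReal (I.segAmt i j k t) := by
  obtain ⟨hk, h⟩ := h
  rw [segLength, dif_pos hk, h]

/-- If all segments of positive slope were full, their total length would fit into the unit supply.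
-/
theorem exists_not_segFull {j : M} (hd : 1 < I.desire j) (hx0 : ∀ i, 0 ≤ x i j)
    (hx : ∑ i, x i j = 1) : ∃ i k, 0 < I.U i j k ∧ ¬ I.SegFull i j k (x i j) := by
  classical
  by_contra! hc
  refine absurd hd (not_lt.2 ?_)
  rw [← ENNReal.ofReal_one, ← hx, ENNReal.ofReal_sum_of_nonneg fun i _ => hx0 i, desire]
  refine Finset.sum_le_sum fun i _ => ?_
  rw [← sum_segAmt (I := I) (i := i) (j := j) (hx0 i),
    ENNReal.ofReal_sum_of_nonneg fun k _ => segAmt_nonneg k _]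
  refine (Finset.sum_le_sum fun k hk => ?_).trans
    (Finset.sum_le_sum_of_subset (Finset.filter_subset _ _))
  exact (segLength_eq_of_segFull (hc i k (Finset.mem_filter.1 hk).2)).le

/-- At a price `≤ 0` an agent with an unfilled segment of positive slope could add to it at no cost.
-/
theorem price_pos (e : I.IsEquilibrium p x) {j : M} (hd : 1 < I.desire j) : 0 < p j := by
  by_contra! hp
  obtain ⟨i, k, hU, hk⟩ := exists_not_segFull hd (fun i => (e.affordable i).1 j) (sum_clearing e j)
  have h0 := (e.affordable i).1 j
  obtain ⟨y, hxy, hy⟩ := exists_gain h0 hk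
  have h1 := not_improving e i j (h0.trans hxy.le)
    (mul_nonpos_of_nonneg_of_nonpos (by linarith) hp)
  have h2 := mul_pos hU (sub_pos.2 hxy)
  linarith

/-- The slopes for a bad are at most `0` and strictly decrease, so only the first one can vanish. -/
theorem eq_zero_of_slope_nonneg {i : N} {j : M} (hb : I.IsBad j) {k : Fin (I.K i j + 1)}
    (hk : 0 ≤ I.U i j k) : k = 0 ∧ I.U i j 0 = 0 := by
  have h0 := hb i
  have hk0 : k = 0 := by
    by_contra h
    have := I.U_strictAnti i j (Fin.pos_iff_ne_zero.2 h)
    linarith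
  subst hk0
  exact ⟨rfl, le_antisymm h0 hk⟩

/-- A zero-slope segment that is also the last would make the indifference infinite. -/
theorem segLength_lt_top {j : M} (hind : I.indifference j < 1) {i : N} (hU : I.U i j 0 = 0) :
    0 < I.K i j := by
  classical
  by_contra hK
  have h1 : I.segLength i j 0 ≤ I.indifference j :=
    Finset.single_le_sum (f := fun i => I.segLength i j 0) (fun _ _ => zero_le)
      (Finset.mem_filter.2 ⟨Finset.mem_univ i, hU⟩)
  have h2 : I.segLength i j 0 = ⊤ := by
    rw [segLength, dif_neg (by simpa using hK)]
  rw [h2] at h1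
  exact absurd (h1.trans_lt hind) (by simp)

/-- At a price `≥ 0` nobody would keep a part of a segment of negative slope, so the whole unit
would have to fit into the zero-slope segments. -/
theorem price_neg (e : I.IsEquilibrium p x) {j : M} (hb : I.IsBad j)
    (hind : I.indifference j < 1) : p j < 0 := by
  classical
  by_contra! hp
  have hx0 : ∀ i, 0 ≤ x i j := fun i => (e.affordable i).1 j
  have h1 : ∀ i k, I.U i j k < 0 → I.segAmt i j k (x i j) = 0 := by
    intro i k hU
    by_contra hk
    obtain ⟨y, hy0, hyx, hy⟩ := exists_loss hk
    have h1 := not_improving e i j hy0 (mul_nonpos_of_nonpos_of_nonneg (by linarith) hp)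
    have h2 := mul_neg_of_neg_of_pos hU (sub_pos.2 hyx)
    linarith
  refine absurd hind (not_lt.2 ?_)
  rw [← ENNReal.ofReal_one, ← sum_clearing e j, ENNReal.ofReal_sum_of_nonneg fun i _ => hx0 i,
    indifference, Finset.sum_filter]
  refine Finset.sum_le_sum fun i _ => ?_
  rw [← sum_segAmt (I := I) (i := i) (j := j) (hx0 i)]
  split_ifs with hU
  · rw [Finset.sum_eq_single 0 (fun k _ hk => h1 i k ?_) (by simp)]
    · have hK := segLength_lt_top hind hU
      rw [segLength, dif_pos (by exact hK)]
      exact ENNReal.ofReal_le_ofReal (segAmt_le hK _)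
    · by_contra! h
      exact hk (eq_zero_of_slope_nonneg hb h).1
  · rw [Finset.sum_eq_zero fun k _ => h1 i k ?_, ENNReal.ofReal_zero]
    by_contra! h
    exact hU (eq_zero_of_slope_nonneg hb h).2

/-- With several agents, an edge leaving `i` provides a good that never satiates `i`. A single agent
receives the whole supply, which is less than its desire. -/
theorem exists_better (hd : ∀ j, I.IsGood j → 1 < I.desire j) (hconn : I.StronglyConnected)
    (e : I.IsEquilibrium p x) (i : N) :
    ∃ y : M → ℝ, (∀ j, 0 ≤ y j) ∧ I.utility i (x i) < I.utility i y := by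
  classical
  suffices H : ∃ j k, 0 < I.U i j k ∧ ¬ I.SegFull i j k (x i j) by
    obtain ⟨j, k, hU, hk⟩ := H
    obtain ⟨y, hxy, hy⟩ := exists_gain ((e.affordable i).1 j) hk
    refine ⟨Function.update (x i) j y, fun l => ?_, ?_⟩
    · by_cases hl : l = j
      · subst hl; simpa using ((e.affordable i).1 l).trans hxy.le
      · simpa [hl] using (e.affordable i).1 l
    · have h1 := utility_update (I := I) (i := i) (x i) j y
      have h2 := mul_pos hU (sub_pos.2 hxy)
      linarith
  by_cases hi : ∃ i', i ≠ i'
  · obtain ⟨i', hi'⟩ := hi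
    rcases (hconn.connected i i').cases_head with h | ⟨l, ⟨j, -, hns, -⟩, -⟩
    · exact absurd h hi'
    · exact ⟨j, Fin.last _, hns, segFull_last _⟩
  · push Not at hi
    obtain ⟨j, hj, -⟩ := hconn.brings_good i
    obtain ⟨i', k, hk⟩ := exists_not_segFull (hd j hj) (fun i => (e.affordable i).1 j)
      (sum_clearing e j)
    obtain rfl := hi i'
    exact ⟨j, k, hk⟩

/-- The first order conditions of an agent in equilibrium. -/
theorem exists_marginal (hd : ∀ j, I.IsGood j → 1 < I.desire j)
    (hind : ∀ j, I.IsBad j → I.indifference j < 1) (hconn : I.StronglyConnected)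
    (e : I.IsEquilibrium p x) (i : N) :
    ∑ j, x i j * p j = ∑ j, I.W i j * p j ∧ ∃ c : ℝ, 0 < c ∧ ∀ j k,
      (¬ I.SegFull i j k (x i j) → I.U i j k ≤ c * p j) ∧
      (I.segAmt i j k (x i j) ≠ 0 → c * p j ≤ I.U i j k) := by
  classical
  have hslater : ∃ y : M → ℝ, (∀ j, 0 ≤ y j) ∧ ∑ j, y j * p j < ∑ j, I.W i j * p j := by
    obtain ⟨j, hb, -⟩ := hconn.brings_bad i
    have hp := price_neg e hb (hind j hb)
    set b := ∑ j, I.W i j * p j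
    -- Taking a bad earns money: this amount costs `-(|b| + 1)`, which is below any budget `b`.
    refine ⟨Function.update 0 j ((|b| + 1) / (-p j)), fun l => ?_, ?_⟩
    · by_cases hl : l = j
      · subst hl
        simp only [Function.update_self]
        exact div_nonneg (by positivity) (by linarith)
      · simp [hl]
    · rw [sum_update_mul]
      simp only [Pi.zero_apply, zero_mul, Finset.sum_const_zero, zero_add, sub_zero]
      have hne := hp.ne
      have : (|b| + 1) / (-p j) * p j = -(|b| + 1) := by
        field_simp
      rw [this]
      linarith [neg_abs_le b]
  obtain ⟨hbud, c, hc, hmult⟩ := exists_multiplier (concaveOn_utility I i) p _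
    (e.affordable i).1 (e.affordable i).2 (fun y h1 h2 => e.optimal i y ⟨h1, h2⟩) hslater
    (exists_better hd hconn e i)
  refine ⟨hbud, c, hc, fun j k => ?_⟩
  have h0 := (e.affordable i).1 j
  have hitem : ∀ y, 0 ≤ y → I.itemUtility i j y - I.itemUtility i j (x i j) ≤
      c * p j * (y - x i j) := by
    intro y hy
    have h1 := hmult (Function.update (x i) j y) fun l => by
      by_cases hl : l = j
      · subst hl; simpa using hy
      · simpa [hl] using (e.affordable i).1 l
    have h2 := utility_update (I := I) (i := i) (x i) j y
    rw [sum_update_mul] at h1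
    linarith
  constructor
  · intro hk
    obtain ⟨y, hxy, hy⟩ := exists_gain h0 hk
    exact le_of_mul_le_mul_right (hy.trans (hitem y (h0.trans hxy.le))) (sub_pos.2 hxy)
  · intro hk
    obtain ⟨y, hy0, hyx, hy⟩ := exists_loss hk
    have := hitem y hy0
    exact le_of_mul_le_mul_right (by linarith) (sub_pos.2 hyx)

/-- The first order conditions suffice for an equilibrium. -/
theorem isEquilibrium_of_marginal (hx0 : ∀ i j, 0 ≤ x i j) (hx : ∀ j, ∑ i, x i j = 1)
    (hbud : ∀ i, ∑ j, x i j * p j = ∑ j, I.W i j * p j) (c : N → ℝ) (hc : ∀ i, 0 < c i)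
    (h : ∀ i j k, (¬ I.SegFull i j k (x i j) → I.U i j k ≤ c i * p j) ∧
      (I.segAmt i j k (x i j) ≠ 0 → c i * p j ≤ I.U i j k)) : I.IsEquilibrium p x := by
  refine ⟨fun i => ⟨hx0 i, (hbud i).le⟩, fun i y hy => ?_, fun j => by rw [hx, I.supply]⟩
  have h1 : ∑ j, (I.itemUtility i j (y j) - c i * p j * y j) ≤
      ∑ j, (I.itemUtility i j (x i j) - c i * p j * x i j) := Finset.sum_le_sum fun j _ =>
    itemUtility_sub_le (hx0 i j) (hy.1 j) (fun k => (h i j k).1) fun k => (h i j k).2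
  have h2 : ∀ z : M → ℝ, ∑ j, c i * p j * z j = c i * ∑ j, z j * p j := fun z => by
    rw [Finset.mul_sum]
    exact Finset.sum_congr rfl fun j _ => by ring
  rw [Finset.sum_sub_distrib, Finset.sum_sub_distrib, h2, h2, hbud i] at h1
  have h3 := mul_le_mul_of_nonneg_left hy.2 (hc i).le
  simp only [utility]
  linarith

end MannaInstance

/-! ### Translation between an instance and its market of pieces -/

namespace MannaInstance

variable {N M : Type*} [Fintype N] [Fintype M] (I : MannaInstance N M)

open Classical in
/-- `1` for goods and `-1` for bads. -/
noncomputable def sgn (j : M) : ℝ := if I.IsGood j then 1 else -1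

/-- The segments whose slope has the sign of the item. -/
abbrev Piece := Σ i : N, Σ j : M, {k : Fin (I.K i j + 1) // 0 < I.sgn j * I.U i j k}

open Classical in
/-- The amount of a bad that an agent takes at no loss of utility. -/
noncomputable def freeAmt (i : N) (j : M) : ℝ :=
  if h : I.IsBad j ∧ I.U i j 0 = 0 ∧ 0 < I.K i j then I.L i j ⟨0, h.2.2⟩ else 0

/-- The length of a piece, or `2` for the last segment. -/
noncomputable def pieceLen (t : I.Piece) : ℝ :=
  if h : t.2.2.1.val < I.K t.1 t.2.1 then I.L t.1 t.2.1 ⟨_, h⟩ else 2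

variable {I}

theorem sgn_good {j : M} (h : I.IsGood j) : I.sgn j = 1 := if_pos h

theorem sgn_bad {j : M} (h : I.IsBad j) : I.sgn j = -1 := if_neg (isBad_iff_not_isGood.1 h)

theorem good_or_bad (j : M) : I.IsGood j ∨ I.IsBad j := by
  rw [isBad_iff_not_isGood]; exact em _

theorem isGood_of_sgn {j : M} (h : I.sgn j = 1) : I.IsGood j := by
  by_contra h'
  rw [sgn_bad (isBad_iff_not_isGood.2 h')] at h
  norm_num at h

theorem isBad_of_sgn {j : M} (h : I.sgn j = -1) : I.IsBad j := by
  rw [isBad_iff_not_isGood]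
  intro h'
  rw [sgn_good h'] at h
  norm_num at h

theorem freeAmt_good {i : N} {j : M} (h : I.IsGood j) : I.freeAmt i j = 0 :=
  dif_neg fun h' => isBad_iff_not_isGood.1 h'.1 h

theorem freeAmt_nonneg (i : N) (j : M) : 0 ≤ I.freeAmt i j := by
  unfold freeAmt
  split_ifs
  · exact (I.L_pos i j _).le
  · exact le_rfl

theorem sum_piece_item (F : I.Piece → ℝ) (j : M) [DecidablePred fun t : I.Piece => t.2.1 = j] :
    ∑ t with t.2.1 = j, F t = ∑ i, ∑ k, F ⟨i, j, k⟩ := by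
  rw [Finset.sum_filter, Fintype.sum_sigma]
  refine Finset.sum_congr rfl fun i _ => ?_
  rw [Fintype.sum_sigma, Finset.sum_eq_single j]
  · simp
  · intro l _ hl
    simp [hl]
  · simp

theorem sum_piece_agent (F : I.Piece → ℝ) (i : N) [DecidablePred fun t : I.Piece => t.1 = i] :
    ∑ t with t.1 = i, F t = ∑ j, ∑ k, F ⟨i, j, k⟩ := by
  rw [Finset.sum_filter, Fintype.sum_sigma, Finset.sum_eq_single i]
  · simp [Fintype.sum_sigma]
  · intro l _ hl
    simp [hl]
  · simp

theorem pieceLen_pos (t : I.Piece) : 0 < I.pieceLen t := by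
  unfold pieceLen
  split_ifs
  · exact I.L_pos _ _ _
  · norm_num

theorem sum_freeAmt_lt {j : M} (hind : I.IsBad j → I.indifference j < 1) :
    ∑ i, I.freeAmt i j < 1 := by
  classical
  rcases good_or_bad (I := I) j with h | h
  · simp [freeAmt_good h]
  · rw [← ENNReal.ofReal_lt_one, ENNReal.ofReal_sum_of_nonneg fun i _ => freeAmt_nonneg i j]
    refine lt_of_le_of_lt ?_ (hind h)
    rw [indifference, Finset.sum_filter]
    refine Finset.sum_le_sum fun i _ => ?_
    unfold freeAmt
    split_ifs with h1 h2 h2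
    · rw [segLength, dif_pos (by exact h1.2.2)]
      exact le_rfl
    · exact absurd h1.2.1 h2
    · simp
    · simp

theorem last_slope_neg {i : N} {j : M} (hind : I.IsBad j → I.indifference j < 1)
    (hb : I.IsBad j) : I.U i j (Fin.last _) < 0 := by
  by_contra! h
  obtain ⟨h1, h2⟩ := eq_zero_of_slope_nonneg hb h
  have h3 := segLength_lt_top (hind hb) h2
  have := congrArg Fin.val h1
  simp only [Fin.val_last, Fin.val_zero] at this
  omega

/-- The last segment of a bad as a piece. -/
def lastPiece {i : N} {j : M} (hind : I.IsBad j → I.indifference j < 1) (hb : I.IsBad j) : I.Piece :=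
  ⟨i, j, Fin.last _, by
    rw [sgn_bad hb]
    linarith [last_slope_neg (i := i) hind hb]⟩

/-- An unbounded piece suffices, having length `2`. Without one the item is a good, since the last
segment for a bad is always a piece, and the total length is the desire. -/
theorem exists_pieces_gt [Nonempty N] {j : M} (hd : I.IsGood j → 1 < I.desire j)
    (hind : I.IsBad j → I.indifference j < 1) :
    ∃ s : Finset I.Piece, (∀ t ∈ s, t.2.1 = j) ∧ 1 < ∑ t ∈ s, I.pieceLen t := by
  classical
  by_cases hu : ∃ t : I.Piece, t.2.1 = j ∧ ¬ t.2.2.1.val < I.K t.1 t.2.1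
  · obtain ⟨t, ht, hu⟩ := hu
    refine ⟨{t}, by simpa using ht, ?_⟩
    rw [Finset.sum_singleton, pieceLen, dif_neg hu]
    norm_num
  · push Not at hu
    rcases good_or_bad (I := I) j with h | h
    · refine ⟨Finset.univ.filter fun t => t.2.1 = j, by simp, ?_⟩
      rw [sum_piece_item, ← ENNReal.one_lt_ofReal, ENNReal.ofReal_sum_of_nonneg fun i _ =>
        Finset.sum_nonneg fun k _ => (pieceLen_pos _).le]
      refine (hd h).trans_le (le_of_eq (Finset.sum_congr rfl fun i _ => ?_))
      rw [ENNReal.ofReal_sum_of_nonneg fun k _ => (pieceLen_pos _).le,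
        Finset.sum_subtype (p := fun k => 0 < I.sgn j * I.U i j k) _ (by simp [sgn_good h])]
      refine Finset.sum_congr rfl fun k _ => ?_
      have hk := hu ⟨i, j, k⟩ rfl
      rw [segLength, dif_pos (by exact hk), pieceLen, dif_pos (by exact hk)]
    · obtain ⟨i⟩ := ‹Nonempty N›
      have := hu (lastPiece (i := i) hind h) rfl
      simp [lastPiece] at this

/-- The market of pieces of an instance. -/
noncomputable def market [Nonempty N] (hd : ∀ j, I.IsGood j → 1 < I.desire j)
    (hind : ∀ j, I.IsBad j → I.indifference j < 1) (hconn : I.StronglyConnected) :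
    PieceMarket N M I.Piece where
  agent t := t.1
  item t := t.2.1
  slope t := I.U t.1 t.2.1 t.2.2.1
  len := I.pieceLen
  bdd t := t.2.2.1.val < I.K t.1 t.2.1
  sgn := I.sgn
  base := I.freeAmt
  W := I.W
  sgn_eq j := by
    rcases good_or_bad (I := I) j with h | h
    · exact Or.inl (sgn_good h)
    · exact Or.inr (sgn_bad h)
  slope_pos t := t.2.2.2
  len_pos := pieceLen_pos
  len_eq t ht := dif_neg ht
  base_nonneg := freeAmt_nonneg
  base_good i j h := freeAmt_good (isGood_of_sgn h)
  base_lt j := sum_freeAmt_lt (hind j)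
  W_nonneg := I.W_nonneg
  supply := I.supply
  enough j := exists_pieces_gt (hd j) (hind j)
  disposal i j h := ⟨lastPiece (hind j) (isBad_of_sgn h), rfl, rfl, by simp [lastPiece]⟩
  connected i i' := by
    refine Relation.ReflTransGen.mono ?_ i i' (hconn.connected i i')
    rintro a b ⟨j, hj, hns, hW⟩
    exact ⟨⟨a, j, Fin.last _, by rw [sgn_good hj, one_mul]; exact hns⟩, rfl, by simp,
      sgn_good hj, hW⟩

/-- First order conditions with marginal utility of money `c`. -/
def Marginal (I : MannaInstance N M) (c : N → ℝ) (p : M → ℝ) (x : N → M → ℝ) : Prop :=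
  ∀ i j k, (¬ I.SegFull i j k (x i j) → I.U i j k ≤ c i * p j) ∧
    (I.segAmt i j k (x i j) ≠ 0 → c i * p j ≤ I.U i j k)

/-- The segments that are not pieces are those of slope at most `0` for a good, which stay empty,
and the zero-slope segment of a bad, which is full and accounts for `freeAmt`. -/
theorem sum_fin_eq {i : N} {j : M} (g : Fin (I.K i j + 1) → ℝ)
    (hind : I.IsBad j → I.indifference j < 1)
    (hgood : ∀ k, I.IsGood j → I.U i j k ≤ 0 → g k = 0)
    (hbad : I.IsBad j → I.U i j 0 = 0 → ∀ h : 0 < I.K i j, g 0 = I.L i j ⟨0, h⟩) :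
    ∑ k, g k = ∑ k : {k : Fin (I.K i j + 1) // 0 < I.sgn j * I.U i j k}, g k + I.freeAmt i j := by
  classical
  rw [← Finset.sum_filter_add_sum_filter_not Finset.univ
    (fun k => 0 < I.sgn j * I.U i j k) g]
  congr 1
  · exact Finset.sum_subtype _ (by simp) g
  · rcases good_or_bad (I := I) j with h | h
    · rw [freeAmt_good h]
      refine Finset.sum_eq_zero fun k hk => hgood k h ?_
      simpa [sgn_good h] using hk
    · have hk0 : ∀ k ∈ Finset.univ.filter (fun k => ¬ 0 < I.sgn j * I.U i j k),
          k = 0 ∧ I.U i j 0 = 0 := fun k hk => by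
        refine eq_zero_of_slope_nonneg h ?_
        simpa [sgn_bad h] using hk
      by_cases hU : I.U i j 0 = 0
      · have hK := segLength_lt_top (hind h) hU
        rw [freeAmt, dif_pos ⟨h, hU, hK⟩, ← hbad h hU hK]
        refine Finset.sum_eq_single_of_mem 0 (by simp [hU]) fun k hk hne => ?_
        exact absurd (hk0 k hk).1 hne
      · rw [freeAmt, dif_neg fun h' => hU h'.2.1]
        exact Finset.sum_eq_zero fun k hk => absurd (hk0 k hk).2 hU

section Translate

variable {r : N → ℝ} {p : M → ℝ} {x : N → M → ℝ} {f : I.Piece → ℝ}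

/-- Spending of an allocation. -/
noncomputable def spending (I : MannaInstance N M) (p : M → ℝ) (x : N → M → ℝ) (t : I.Piece) : ℝ :=
  I.segAmt t.1 t.2.1 t.2.2.1 (x t.1 t.2.1) * p t.2.1

/-- The allocation of a spending plan. -/
noncomputable def allocOf (I : MannaInstance N M) (p : M → ℝ) (f : I.Piece → ℝ) (i : N) (j : M) : ℝ :=
  ∑ k, f ⟨i, j, k⟩ / p j + I.freeAmt i j

/-- The signs of prices force the segments that are not pieces: slope at most `0` at a positive
price leaves a good unbought, and slope `0` at a negative price fills the free segment of a bad. -/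
theorem sum_spending (hind : ∀ j, I.IsBad j → I.indifference j < 1) {c : N → ℝ}
    (hc : ∀ i, 0 < c i) (hp : ∀ j, 0 < I.sgn j * p j)
    (hx0 : ∀ i j, 0 ≤ x i j) (hm : I.Marginal c p x) (i : N) (j : M) :
    ∑ k, I.spending p x ⟨i, j, k⟩ = (x i j - I.freeAmt i j) * p j := by
  have h := sum_fin_eq (i := i) (fun k => I.segAmt i j k (x i j)) (hind j) (fun k hg hU => by
      by_contra h
      have h1 := (hm i j k).2 h
      have h2 := hp j
      rw [sgn_good hg, one_mul] at h2
      have := mul_pos (hc i) h2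
      linarith)
    fun hb hU hK => by
      by_contra h
      have h1 := (hm i j 0).1 fun ⟨_, h'⟩ => h h'
      have h2 := hp j
      rw [sgn_bad hb] at h2
      have := mul_neg_of_pos_of_neg (hc i) (by linarith : p j < 0)
      linarith
  rw [sum_segAmt (hx0 i j)] at h
  simp only [spending]
  rw [← Finset.sum_mul]
  congr 1
  linarith

theorem allocOf_spending (hind : ∀ j, I.IsBad j → I.indifference j < 1) {c : N → ℝ}
    (hc : ∀ i, 0 < c i) (hp : ∀ j, 0 < I.sgn j * p j)
    (hx0 : ∀ i j, 0 ≤ x i j) (hm : I.Marginal c p x) : I.allocOf p (I.spending p x) = x := by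
  funext i j
  have hpj : p j ≠ 0 := fun h => by have := hp j; simp [h] at this
  rw [allocOf, ← Finset.sum_div, sum_spending hind hc hp hx0 hm, mul_div_cancel_right₀ _ hpj]
  ring

variable [Nonempty N] {hd : ∀ j, I.IsGood j → 1 < I.desire j}
  {hind : ∀ j, I.IsBad j → I.indifference j < 1} {hconn : I.StronglyConnected}

theorem sum_pieces (F : I.Piece → ℝ) (j : M) :
    ∑ t ∈ (market hd hind hconn).pieces j, F t = ∑ i, ∑ k, F ⟨i, j, k⟩ := by
  classical
  rw [← sum_piece_item]
  refine Finset.sum_congr ?_ fun _ _ => rfl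
  ext t
  simp [market]

theorem sum_agentPieces (F : I.Piece → ℝ) (i : N) :
    ∑ t ∈ (market hd hind hconn).agentPieces i, F t = ∑ j, ∑ k, F ⟨i, j, k⟩ := by
  classical
  rw [← sum_piece_agent]
  refine Finset.sum_congr ?_ fun _ _ => rfl
  ext t
  simp [market]

theorem isClearing_spending (hr : ∀ i, 0 < r i) (hp : ∀ j, 0 < I.sgn j * p j)
    (hx0 : ∀ i j, 0 ≤ x i j) (hx : ∀ j, ∑ i, x i j = 1)
    (hm : I.Marginal (fun i => (r i)⁻¹) p x) :
    (market hd hind hconn).IsClearing r p (I.spending p x) := by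
  have hamt : ∀ t : I.Piece, I.segAmt t.1 t.2.1 t.2.2.1 (x t.1 t.2.1) ≤ I.pieceLen t := by
    intro t
    unfold pieceLen
    split_ifs with h
    · exact segAmt_le h _
    -- On a last segment the amount is at most the supply `1`, below the stand-in length `2`.
    · have h1 := Finset.single_le_sum (f := fun k => I.segAmt t.1 t.2.1 k (x t.1 t.2.1))
        (fun k _ => segAmt_nonneg k _) (Finset.mem_univ t.2.2.1)
      rw [sum_segAmt (hx0 _ _)] at h1
      have h2 := Finset.single_le_sum (f := fun i => x i t.2.1) (fun i _ => hx0 i _)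
        (Finset.mem_univ t.1)
      rw [hx] at h2
      linarith
  refine ⟨hr, hp, fun t => ?_, fun t => ?_, fun t h => ?_, fun t h => ?_, fun j => ?_⟩
  · have h1 := segAmt_nonneg (I := I) t.2.2.1 (x t.1 t.2.1)
    have h2 := mul_nonneg h1 (hp t.2.1).le
    change 0 ≤ I.sgn t.2.1 * (_ * p t.2.1)
    linarith
  · have h2 := mul_le_mul_of_nonneg_right (hamt t) (hp t.2.1).le
    change I.sgn t.2.1 * (_ * p t.2.1) ≤ I.sgn t.2.1 * (I.pieceLen t * p t.2.1)
    linarith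
  · have h1 := (hm t.1 t.2.1 t.2.2.1).1 fun ⟨hk, hfull⟩ => h (by
      change I.segAmt _ _ _ _ * _ = I.pieceLen t * _
      rw [hfull, pieceLen, dif_pos hk]
      rfl)
    rw [inv_mul_eq_div, le_div_iff₀ (hr _)] at h1
    rw [mul_comm]
    exact h1
  · have h1 := (hm t.1 t.2.1 t.2.2.1).2 fun h0 => h (by
      change I.segAmt _ _ _ _ * _ = 0
      rw [h0, zero_mul])
    rw [inv_mul_eq_div, div_le_iff₀ (hr _)] at h1
    rw [mul_comm]
    exact h1
  · rw [sum_pieces, Finset.sum_congr rfl fun i _ =>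
      sum_spending hind (fun i => inv_pos.2 (hr i)) hp hx0 hm i j, ← Finset.sum_mul,
      Finset.sum_sub_distrib, hx]
    rfl

theorem excess_eq (hp : ∀ j, p j ≠ 0) (i : N) :
    (market hd hind hconn).excess p f i =
      ∑ j, I.W i j * p j - ∑ j, I.allocOf p f i j * p j := by
  rw [PieceMarket.excess, sum_agentPieces, ← Finset.sum_sub_distrib, ← Finset.sum_sub_distrib]
  refine Finset.sum_congr rfl fun j _ => ?_
  rw [allocOf, ← Finset.sum_div, add_mul, div_mul_cancel₀ _ (hp j)]
  change (I.W i j - I.freeAmt i j) * p j - _ = _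
  ring

/-- The purchased amounts fill the segments in order: if a segment is used, then `p` is at most `r`
times its slope, hence below `r` times any earlier slope, and the earlier pieces are full. So the
bundle alone recovers the amounts in all segments. -/
theorem allocOf_of_isClearing (h : (market hd hind hconn).IsClearing r p f) :
    (∀ i j, 0 ≤ I.allocOf p f i j) ∧ (∀ j, ∑ i, I.allocOf p f i j = 1) ∧
    I.Marginal (fun i => (r i)⁻¹) p (I.allocOf p f) ∧ I.spending p (I.allocOf p f) = f := by
  classical
  have hp : ∀ j, 0 < I.sgn j * p j := h.sgn_pos
  have hp0 : ∀ j, p j ≠ 0 := fun j h0 => by have := hp j; simp [h0] at this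
  have hsq : ∀ j, I.sgn j * I.sgn j = 1 := fun j => by
    rcases good_or_bad (I := I) j with h | h
    · rw [sgn_good h, one_mul]
    · rw [sgn_bad h]; norm_num
  have hdiv : ∀ t : I.Piece, 0 ≤ f t / p t.2.1 ∧ f t / p t.2.1 ≤ I.pieceLen t := by
    intro t
    have h1 : 0 ≤ I.sgn t.2.1 * f t := h.nonneg t
    have h2 : I.sgn t.2.1 * f t ≤ I.sgn t.2.1 * (I.pieceLen t * p t.2.1) := h.le t
    have h3 : f t / p t.2.1 = (I.sgn t.2.1 * f t) / (I.sgn t.2.1 * p t.2.1) := by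
      rw [mul_div_mul_left]
      intro h0
      have := hsq t.2.1
      simp [h0] at this
    rw [h3]
    exact ⟨div_nonneg h1 (hp _).le, (div_le_iff₀ (hp _)).2 (by linarith)⟩
  -- The amounts in all segments, including those that are not pieces: the free amount for a bad,
  -- nothing for a good.
  set xs : ∀ i j, Fin (I.K i j + 1) → ℝ := fun i j k =>
    if hk : 0 < I.sgn j * I.U i j k then f ⟨i, j, k, hk⟩ / p j
    else if I.IsBad j then I.freeAmt i j else 0 with hxs
  have hfree : ∀ {i j} {k : Fin (I.K i j + 1)}, I.IsBad j → ¬ 0 < I.sgn j * I.U i j k →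
      k = 0 ∧ I.U i j k = 0 ∧ ∃ hK : 0 < I.K i j, I.freeAmt i j = I.L i j ⟨0, hK⟩ := by
    intro i j k hb hk
    obtain ⟨h1, h2⟩ := eq_zero_of_slope_nonneg hb (k := k) (by simpa [sgn_bad hb] using hk)
    have hK := segLength_lt_top (hind j hb) h2
    exact ⟨h1, h1 ▸ h2, hK, dif_pos ⟨hb, h2, hK⟩⟩
  have hsum : ∀ i j, ∑ k, xs i j k = I.allocOf p f i j := by
    intro i j
    rw [sum_fin_eq (xs i j) (hind j), allocOf]
    · congr 1
      exact Finset.sum_congr rfl fun k _ => dif_pos k.2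
    · intro k hg hU
      simp only [hxs]
      rw [dif_neg (by rw [sgn_good hg]; linarith), if_neg]
      rwa [isBad_iff_not_isGood, not_not]
    · intro hb hU hK
      simp only [hxs]
      rw [dif_neg (by rw [hU]; simp), if_pos hb, freeAmt, dif_pos ⟨hb, hU, hK⟩]
  have hxs0 : ∀ i j k, 0 ≤ xs i j k := by
    intro i j k
    simp only [hxs]
    split_ifs
    · exact (hdiv _).1
    · exact freeAmt_nonneg i j
    · exact le_rfl
  have hxsL : ∀ i j k (hk : k.val < I.K i j), xs i j k ≤ I.L i j ⟨k.val, hk⟩ := by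
    intro i j k hk
    simp only [hxs]
    split_ifs with h1 h2
    · refine (hdiv _).2.trans (le_of_eq ?_)
      exact dif_pos hk
    · obtain ⟨rfl, -, hK, h3⟩ := hfree h2 h1
      exact h3.le
    · exact (I.L_pos i j _).le
  have hfull : ∀ i j k (hk : 0 < I.sgn j * I.U i j k), p j < r i * I.U i j k →
      ∀ hK : k.val < I.K i j, xs i j k = I.L i j ⟨k.val, hK⟩ := by
    intro i j k hk hlt hK
    simp only [hxs]
    rw [dif_pos hk]
    have : f ⟨i, j, k, hk⟩ = I.pieceLen ⟨i, j, k, hk⟩ * p j := by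
      by_contra hc
      exact absurd (h.of_not_full ⟨i, j, k, hk⟩ hc) (not_le.2 hlt)
    rw [this, mul_div_cancel_right₀ _ (hp0 j)]
    exact dif_pos hK
  have hamt : ∀ i j k, I.segAmt i j k (I.allocOf p f i j) = xs i j k := by
    intro i j k
    rw [← hsum]
    refine segAmt_sum_eq _ (hxs0 i j) (hxsL i j) (fun l k hlk hne hl => ?_) k
    have hU := I.U_strictAnti i j hlk
    have hk : 0 < I.sgn j * I.U i j k := by
      by_contra hk
      rcases good_or_bad (I := I) j with hg | hb
      · apply hne
        simp only [hxs]
        rw [dif_neg hk, if_neg (by rwa [isBad_iff_not_isGood, not_not])]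
      · rw [(hfree hb hk).1] at hlk
        exact absurd hlk (by simp)
    have hle : p j ≤ r i * I.U i j k := by
      refine h.of_not_empty ⟨i, j, k, hk⟩ fun h0 => hne ?_
      simp only [hxs]
      rw [dif_pos hk, h0, zero_div]
    have hlt : p j < r i * I.U i j l := hle.trans_lt (mul_lt_mul_of_pos_left hU (h.pos i))
    by_cases hl' : 0 < I.sgn j * I.U i j l
    · exact hfull i j l hl' hlt hl
    · rcases good_or_bad (I := I) j with hg | hb
      · rw [sgn_good hg] at hk hl'
        linarith
      · obtain ⟨rfl, -, hK, h3⟩ := hfree hb hl'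
        simp only [hxs]
        rw [dif_neg hl', if_pos hb, h3]
        rfl
  have hx0 : ∀ i j, 0 ≤ I.allocOf p f i j := fun i j => by
    rw [← hsum]
    exact Finset.sum_nonneg fun k _ => hxs0 i j k
  refine ⟨hx0, fun j => ?_, fun i j k => ?_, funext fun t => ?_⟩
  · have hcl : ∑ t ∈ (market hd hind hconn).pieces j, f t = (1 - ∑ i, I.freeAmt i j) * p j :=
      h.clear j
    rw [sum_pieces] at hcl
    simp only [allocOf, Finset.sum_add_distrib, ← Finset.sum_div]
    rw [hcl, mul_div_cancel_right₀ _ (hp0 j)]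
    ring
  · rw [hamt]
    by_cases hk : 0 < I.sgn j * I.U i j k
    · constructor
      · intro hnf
        rw [inv_mul_eq_div, le_div_iff₀ (h.pos i), mul_comm]
        by_contra! hlt
        by_cases hK : k.val < I.K i j
        · exact hnf ⟨hK, by rw [hamt]; exact hfull i j k hk hlt hK⟩
        · exact absurd (h.of_not_full ⟨i, j, k, hk⟩
            (h.not_full_of_unbounded (t := ⟨i, j, k, hk⟩) hK)) (not_le.2 hlt)
      · intro hne
        rw [inv_mul_eq_div, div_le_iff₀ (h.pos i), mul_comm]
        refine h.of_not_empty ⟨i, j, k, hk⟩ fun h0 => hne ?_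
        simp only [hxs]
        rw [dif_pos hk, h0, zero_div]
    · have hpj := hp j
      have hr := inv_pos.2 (h.pos i)
      rcases good_or_bad (I := I) j with hg | hb
      · rw [sgn_good hg, one_mul] at hk hpj
        refine ⟨fun _ => (not_lt.1 hk).trans (mul_pos hr hpj).le, fun hne => absurd ?_ hne⟩
        simp only [hxs]
        rw [dif_neg (by rwa [sgn_good hg, one_mul]),
          if_neg (by rwa [isBad_iff_not_isGood, not_not])]
      · obtain ⟨h1, h2, hK, h3⟩ := hfree hb hk
        refine ⟨fun hnf => absurd ?_ hnf, fun _ => ?_⟩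
        · subst h1
          refine ⟨hK, ?_⟩
          rw [hamt]
          simp only [hxs]
          rw [dif_neg hk, if_pos hb, h3]
          rfl
        · rw [sgn_bad hb] at hpj
          rw [h2]
          exact (mul_neg_of_pos_of_neg hr (by linarith)).le
  · rw [spending, hamt]
    simp only [hxs]
    rw [dif_pos t.2.2.2, div_mul_cancel₀ _ (hp0 _)]

end Translate

end MannaInstance

/-! ### Generic parameters and the count of equilibria -/

namespace MannaInstance

variable {N M : Type*} [Fintype N] [Fintype M] {I : MannaInstance N M}

/-- The parameters without the endowments of agent `o`. -/
abbrev FreeParam (I : MannaInstance N M) (o : N) := {q : I.Param // ∀ j, q ≠ .endowment o j}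

/-- The normalization can be solved for the endowments of `o`, so it leaves the other parameters
free. A relation among these vanishes at all rational points and is the zero polynomial. -/
theorem NoPolynomialRelation.algebraicIndependent (h : I.NoPolynomialRelation) (o : N) :
    AlgebraicIndependent ℚ fun q : I.FreeParam o => I.paramValue q.1 := by
  classical
  rw [algebraicIndependent_iff]
  intro Q hQ
  refine MvPolynomial.funext fun y => ?_
  -- A rational point `y` is extended by the endowments of `o` that the normalization prescribes.
  let θ : I.Param → ℝ := fun q => if hq : ∀ j, q ≠ .endowment o j then (y ⟨q, hq⟩ : ℝ) else
    match q with
    | .endowment _ j => 1 - ∑ i : {i // i ≠ o}, (y ⟨.endowment i j, fun _ h => i.2 (by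
        injection h)⟩ : ℝ)
    | _ => 0
  have h1 := h (MvPolynomial.rename Subtype.val Q) (by rwa [MvPolynomial.aeval_rename]) θ ?_
  · rw [MvPolynomial.aeval_rename] at h1
    have h2 : θ ∘ Subtype.val = algebraMap ℚ ℝ ∘ y := by
      funext q
      exact dif_pos q.2
    rw [h2, MvPolynomial.aeval_algebraMap_apply] at h1
    rw [map_zero]
    simpa using h1
  · intro j
    have h3 : θ (.endowment o j) = 1 - ∑ i : {i // i ≠ o},
        (y ⟨.endowment i j, fun _ h => i.2 (by injection h)⟩ : ℝ) :=
      dif_neg fun h => h j rfl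
    rw [← Finset.add_sum_erase _ _ (Finset.mem_univ o), h3,
      Finset.sum_subtype (p := fun i => i ≠ o) (Finset.univ.erase o) (by simp), sub_add_eq_add_sub,
      sub_eq_iff_eq_add]
    congr 1
    refine Finset.sum_congr rfl fun i _ => ?_
    exact dif_pos fun _ h => i.2 (by injection h)

theorem freeAmt_ne_zero {i : N} {j : M} (h : I.freeAmt i j ≠ 0) :
    I.IsBad j ∧ I.U i j 0 = 0 ∧ 0 < I.K i j := by
  by_contra h'
  exact h (dif_neg h')

theorem price_sgn_pos {p : M → ℝ} {x : N → M → ℝ} (hd : ∀ j, I.IsGood j → 1 < I.desire j)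
    (hind : ∀ j, I.IsBad j → I.indifference j < 1) (e : I.IsEquilibrium p x) (j : M) :
    0 < I.sgn j * p j := by
  rcases good_or_bad (I := I) j with h | h
  · rw [sgn_good h, one_mul]
    exact price_pos e (hd j h)
  · rw [sgn_bad h]
    linarith [price_neg e h (hind j h)]

section Count

variable [Nonempty N] {hd : ∀ j, I.IsGood j → 1 < I.desire j}
  {hind : ∀ j, I.IsBad j → I.indifference j < 1} {hconn : I.StronglyConnected}

/-- The free parameter of the instance behind a free parameter of its market. -/
def parParam (o : N) : (market hd hind hconn).Par o → I.FreeParam o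
  | .inl t => ⟨.slope t.1 t.2.1 t.2.2.1 fun h => by
      have := t.2.2.2
      rw [h, mul_zero] at this
      exact this.false, fun _ => by simp⟩
  | .inr (.inl t) => ⟨.length t.1.1 t.1.2.1 ⟨t.1.2.2.1.val, t.2⟩, fun _ => by simp⟩
  | .inr (.inr (.inl x)) => ⟨.endowment x.1 x.2, fun _ h => x.1.2 (by injection h)⟩
  | .inr (.inr (.inr x)) => ⟨.length x.1.1 x.1.2 ⟨0, (freeAmt_ne_zero x.2).2.2⟩, fun _ => by simp⟩

/-- The delicate case is that of piece lengths and free amounts, which are both segment lengths: a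
free amount belongs to a segment of slope `0`, and such a segment is not a piece. -/
theorem parParam_injective (o : N) :
    Function.Injective (parParam (hd := hd) (hind := hind) (hconn := hconn) o) := by
  have key : ∀ (t : {t // (market hd hind hconn).bdd t})
      (x : {x : N × M // (market hd hind hconn).base x.1 x.2 ≠ 0}),
      parParam o (.inr (.inl t)) ≠ parParam o (.inr (.inr (.inr x))) := by
    rintro ⟨⟨i, j, k, hk⟩, ht⟩ ⟨⟨i', j'⟩, hx⟩ h
    simp only [parParam, Subtype.mk.injEq, Param.length.injEq] at h
    obtain ⟨rfl, rfl, h⟩ := h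
    have h0 : k = 0 := by
      have := congrArg Fin.val (eq_of_heq h)
      exact Fin.ext this
    rw [h0, (freeAmt_ne_zero hx).2.1, mul_zero] at hk
    exact hk.false
  rintro (⟨i, j, k, hk⟩ | ⟨⟨i, j, k, hk⟩, ht⟩ | ⟨⟨i, hi⟩, j⟩ | ⟨⟨i, j⟩, hx⟩)
    (⟨i', j', k', hk'⟩ | ⟨⟨i', j', k', hk'⟩, ht'⟩ | ⟨⟨i', hi'⟩, j'⟩ | ⟨⟨i', j'⟩, hx'⟩) h
  all_goals first
    | exact absurd h (key _ _)
    | exact absurd h.symm (key _ _)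
    | simp [parParam] at h
      done
    | skip
  · simp only [parParam, Subtype.mk.injEq, Param.slope.injEq] at h
    obtain ⟨rfl, rfl, h⟩ := h
    obtain rfl := eq_of_heq h
    rfl
  · simp only [parParam, Subtype.mk.injEq, Param.length.injEq] at h
    obtain ⟨rfl, rfl, h⟩ := h
    have h0 := congrArg Fin.val (eq_of_heq h)
    obtain rfl : k = k' := Fin.ext h0
    rfl
  · simp only [parParam, Subtype.mk.injEq, Param.endowment.injEq] at h
    obtain ⟨rfl, rfl⟩ := h
    rfl
  · simp only [parParam, Subtype.mk.injEq, Param.length.injEq] at h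
    obtain ⟨rfl, rfl, -⟩ := h
    rfl

theorem NoPolynomialRelation.generic (h : I.NoPolynomialRelation) (o : N) :
    (market hd hind hconn).Generic o := by
  have h1 := (h.algebraicIndependent o).comp _
    (parParam_injective (hd := hd) (hind := hind) (hconn := hconn) o)
  suffices h2 : (market hd hind hconn).parVal o = (fun q => I.paramValue q.1) ∘ parParam o by
    rw [PieceMarket.Generic, h2]
    exact h1
  funext z
  rcases z with t | ⟨t, ht⟩ | x | ⟨x, hx⟩
  · rfl
  · exact dif_pos ht
  · rfl
  · exact dif_pos (freeAmt_ne_zero hx)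

open PieceMarket in
/-- The equilibrium of a solution of the market of pieces. -/
noncomputable def toEquilibrium (o : N) (v : (market hd hind hconn).eqSet o) : I.Equilibrium where
  price := vp v.1
  alloc := I.allocOf (vp v.1) (vf v.1)
  isEquilibrium := by
    obtain ⟨v, h, -, hex, -⟩ := v
    obtain ⟨hx0, hx, hm, -⟩ := allocOf_of_isClearing h
    have hp0 : ∀ j, vp v j ≠ 0 := fun j h0 => by
      have := h.sgn_pos j
      simp [h0] at this
    refine isEquilibrium_of_marginal hx0 hx (fun i => ?_) (fun i => (vr v i)⁻¹)
      (fun i => inv_pos.2 (h.pos i)) hm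
    have := hex i
    rw [excess_eq hp0] at this
    linarith

open PieceMarket in
-- Scaling the prices by the marginal utility of money `c o` gives `r i = c o / c i`, so that `r o =
-- 1`.
theorem exists_toEquilibrium (o : N) (e : I.Equilibrium) :
    ∃ v : (market hd hind hconn).eqSet o, I.scaling (toEquilibrium o v) e := by
  obtain ⟨p, x, e⟩ := e
  choose hbud c hc hm using exists_marginal hd hind hconn e
  let r : N → ℝ := fun i => c o / c i
  let q : M → ℝ := c o • p
  have hr : ∀ i, 0 < r i := fun i => div_pos (hc o) (hc i)
  have hx0 : ∀ i j, 0 ≤ x i j := fun i => (e.affordable i).1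
  have hq : ∀ j, 0 < I.sgn j * q j := fun j => by
    have := mul_pos (hc o) (price_sgn_pos hd hind e j)
    change 0 < _ * (c o * p j)
    linarith
  have hq0 : ∀ j, q j ≠ 0 := fun j h0 => by
    have := hq j
    simp [h0] at this
  have hmq : I.Marginal (fun i => (r i)⁻¹) q x := by
    intro i j k
    have : (r i)⁻¹ * q j = c i * p j := by
      change (c o / c i)⁻¹ * (c o * p j) = _
      have := (hc o).ne'
      have := (hc i).ne'
      field_simp
    change (_ → _ ≤ (r i)⁻¹ * q j) ∧ (_ → (r i)⁻¹ * q j ≤ _)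
    rw [this]
    exact hm i j k
  have halloc := allocOf_spending hind (fun i => inv_pos.2 (hr i)) hq hx0 hmq
  let v : Var N M I.Piece → ℝ := Sum.elim r (Sum.elim q (Sum.elim (I.spending q x) 0))
  refine ⟨⟨v, isClearing_spending hr hq hx0 (sum_clearing e) hmq, div_self (hc o).ne',
    fun i => ?_, rfl⟩, ⟨(c o)⁻¹, inv_pos.2 (hc o), ?_⟩, ?_⟩
  · change (market hd hind hconn).excess q (I.spending q x) i = 0
    rw [excess_eq hq0, halloc]
    have : ∀ y : M → ℝ, ∑ j, y j * q j = c o * ∑ j, y j * p j := fun y => by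
      rw [Finset.mul_sum]
      refine Finset.sum_congr rfl fun j _ => ?_
      change y j * (c o * p j) = _
      ring
    rw [this, this, hbud, sub_self]
  · exact (inv_smul_smul₀ (hc o).ne' p).symm
  · exact halloc.symm

open PieceMarket in
-- With equal allocations the spending scales like the prices, so the same pieces are empty and
-- full. As these sets determine the solution, distinct solutions are not scalings of each other.
theorem full_iff_of_scaling {o : N} {v v' : (market hd hind hconn).eqSet o}
    (h : I.scaling (toEquilibrium o v) (toEquilibrium o v')) (t : I.Piece) (β : Bool) :
    vf v.1 t = (market hd hind hconn).cap t β (vp v.1 t.2.1) ↔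
      vf v'.1 t = (market hd hind hconn).cap t β (vp v'.1 t.2.1) := by
  obtain ⟨⟨α, hα, hp⟩, hx⟩ := h
  have h1 := congrFun (allocOf_of_isClearing v.2.1).2.2.2 t
  have h2 := congrFun (allocOf_of_isClearing v'.2.1).2.2.2 t
  change vp v'.1 = α • vp v.1 at hp
  change I.allocOf (vp v'.1) (vf v'.1) = I.allocOf (vp v.1) (vf v.1) at hx
  rw [hx] at h2
  have h3 : vf v'.1 t = α * vf v.1 t := by
    rw [← h1, ← h2, spending, spending, hp, Pi.smul_apply, smul_eq_mul]
    ring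
  have h4 : (market hd hind hconn).cap t β (vp v'.1 t.2.1) =
      α * (market hd hind hconn).cap t β (vp v.1 t.2.1) := by
    rw [hp, Pi.smul_apply, smul_eq_mul, cap, cap]
    split_ifs
    · ring
    · ring
  rw [h3, h4, mul_right_inj' hα.ne']

end Count

end MannaInstance

theorem mainTheorem3 {N M : Type*} [Fintype N] [Nonempty N] [Fintype M]
    (I : MannaInstance N M)
    (hdesire : ∀ j, I.IsGood j → 1 < I.desire j)
    (hindiff : ∀ j, I.IsBad j → I.indifference j < 1)
    (hconn : I.StronglyConnected)
    (hgen : I.NoPolynomialRelation) :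
    Finite (Quotient I.scaling) ∧ Odd (Nat.card (Quotient I.scaling)) := by
  obtain ⟨o⟩ := ‹Nonempty N›
  have : Nonempty N := ⟨o⟩
  obtain ⟨j, -⟩ := hconn.brings_good o
  have : Nonempty M := ⟨j⟩
  obtain ⟨hfin, hodd, huniq⟩ := PieceMarket.Generic.odd_eqSet
    (hgen.generic (hd := hdesire) (hind := hindiff) (hconn := hconn) o)
  have hbij : Function.Bijective fun v : (MannaInstance.market hdesire hindiff hconn).eqSet o =>
      Quotient.mk I.scaling (MannaInstance.toEquilibrium o v) := by
    constructor
    · intro v v' h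
      exact Subtype.ext (huniq v.1 v.2 v'.1 v'.2
        (MannaInstance.full_iff_of_scaling (Quotient.exact h)))
    · intro e
      induction e using Quotient.inductionOn with
      | h e =>
        obtain ⟨v, hv⟩ := MannaInstance.exists_toEquilibrium o e
        exact ⟨v, Quotient.sound hv⟩
  have := hfin.to_subtype
  refine ⟨Finite.of_surjective _ hbij.surjective, ?_⟩
  rw [← Nat.card_congr (Equiv.ofBijective _ hbij)]
  exact hodd
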